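/- Let $N\ge 2$, $\mathbb R^N_+=\{x=(x',x_N)\in\mathbb R^{N-1}\times\mathbb R: x_N>0\}$, and identify $\partial\mathbb R^N_+$ with $\mathbb R^{N-1}$. A local Radon measure on a $\sigma$-compact, locally compact Hausdorff space $X$ is a continuous linear functional $\mu$ on $C_c(X)$; it has a Jordan decomposition $\mu=\mu^+-\mu^-$ into positive Radon measures, and $|\mu|=\mu^++\mu^-$. Let $\mathcal M_{loc}(X)$ be the space of these functionals, ordered by $\mu\le\nu$ iff $\mu(f)\le\nu(f)$ for all $0\le f\in C_c(X)$. Let $\mathcal M_{loc}(\overline{\mathbb R^N_+},x_N)$ be the set of $\mu\in\mathcal M_{loc}(\mathbb R^N_+)$ with $\int_\Omega x_N\,d|\mu|<\infty$ for every bounded $\Omega\subset\mathbb R^N_+$. Let $L^1_{loc}(\overline{\mathbb R^N_+})$ be the set of functions that belong to $L^1(\Omega)$ for every bounded open $\Omega\subset\mathbb R^N_+$, and let $\mathbf D_0$ be the set of restrictions to $\mathbb R^N_+$ of functions $\varphi\in C^2_c(\mathbb R^N)$ with $\varphi(x',0)=0$. Write $\varphi_N=\partial\varphi/\partial x_N$.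 For $\mu\in\mathcal M_{loc}(\overline{\mathbb R^N_+},x_N)$ and $\nu\in\mathcal M_{loc}(\partial\mathbb R^N_+)$, a function $u\in L^1_{loc}(\overline{\mathbb R^N_+})$ is a weak solution of $$\Delta u\ge\mu\ \text{ in }\mathbb R^N_+,\qquad u\le\nu\ \text{ on }\partial\mathbb R^N_+\tag{1}$$ if for every $\varphi\in\mathbf D_0$ with $\varphi\ge0$ $$\int_{\mathbb R^N_+}\varphi\,d\mu-\int_{\partial\mathbb R^N_+}\varphi_N(x',0)\,d\nu(x')\le\int_{\mathbb R^N_+}u\,\Delta\varphi\,dx ,$$ and a weak solution of $$\Delta u=\mu\ \text{ in }\mathbb R^N_+,\qquad u=\nu\ \text{ on }\partial\mathbb R^N_+\tag{2}$$ if the same relation holds with $=$ in place of $\le$ for every $\varphi\in\mathbf D_0$. Every weak solution of (1) or (2) lies in $W^{1,p}_{loc}(\mathbb R^N_+)$ for $1\le p<N/(N-1)$, so it has a Sobolev trace $u(\cdot,\epsilon)$ on each hyperplane $\{x_N=\epsilon\}$, $\epsilon>0$. If $u\in W^{1,p}_{loc}(\mathbb R^N_+)$ for some $p>1$ and $\nu\in\mathcal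 M_{loc}(\partial\mathbb R^N_+)$, then $\nu$ is the lim-trace of $u$, written $\nu=Tr(u)$, if for every $\psi\in C^2_c(\mathbb R^{N-1})$ $$\lim_{\epsilon\to0^+}\int_{\mathbb R^{N-1}}\psi(x')\,u(x',\epsilon)\,dx'=\int_{\mathbb R^{N-1}}\psi\,d\nu .$$ **Theorem.** Let $\mu_1\in\mathcal M_{loc}(\overline{\mathbb R^N_+},x_N)$, $\nu_1\in\mathcal M_{loc}(\partial\mathbb R^N_+)$, and let $u$ be a weak solution of (1) with $\mu=\mu_1$ and $\nu=\nu_1$. 1. If for every $R>0$ there exist $M>0$ and $\delta>0$ such that $u\le M$ almost everywhere on the cylinder $\{|x'|<R\}\times(0,\delta)$, then $u$ has a lim-trace on $\partial\mathbb R^N_+$. 2. If for every $R>0$ there exist $\tilde M>0$ and $\delta>0$ such that $\int_{|x'|<R}|u(x',\epsilon)|\,dx'<\tilde M$ for every $0<\epsilon<\delta$, then $u$ has a lim-trace on $\partial\mathbb R^N_+$. 3. If $u$ has a lim-trace on $\partial\mathbb R^N_+$, then $Tr(u)\le\nu_1$, and there exists a positive Radon measure $\lambda\in\mathcal M_{loc}(\overline{\mathbb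 R^N_+},x_N)$ such that $u$ is a weak solution of (2) with $\mu=\mu_1+\lambda$ and $\nu=Tr(u)$. -/

import Mathlib

open MeasureTheory Filter Topology Set
open scoped ENNReal NNReal

noncomputable section

/-- A local Radon measure on `X`, given by its Jordan decomposition: two mutually singular positive
Borel measures that are finite on compact sets. For the spaces used below (locally compact,
second countable) these pairs correspond exactly to the continuous linear functionals on
`C_c(X)`, the functional being `LocalRadonMeasure.integral`. -/
structure LocalRadonMeasure (X : Type*) [TopologicalSpace X] [MeasurableSpace X] where
  posPart : Measure X
  negPart : Measure X
  finite_posPart : IsFiniteMeasureOnCompacts posPart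
  finite_negPart : IsFiniteMeasureOnCompacts negPart
  mutuallySingular : posPart ⟂ₘ negPart

namespace LocalRadonMeasure

variable {X : Type*} [TopologicalSpace X] [MeasurableSpace X]

/-- The total variation `|μ| = μ⁺ + μ⁻`. -/
def totalVariation (μ : LocalRadonMeasure X) : Measure X := μ.posPart + μ.negPart

/-- `∫ f dμ = ∫ f dμ⁺ - ∫ f dμ⁻`. -/
def integral (μ : LocalRadonMeasure X) (f : X → ℝ) : ℝ :=
  ∫ x, f x ∂μ.posPart - ∫ x, f x ∂μ.negPart

/-- The order of functionals: `μ ≤ ν` if `μ(f) ≤ ν(f)` for all `f ∈ C_c(X)` with `f ≥ 0`. -/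
instance : LE (LocalRadonMeasure X) where
  le μ ν := ∀ f : X → ℝ, Continuous f → HasCompactSupport f → (∀ x, 0 ≤ f x) →
    μ.integral f ≤ ν.integral f

/-- `μ` is a positive Radon measure. -/
def IsPositive (μ : LocalRadonMeasure X) : Prop := μ.negPart = 0

/-- The local Radon measure `a - b`, for two positive Radon measures `a` and `b`. With the densities
`f`, `g` of `a`, `b` with respect to `a + b`, its Jordan decomposition consists of the measures with
densities `(f - g)⁺` and `(g - f)⁺` (subtraction in `ℝ≥0∞` is truncated at `0`). -/
def ofSub (a b : Measure X) [ha : IsFiniteMeasureOnCompacts a]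
    [hb : IsFiniteMeasureOnCompacts b] : LocalRadonMeasure X where
  posPart := (a + b).withDensity (fun x => a.rnDeriv (a + b) x - b.rnDeriv (a + b) x)
  negPart := (a + b).withDensity (fun x => b.rnDeriv (a + b) x - a.rnDeriv (a + b) x)
  finite_posPart := ⟨fun K hK => lt_of_le_of_lt
    (((withDensity_mono (ae_of_all _ fun _ => tsub_le_self)).trans
      (Measure.withDensity_rnDeriv_le a (a + b))) K) (ha.lt_top_of_isCompact hK)⟩
  finite_negPart := ⟨fun K hK => lt_of_le_of_lt
    (((withDensity_mono (ae_of_all _ fun _ => tsub_le_self)).trans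
      (Measure.withDensity_rnDeriv_le b (a + b))) K) (hb.lt_top_of_isCompact hK)⟩
  mutuallySingular := by
    have hs : MeasurableSet {x | a.rnDeriv (a + b) x ≤ b.rnDeriv (a + b) x} :=
      measurableSet_le (Measure.measurable_rnDeriv _ _) (Measure.measurable_rnDeriv _ _)
    refine ⟨{x | a.rnDeriv (a + b) x ≤ b.rnDeriv (a + b) x}, hs, ?_, ?_⟩
    · rw [withDensity_apply _ hs, setLIntegral_congr_fun (g := fun _ => 0) hs, lintegral_zero]
      intro x hx
      exact tsub_eq_zero_of_le hx
    · rw [withDensity_apply _ hs.compl,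
        setLIntegral_congr_fun (g := fun _ => 0) hs.compl, lintegral_zero]
      intro x hx
      exact tsub_eq_zero_of_le (le_of_lt (not_le.mp hx))

/-- The defining property of `ofSub a b`: its positive part plus `b` is its negative part
plus `a`. -/
theorem ofSub_spec (a b : Measure X) [IsFiniteMeasureOnCompacts a] [IsFiniteMeasureOnCompacts b]
    [SigmaFinite a] [SigmaFinite b] :
    (ofSub a b).posPart + b = (ofSub a b).negPart + a := by
  have key : ∀ s t : ℝ≥0∞, (s - t) + t = (t - s) + s := by
    intro s t
    rcases le_total s t with h | h
    · rw [tsub_eq_zero_of_le h, tsub_add_cancel_of_le h, zero_add]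
    · rw [tsub_eq_zero_of_le h, tsub_add_cancel_of_le h, zero_add]
  have ha : (a + b).withDensity (a.rnDeriv (a + b)) = a :=
    Measure.withDensity_rnDeriv_eq _ _ (Measure.absolutelyContinuous_of_le
      (Measure.le_add_right le_rfl))
  have hb : (a + b).withDensity (b.rnDeriv (a + b)) = b :=
    Measure.withDensity_rnDeriv_eq _ _ (Measure.absolutelyContinuous_of_le
      (Measure.le_add_left le_rfl))
  calc (ofSub a b).posPart + b
      = (ofSub a b).posPart + (a + b).withDensity (b.rnDeriv (a + b)) := by rw [hb]
    _ = (ofSub a b).negPart + (a + b).withDensity (a.rnDeriv (a + b)) := by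
        simp only [ofSub]
        rw [← withDensity_add_right _ (Measure.measurable_rnDeriv _ _),
          ← withDensity_add_right _ (Measure.measurable_rnDeriv _ _)]
        congr 1
        funext x
        exact key _ _
    _ = (ofSub a b).negPart + a := by rw [ha]

/-- The sum of two local Radon measures, as functionals. -/
instance : Add (LocalRadonMeasure X) where
  add μ ν :=
    haveI := μ.finite_posPart
    haveI := μ.finite_negPart
    haveI := ν.finite_posPart
    haveI := ν.finite_negPart
    haveI : IsFiniteMeasureOnCompacts (μ.posPart + ν.posPart) := ⟨fun K hK => by
      rw [Measure.add_apply]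
      exact ENNReal.add_lt_top.2 ⟨hK.measure_lt_top, hK.measure_lt_top⟩⟩
    haveI : IsFiniteMeasureOnCompacts (μ.negPart + ν.negPart) := ⟨fun K hK => by
      rw [Measure.add_apply]
      exact ENNReal.add_lt_top.2 ⟨hK.measure_lt_top, hK.measure_lt_top⟩⟩
    ofSub (μ.posPart + ν.posPart) (μ.negPart + ν.negPart)

end LocalRadonMeasure

namespace HalfSpaceProblem

/-- The open half-space `{x_N > 0}` of `ℝ^N`, where `N = n + 1` and `x_N` is the last coordinate. Its
boundary is identified with `ℝ^n`. -/
def halfSpace (n : ℕ) : Set (EuclideanSpace ℝ (Fin (n + 1))) := {x | 0 < x (Fin.last n)}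

/-- The point `(x', t)`. -/
def point {n : ℕ} (x' : EuclideanSpace ℝ (Fin n)) (t : ℝ) : EuclideanSpace ℝ (Fin (n + 1)) :=
  WithLp.toLp 2 (Fin.snoc (α := fun _ => ℝ) (fun i => x' i) t)

/-- The tangential part `x'` of `x = (x', x_N)`. -/
def tangential {n : ℕ} (x : EuclideanSpace ℝ (Fin (n + 1))) : EuclideanSpace ℝ (Fin n) :=
  WithLp.toLp 2 (fun i => x i.castSucc)

/-- The space `M_loc(closure of the half-space, x_N)`: the integral `∫_Ω x_N d|μ|` is finite for every
bounded subset `Ω` of the half-space. -/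
def IsWeightedLocal {n : ℕ} (μ : LocalRadonMeasure (halfSpace n)) : Prop :=
  ∀ Ω : Set (halfSpace n), Bornology.IsBounded Ω →
    ∫⁻ x in Ω, ENNReal.ofReal (x.1 (Fin.last n)) ∂μ.totalVariation < ⊤

/-- `u ∈ L¹_loc` up to the boundary: `u ∈ L¹(Ω)` for every bounded open subset `Ω` of the
half-space. -/
def LocIntegrableUpToBoundary {n : ℕ} (u : EuclideanSpace ℝ (Fin (n + 1)) → ℝ) : Prop :=
  ∀ Ω : Set (EuclideanSpace ℝ (Fin (n + 1))), IsOpen Ω → Bornology.IsBounded Ω →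
    Ω ⊆ halfSpace n → IntegrableOn u Ω volume

/-- (Extensions to `ℝ^N` of) the test functions in `D₀`: `φ ∈ C²_c(ℝ^N)` with `φ(x', 0) = 0`. -/
structure IsTest {n : ℕ} (φ : EuclideanSpace ℝ (Fin (n + 1)) → ℝ) : Prop where
  contDiff : ContDiff ℝ 2 φ
  hasCompactSupport : HasCompactSupport φ
  eq_zero : ∀ x' : EuclideanSpace ℝ (Fin n), φ (point x' 0) = 0

/-- The normal derivative `φ_N(x', 0)` at the boundary. -/
def normalDeriv {n : ℕ} (φ : EuclideanSpace ℝ (Fin (n + 1)) → ℝ) (x' : EuclideanSpace ℝ (Fin n)) :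
    ℝ :=
  fderiv ℝ φ (point x' 0) (EuclideanSpace.single (Fin.last n) 1)

/-- `u` is a weak solution of `Δu = μ` in the half-space, `u = ν` on its boundary. -/
def IsWeakSolution {n : ℕ} (μ : LocalRadonMeasure (halfSpace n))
    (ν : LocalRadonMeasure (EuclideanSpace ℝ (Fin n)))
    (u : EuclideanSpace ℝ (Fin (n + 1)) → ℝ) : Prop :=
  IsWeightedLocal μ ∧ LocIntegrableUpToBoundary u ∧
    ∀ φ : EuclideanSpace ℝ (Fin (n + 1)) → ℝ, IsTest φ →
      μ.integral (fun x => φ x) - ν.integral (normalDeriv φ) =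
        ∫ x in halfSpace n, u x * Laplacian.laplacian φ x

/-- `u` is a weak solution of `Δu ≥ μ` in the half-space, `u ≤ ν` on its boundary. -/
def IsWeakSubsolution {n : ℕ} (μ : LocalRadonMeasure (halfSpace n))
    (ν : LocalRadonMeasure (EuclideanSpace ℝ (Fin n)))
    (u : EuclideanSpace ℝ (Fin (n + 1)) → ℝ) : Prop :=
  IsWeightedLocal μ ∧ LocIntegrableUpToBoundary u ∧
    ∀ φ : EuclideanSpace ℝ (Fin (n + 1)) → ℝ, IsTest φ → (∀ x ∈ halfSpace n, 0 ≤ φ x) →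
      μ.integral (fun x => φ x) - ν.integral (normalDeriv φ) ≤
        ∫ x in halfSpace n, u x * Laplacian.laplacian φ x

/-- `u ∈ W^{1,p}_loc` of the half-space, with weak gradient `G`. -/
structure IsW1pLoc {n : ℕ} (p : ℝ≥0) (u : EuclideanSpace ℝ (Fin (n + 1)) → ℝ)
    (G : EuclideanSpace ℝ (Fin (n + 1)) → EuclideanSpace ℝ (Fin (n + 1))) : Prop where
  memLp : ∀ K : Set (EuclideanSpace ℝ (Fin (n + 1))), IsCompact K → K ⊆ halfSpace n →
    MemLp u p (volume.restrict K)
  memLp_grad : ∀ K : Set (EuclideanSpace ℝ (Fin (n + 1))), IsCompact K → K ⊆ halfSpace n →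
    MemLp G p (volume.restrict K)
  weak_grad : ∀ φ : EuclideanSpace ℝ (Fin (n + 1)) → ℝ, ContDiff ℝ (⊤ : ℕ∞) φ → HasCompactSupport φ →
    tsupport φ ⊆ halfSpace n → ∀ i : Fin (n + 1),
      ∫ x in halfSpace n, u x * fderiv ℝ φ x (EuclideanSpace.single i 1) =
        -∫ x in halfSpace n, G x i * φ x

/-- `g` is the Sobolev trace of `u ∈ W^{1,p}_loc` on the hyperplane `{x_N = ε}`: some `C¹` functions
`w k` converge to `u` in `W^{1,p}(K)` for every compact subset `K` of the half-space, and their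
restrictions to the hyperplane converge to `g` in `L^p_loc`. -/
def IsSobolevTrace {n : ℕ} (p : ℝ≥0) (u : EuclideanSpace ℝ (Fin (n + 1)) → ℝ) (ε : ℝ)
    (g : EuclideanSpace ℝ (Fin n) → ℝ) : Prop :=
  (∀ R : ℝ, MemLp g p (volume.restrict (Metric.ball 0 R))) ∧
  ∃ G : EuclideanSpace ℝ (Fin (n + 1)) → EuclideanSpace ℝ (Fin (n + 1)), IsW1pLoc p u G ∧
  ∃ w : ℕ → EuclideanSpace ℝ (Fin (n + 1)) → ℝ,
    (∀ k, ContDiffOn ℝ 1 (w k) (halfSpace n)) ∧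
    (∀ K : Set (EuclideanSpace ℝ (Fin (n + 1))), IsCompact K → K ⊆ halfSpace n →
      Tendsto (fun k => eLpNorm (fun x => w k x - u x) p (volume.restrict K)) atTop (𝓝 0) ∧
      Tendsto (fun k => eLpNorm (fun x => gradient (w k) x - G x) p (volume.restrict K))
        atTop (𝓝 0)) ∧
    ∀ R : ℝ, Tendsto (fun k => eLpNorm (fun x' => w k (point x' ε) - g x') p
      (volume.restrict (Metric.ball 0 R))) atTop (𝓝 0)

/-- `ν` is the lim-trace `Tr(u)` of `u` on the boundary of the half-space: `u ∈ W^{1,p}_loc` for some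
`p > 1` and, `U ε` being the Sobolev trace of `u` on `{x_N = ε}`, the integrals `∫ ψ (U ε)` converge
to `∫ ψ dν` as `ε → 0⁺`, for every `ψ ∈ C²_c`. -/
def HasLimTrace {n : ℕ} (u : EuclideanSpace ℝ (Fin (n + 1)) → ℝ)
    (ν : LocalRadonMeasure (EuclideanSpace ℝ (Fin n))) : Prop :=
  ∃ p : ℝ≥0, 1 < p ∧ (∃ G, IsW1pLoc p u G) ∧
    ∃ U : ℝ → EuclideanSpace ℝ (Fin n) → ℝ, (∀ ε > 0, IsSobolevTrace p u ε (U ε)) ∧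
      ∀ ψ : EuclideanSpace ℝ (Fin n) → ℝ, ContDiff ℝ 2 ψ → HasCompactSupport ψ →
        Tendsto (fun ε => ∫ x', ψ x' * U ε x') (𝓝[>] 0) (𝓝 (ν.integral ψ))

end HalfSpaceProblem

end

/-!
# Lim-traces of weak subsolutions in the half-space

*The defect of a subsolution is a measure.* For a weak subsolution `u` of `Δu ≥ μ`, `u ≤ ν`, the
difference of the two sides of the defining inequality is a linear functional on the test
functions `φ` that is nonnegative for `φ ≥ 0`. The quotients `φ / x_N` extend continuously to the
boundary, with the value `φ_N` there, and form a space of compactly supported continuous functions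
on the closed half-space in which every such function has a majorant. So the functional extends to
a positive functional on that `C_c`, which is a measure `σ` by the Riesz–Markov–Kakutani theorem
(`exists_measure_of_nonneg`). The part of `σ` in the open half-space, divided by `x_N`, is a
positive measure `λ`, and the part of `σ` on the boundary is a positive measure `κ`; thus `u` is a
weak solution of `Δu = μ + λ`, `u = ν - κ` (`IsWeakSubsolution.exists_isWeakSolution`).

*A weak solution has traces, and they converge.* Let `u` be a weak solution of `Δu = m`, `u = ν₀`.

* There are mollifiers `ρ_j` at scale `2^{-j}` with `ρ_{j+1} - ρ_j = Δk_j`, where `k_j` is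
  supported at scale `2^{-j}`, the gradient of `k_j` being the difference of two truncations of
  the gradient of the fundamental solution (`exists_mollifier_laplacian`, `DyadicMollifier`). The
  function `y ↦ k_j(x - y)` is a test function if `x` is at distance more than `2^{-j}` from the
  boundary, and the equation shows that the mollifications `w_j` of `u` satisfy `w_{j+1} - w_j =
  k_j * m` (`DyadicMollifier.mollify_succ_sub`). Interpolation between `L^∞` and `L¹`
  (`eLpNorm_potential_le`) makes these increments decay geometrically for `p = 1 + 1/N`, in
  `W^{1,p}` on compact subsets of the half-space and in `L^p` on bounded subsets of hyperplanes
  (`DyadicMollifier.exists_bounds`). Hence `u ∈ W^{1,p}_loc`, and the restrictions of `w_j` to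
  `{x_N = ε}` converge to a Sobolev trace (`IsWeakSolution.exists_isSobolevTrace`).
* Test the equation with `ψ(x') θ(x_N)`, where `θ` is a smooth version of `t ↦ min t ε`. The
  normal derivative at the boundary is `ψ`, the second derivative of `θ` reproduces minus the
  trace at height `ε` (`IsSobolevTrace.exists_layer`), and the remaining terms tend to `0` with
  `ε`. So the traces converge to `ν₀` (`IsWeakSolution.tendsto_trace`).

Consequently every weak subsolution has the lim-trace `ν₀ = ν - κ`. The limit does not depend on
the choice of Sobolev traces, so any lim-trace agrees with `ν₀` on `C²_c`, hence on `C_c`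
(`integral_eq_of_forall_contDiff`). It is therefore at most `ν`, and it can replace `ν₀` as the
boundary value in the equation.
-/

noncomputable section

namespace HalfSpaceProblem

/-! ### Coordinates of the half-space -/

variable {n : ℕ}

theorem point_last (x' : EuclideanSpace ℝ (Fin n)) (t : ℝ) : point x' t (Fin.last n) = t := by
  simp [point]

theorem point_castSucc (x' : EuclideanSpace ℝ (Fin n)) (t : ℝ) (i : Fin n) :
    point x' t i.castSucc = x' i := by
  simp [point]

theorem tangential_point (x' : EuclideanSpace ℝ (Fin n)) (t : ℝ) :
    tangential (point x' t) = x' := by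
  ext i
  simp [point, tangential]

theorem point_tangential (x : EuclideanSpace ℝ (Fin (n + 1))) :
    point (tangential x) (x (Fin.last n)) = x := by
  ext i
  refine Fin.lastCases ?_ (fun i => ?_) i
  · rw [point_last]
  · rw [point_castSucc]; rfl

/-- The unit vector in the direction of the last coordinate. -/
def normalVector (n : ℕ) : EuclideanSpace ℝ (Fin (n + 1)) :=
  EuclideanSpace.single (Fin.last n) 1

theorem point_add_smul_normalVector (x' : EuclideanSpace ℝ (Fin n)) (t s : ℝ) :
    point x' t + s • normalVector n = point x' (t + s) := by
  ext i
  refine Fin.lastCases ?_ (fun i => ?_) i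
  · simp [normalVector, point_last]
  · have : i.castSucc ≠ Fin.last n := (Fin.castSucc_lt_last i).ne
    simp [normalVector, point_castSucc, this]

/-- The identification of `ℝ^n × ℝ` with `ℝ^(n+1)`, as a continuous linear equivalence. -/
def pointCLE (n : ℕ) :
    (EuclideanSpace ℝ (Fin n) × ℝ) ≃L[ℝ] EuclideanSpace ℝ (Fin (n + 1)) :=
  LinearEquiv.toContinuousLinearEquiv
    { toFun := fun p => point p.1 p.2
      invFun := fun x => (tangential x, x (Fin.last n))
      left_inv := fun p => by simp [tangential_point, point_last]
      right_inv := fun x => point_tangential x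
      map_add' := fun p q => by
        ext i
        refine Fin.lastCases ?_ (fun i => ?_) i
        · simp [point_last]
        · simp [point_castSucc]
      map_smul' := fun c p => by
        ext i
        refine Fin.lastCases ?_ (fun i => ?_) i
        · simp [point_last]
        · simp [point_castSucc] }

theorem pointCLE_apply (p : EuclideanSpace ℝ (Fin n) × ℝ) : pointCLE n p = point p.1 p.2 := rfl

theorem contDiff_tangential {m : WithTop ℕ∞} :
    ContDiff ℝ m (tangential : EuclideanSpace ℝ (Fin (n + 1)) → _) :=
  (pointCLE n).symm.contDiff.fst

theorem contDiff_last {m : WithTop ℕ∞} :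
    ContDiff ℝ m (fun x : EuclideanSpace ℝ (Fin (n + 1)) => x (Fin.last n)) :=
  (pointCLE n).symm.contDiff.snd

theorem continuous_last :
    Continuous (fun x : EuclideanSpace ℝ (Fin (n + 1)) => x (Fin.last n)) :=
  (contDiff_last (m := 0)).continuous

theorem continuous_point (t : ℝ) :
    Continuous (fun x' : EuclideanSpace ℝ (Fin n) => point x' t) :=
  (pointCLE n).continuous.comp (Continuous.prodMk_left t)

theorem isOpen_halfSpace : IsOpen (halfSpace n) := isOpen_lt continuous_const continuous_last

theorem measurableSet_halfSpace : MeasurableSet (halfSpace n) := isOpen_halfSpace.measurableSet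

theorem norm_sq_eq (x : EuclideanSpace ℝ (Fin (n + 1))) :
    ‖x‖ ^ 2 = ‖tangential x‖ ^ 2 + x (Fin.last n) ^ 2 := by
  rw [EuclideanSpace.norm_sq_eq, EuclideanSpace.norm_sq_eq, Fin.sum_univ_castSucc]
  simp [tangential]

theorem norm_tangential_le (x : EuclideanSpace ℝ (Fin (n + 1))) : ‖tangential x‖ ≤ ‖x‖ := by
  apply le_of_sq_le_sq _ (norm_nonneg x)
  rw [norm_sq_eq x]; nlinarith [sq_nonneg (x (Fin.last n))]

theorem norm_le_norm_point (x' : EuclideanSpace ℝ (Fin n)) (t : ℝ) : ‖x'‖ ≤ ‖point x' t‖ := by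
  simpa [tangential_point] using norm_tangential_le (point x' t)

theorem measurePreserving_pointCLE :
    MeasurePreserving (pointCLE n) (volume.prod volume) volume := by
  have h1 : MeasurePreserving (fun p : (Fin n → ℝ) × ℝ => (p.2, p.1))
      (volume.prod volume) (volume.prod volume) := Measure.measurePreserving_swap
  have h2 := (volume_preserving_piFinSuccAbove (fun _ : Fin (n + 1) => ℝ) (Fin.last n)).symm
  have h3 := PiLp.volume_preserving_toLp (Fin (n + 1))
  have h0 : MeasurePreserving (fun p : EuclideanSpace ℝ (Fin n) × ℝ => (WithLp.ofLp p.1, p.2))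
      (volume.prod volume) (volume.prod volume) :=
    (PiLp.volume_preserving_ofLp (Fin n)).prod (MeasurePreserving.id volume)
  refine (congrArg (fun f => MeasurePreserving f (volume.prod volume) volume) ?_).mpr
    (h3.comp (h2.comp (h1.comp h0)))
  funext p
  ext i
  refine Fin.lastCases ?_ (fun i => ?_) i
  · simp [pointCLE_apply, point, MeasurableEquiv.piFinSuccAbove]
  · simp [pointCLE_apply, point, MeasurableEquiv.piFinSuccAbove]

theorem measurableEmbedding_pointCLE : MeasurableEmbedding (pointCLE n) :=
  (pointCLE n).toHomeomorph.measurableEmbedding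

/-! ### The Laplacian in coordinates -/

variable {d : ℕ}

theorem differentiable_fderiv_apply {E : Type*} [NormedAddCommGroup E] [NormedSpace ℝ E]
    {φ : E → ℝ} (hφ : ContDiff ℝ 2 φ) (v : E) : Differentiable ℝ (fun y => fderiv ℝ φ y v) :=
  ((hφ.fderiv_right (m := 1) (by norm_num)).clm_apply contDiff_const).differentiable one_ne_zero

theorem laplacian_eq_sum_fderiv {φ : EuclideanSpace ℝ (Fin d) → ℝ} (hφ : ContDiff ℝ 2 φ)
    (x : EuclideanSpace ℝ (Fin d)) :
    Laplacian.laplacian φ x = ∑ i, fderiv ℝ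
      (fun y => fderiv ℝ φ y (EuclideanSpace.single i 1)) x (EuclideanSpace.single i 1) := by
  rw [InnerProductSpace.laplacian_eq_iteratedFDeriv_orthonormalBasis φ
    (EuclideanSpace.basisFun (Fin d) ℝ)]
  refine Finset.sum_congr rfl fun i _ => ?_
  have h : DifferentiableAt ℝ (fderiv ℝ φ) x :=
    ((hφ.fderiv_right (m := 1) (by norm_num)).differentiable one_ne_zero) x
  rw [iteratedFDeriv_two_apply, fderiv_clm_apply h (differentiableAt_const _)]
  simp

theorem continuous_laplacian {φ : EuclideanSpace ℝ (Fin d) → ℝ} (hφ : ContDiff ℝ 2 φ) :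
    Continuous (Laplacian.laplacian φ) := by
  rw [funext (laplacian_eq_sum_fderiv hφ)]
  refine continuous_finsetSum _ fun i _ => ?_
  have h1 : ContDiff ℝ 1 (fun y => fderiv ℝ φ y (EuclideanSpace.single i 1)) :=
    (hφ.fderiv_right (m := 1) (by norm_num)).clm_apply contDiff_const
  exact (h1.continuous_fderiv one_ne_zero).clm_apply continuous_const

theorem laplacian_eq_zero_of_notMem_tsupport {φ : EuclideanSpace ℝ (Fin d) → ℝ}
    {x : EuclideanSpace ℝ (Fin d)} (hx : x ∉ tsupport φ) : Laplacian.laplacian φ x = 0 := by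
  have h : φ =ᶠ[𝓝 x] fun _ => 0 := notMem_tsupport_iff_eventuallyEq.1 hx
  rw [(InnerProductSpace.laplacian_congr_nhds h).eq_of_nhds]
  simp

theorem hasCompactSupport_laplacian {φ : EuclideanSpace ℝ (Fin d) → ℝ}
    (hφ : HasCompactSupport φ) : HasCompactSupport (Laplacian.laplacian φ) :=
  HasCompactSupport.of_support_subset_isCompact hφ.isCompact fun _ hx => by
    by_contra h
    exact hx (laplacian_eq_zero_of_notMem_tsupport h)

theorem fderiv_comp_smul_add {E : Type*} [NormedAddCommGroup E] [NormedSpace ℝ E] {φ : E → ℝ}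
    (hφ : Differentiable ℝ φ) (c : ℝ) (b x v : E) :
    fderiv ℝ (fun y => φ (c • y + b)) x v = c * fderiv ℝ φ (c • x + b) v := by
  have h1 : HasFDerivAt (fun y : E => c • y + b) (c • ContinuousLinearMap.id ℝ E) x :=
    ((hasFDerivAt_id x).const_smul c).add_const b
  have h2 := (hφ (c • x + b)).hasFDerivAt.comp x h1
  have h3 : (φ ∘ fun y : E => c • y + b) = fun y => φ (c • y + b) := rfl
  rw [← h3, h2.fderiv]
  simp

theorem laplacian_comp_smul_add {φ : EuclideanSpace ℝ (Fin d) → ℝ} (hφ : ContDiff ℝ 2 φ) (c : ℝ)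
    (b x : EuclideanSpace ℝ (Fin d)) :
    Laplacian.laplacian (fun y => φ (c • y + b)) x =
      c ^ 2 * Laplacian.laplacian φ (c • x + b) := by
  have hc : ContDiff ℝ 2 (fun y => φ (c • y + b)) :=
    hφ.comp ((contDiff_const_smul c).add contDiff_const)
  rw [laplacian_eq_sum_fderiv hc, laplacian_eq_sum_fderiv hφ, Finset.mul_sum]
  refine Finset.sum_congr rfl fun i _ => ?_
  have h : (fun y => fderiv ℝ (fun y => φ (c • y + b)) y (EuclideanSpace.single i 1)) =
      fun y => c * (fun z => fderiv ℝ φ z (EuclideanSpace.single i 1)) (c • y + b) := by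
    funext y
    exact fderiv_comp_smul_add (hφ.differentiable two_ne_zero) c b y _
  have hd := differentiable_fderiv_apply hφ (EuclideanSpace.single i (1 : ℝ))
  rw [h, fderiv_const_mul]
  · rw [_root_.smul_apply, fderiv_comp_smul_add hd, smul_eq_mul]
    ring
  · exact (hd.comp ((differentiable_id.const_smul c).add_const b)) x

/-- The Laplacian of a radial function, written as a function of `‖x‖²`. -/
theorem laplacian_comp_norm_sq {κ κ₁ κ₂ : ℝ → ℝ} (hκ : ContDiff ℝ 2 κ)
    (h1 : ∀ s, HasDerivAt κ (κ₁ s) s) (h2 : ∀ s, HasDerivAt κ₁ (κ₂ s) s)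
    (x : EuclideanSpace ℝ (Fin d)) :
    Laplacian.laplacian (fun y : EuclideanSpace ℝ (Fin d) => κ (‖y‖ ^ 2)) x =
      4 * ‖x‖ ^ 2 * κ₂ (‖x‖ ^ 2) + 2 * d * κ₁ (‖x‖ ^ 2) := by
  have hc : ContDiff ℝ 2 (fun y : EuclideanSpace ℝ (Fin d) => κ (‖y‖ ^ 2)) :=
    hκ.comp (contDiff_norm_sq ℝ)
  have hn : ∀ (y : EuclideanSpace ℝ (Fin d)),
      HasFDerivAt (fun y : EuclideanSpace ℝ (Fin d) => ‖y‖ ^ 2) (2 • innerSL ℝ y) y :=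
    fun y => (hasStrictFDerivAt_norm_sq y).hasFDerivAt
  have hfirst : ∀ (i : Fin d) (y : EuclideanSpace ℝ (Fin d)),
      fderiv ℝ (fun y : EuclideanSpace ℝ (Fin d) => κ (‖y‖ ^ 2)) y
        (EuclideanSpace.single i 1) = κ₁ (‖y‖ ^ 2) * (2 * y i) := by
    intro i y
    have := (h1 (‖y‖ ^ 2)).comp_hasFDerivAt y (hn y)
    have h3 : (κ ∘ fun y : EuclideanSpace ℝ (Fin d) => ‖y‖ ^ 2) =
      fun y : EuclideanSpace ℝ (Fin d) => κ (‖y‖ ^ 2) := rfl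
    rw [← h3, this.fderiv]
    simp [EuclideanSpace.inner_single_right]
  rw [laplacian_eq_sum_fderiv hc]
  have hsecond : ∀ i : Fin d, fderiv ℝ (fun y => fderiv ℝ
      (fun y : EuclideanSpace ℝ (Fin d) => κ (‖y‖ ^ 2)) y (EuclideanSpace.single i 1)) x
        (EuclideanSpace.single i 1) = 4 * κ₂ (‖x‖ ^ 2) * x i ^ 2 + 2 * κ₁ (‖x‖ ^ 2) := by
    intro i
    have hx1 := (h2 (‖x‖ ^ 2)).comp_hasFDerivAt x (hn x)
    have hx2 : HasFDerivAt (fun y : EuclideanSpace ℝ (Fin d) => 2 * y i)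
        ((2 : ℝ) • (EuclideanSpace.proj i : EuclideanSpace ℝ (Fin d) →L[ℝ] ℝ)) x :=
      (EuclideanSpace.proj i : EuclideanSpace ℝ (Fin d) →L[ℝ] ℝ).hasFDerivAt.const_mul 2
    have hx3 := hx1.mul hx2
    rw [funext (hfirst i)]
    refine (congrArg (fun L => L (EuclideanSpace.single i (1 : ℝ))) hx3.fderiv).trans ?_
    simp [EuclideanSpace.inner_single_right]
    ring
  simp_rw [hsecond]
  rw [Finset.sum_add_distrib, ← Finset.mul_sum, EuclideanSpace.norm_sq_eq]
  simp
  ring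

/-- The Laplacian of the product of `Ψ` with a function of the last coordinate. -/
theorem laplacian_mul_comp_last {Ψ : EuclideanSpace ℝ (Fin (n + 1)) → ℝ} {θ θ₁ θ₂ : ℝ → ℝ}
    (hΨ : ContDiff ℝ 2 Ψ) (hθ : ContDiff ℝ 2 θ)
    (h1 : ∀ s, HasDerivAt θ (θ₁ s) s) (h2 : ∀ s, HasDerivAt θ₁ (θ₂ s) s)
    (x : EuclideanSpace ℝ (Fin (n + 1))) :
    Laplacian.laplacian (fun y => Ψ y * θ (y (Fin.last n))) x =
      Laplacian.laplacian Ψ x * θ (x (Fin.last n)) +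
        2 * fderiv ℝ Ψ x (normalVector n) * θ₁ (x (Fin.last n)) +
        Ψ x * θ₂ (x (Fin.last n)) := by
  have hlast : ∀ (y : EuclideanSpace ℝ (Fin (n + 1))),
      HasFDerivAt (fun y : EuclideanSpace ℝ (Fin (n + 1)) => y (Fin.last n))
        (EuclideanSpace.proj (Fin.last n) : EuclideanSpace ℝ (Fin (n + 1)) →L[ℝ] ℝ) y :=
    fun y => (EuclideanSpace.proj (Fin.last n) :
      EuclideanSpace ℝ (Fin (n + 1)) →L[ℝ] ℝ).hasFDerivAt
  have hfirst : ∀ (i : Fin (n + 1)) (y : EuclideanSpace ℝ (Fin (n + 1))),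
      fderiv ℝ (fun y => Ψ y * θ (y (Fin.last n))) y (EuclideanSpace.single i 1) =
        fderiv ℝ Ψ y (EuclideanSpace.single i 1) * θ (y (Fin.last n)) +
        Ψ y * θ₁ (y (Fin.last n)) * (EuclideanSpace.single i (1 : ℝ)) (Fin.last n) := by
    intro i y
    have ha := (h1 (y (Fin.last n))).comp_hasFDerivAt y (hlast y)
    have hb := (hΨ.differentiable two_ne_zero y).hasFDerivAt.mul ha
    refine (congrArg (fun L => L (EuclideanSpace.single i (1 : ℝ))) hb.fderiv).trans ?_
    simp
    ring
  have hc : ContDiff ℝ 2 (fun y => Ψ y * θ (y (Fin.last n))) := hΨ.mul (hθ.comp contDiff_last)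
  rw [laplacian_eq_sum_fderiv hc, laplacian_eq_sum_fderiv hΨ]
  have hsecond : ∀ i : Fin (n + 1), fderiv ℝ (fun y => fderiv ℝ
      (fun y => Ψ y * θ (y (Fin.last n))) y (EuclideanSpace.single i 1)) x
        (EuclideanSpace.single i 1) =
      fderiv ℝ (fun y => fderiv ℝ Ψ y (EuclideanSpace.single i 1)) x
        (EuclideanSpace.single i 1) * θ (x (Fin.last n)) +
      2 * fderiv ℝ Ψ x (EuclideanSpace.single i 1) * θ₁ (x (Fin.last n)) *
        (EuclideanSpace.single i (1 : ℝ)) (Fin.last n) +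
      Ψ x * θ₂ (x (Fin.last n)) * ((EuclideanSpace.single i (1 : ℝ)) (Fin.last n)) ^ 2 := by
    intro i
    have ha := (h1 (x (Fin.last n))).comp_hasFDerivAt x (hlast x)
    have hb := (h2 (x (Fin.last n))).comp_hasFDerivAt x (hlast x)
    have hd := (differentiable_fderiv_apply hΨ (EuclideanSpace.single i (1 : ℝ)) x).hasFDerivAt
    have he := (hd.mul ha).add
      (((hΨ.differentiable two_ne_zero x).hasFDerivAt.mul hb).mul_const
        ((EuclideanSpace.single i (1 : ℝ)) (Fin.last n)))
    rw [funext (hfirst i)]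
    refine (congrArg (fun L => L (EuclideanSpace.single i (1 : ℝ))) he.fderiv).trans ?_
    rcases eq_or_ne (Fin.last n) i with rfl | hi
    · simp
      ring
    · simp [hi]
      ring
  simp_rw [hsecond]
  rw [Finset.sum_add_distrib, Finset.sum_add_distrib, Finset.sum_mul]
  congr 1
  · congr 1
    rw [Finset.sum_eq_single (Fin.last n)]
    · simp [normalVector]
    · intro b _ hb
      simp [hb.symm]
    · simp
  · rw [Finset.sum_eq_single (Fin.last n)]
    · simp
    · intro b _ hb
      simp [hb.symm]
    · simp

end HalfSpaceProblem

namespace LocalRadonMeasure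

/-! ### Sums and differences of local Radon measures -/

variable {X : Type*} [TopologicalSpace X] [MeasurableSpace X]

theorem ofSub_posPart_le (a b : Measure X) [IsFiniteMeasureOnCompacts a]
    [IsFiniteMeasureOnCompacts b] : (ofSub a b).posPart ≤ a :=
  (withDensity_mono (ae_of_all _ fun _ => tsub_le_self)).trans
    (Measure.withDensity_rnDeriv_le a (a + b))

theorem ofSub_negPart_le (a b : Measure X) [IsFiniteMeasureOnCompacts a]
    [IsFiniteMeasureOnCompacts b] : (ofSub a b).negPart ≤ b :=
  (withDensity_mono (ae_of_all _ fun _ => tsub_le_self)).trans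
    (Measure.withDensity_rnDeriv_le b (a + b))

theorem integral_ofSub (a b : Measure X) [IsFiniteMeasureOnCompacts a]
    [IsFiniteMeasureOnCompacts b] [SigmaFinite a] [SigmaFinite b] {f : X → ℝ}
    (ha : Integrable f a) (hb : Integrable f b) :
    (ofSub a b).integral f = ∫ x, f x ∂a - ∫ x, f x ∂b := by
  have h := congrArg (fun m => ∫ x, f x ∂m) (ofSub_spec a b)
  rw [integral_add_measure (ha.mono_measure (ofSub_posPart_le a b)) hb,
    integral_add_measure (hb.mono_measure (ofSub_negPart_le a b)) ha] at h
  unfold integral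
  linarith

theorem posPart_le_totalVariation (μ : LocalRadonMeasure X) : μ.posPart ≤ μ.totalVariation :=
  Measure.le_add_right le_rfl

theorem negPart_le_totalVariation (μ : LocalRadonMeasure X) : μ.negPart ≤ μ.totalVariation :=
  Measure.le_add_left le_rfl

theorem abs_integral_le (μ : LocalRadonMeasure X) {f : X → ℝ}
    (hf : Integrable f μ.totalVariation) :
    |μ.integral f| ≤ ∫ x, |f x| ∂μ.totalVariation := by
  have h1 := hf.mono_measure μ.posPart_le_totalVariation
  have h2 := hf.mono_measure μ.negPart_le_totalVariation
  unfold totalVariation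
  rw [integral_add_measure h1.abs h2.abs]
  exact (abs_sub _ _).trans (add_le_add (abs_integral_le_integral_abs)
    (abs_integral_le_integral_abs))

instance (μ : LocalRadonMeasure X) : IsFiniteMeasureOnCompacts μ.posPart := μ.finite_posPart

instance (μ : LocalRadonMeasure X) : IsFiniteMeasureOnCompacts μ.negPart := μ.finite_negPart

theorem isFiniteMeasureOnCompacts_add (a b : Measure X) [IsFiniteMeasureOnCompacts a]
    [IsFiniteMeasureOnCompacts b] : IsFiniteMeasureOnCompacts (a + b) := ⟨fun K hK => by
  rw [Measure.add_apply]
  exact ENNReal.add_lt_top.2 ⟨hK.measure_lt_top, hK.measure_lt_top⟩⟩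

theorem sigmaFinite_of_isFiniteMeasureOnCompacts [LocallyCompactSpace X]
    [SecondCountableTopology X] [OpensMeasurableSpace X] (a : Measure X)
    [IsFiniteMeasureOnCompacts a] : SigmaFinite a := by
  have : IsLocallyFiniteMeasure a := isLocallyFiniteMeasure_of_isFiniteMeasureOnCompacts
  infer_instance

theorem add_posPart_le (μ ν : LocalRadonMeasure X) :
    (μ + ν).posPart ≤ μ.posPart + ν.posPart :=
  haveI := isFiniteMeasureOnCompacts_add μ.posPart ν.posPart
  haveI := isFiniteMeasureOnCompacts_add μ.negPart ν.negPart
  ofSub_posPart_le (μ.posPart + ν.posPart) (μ.negPart + ν.negPart)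

theorem add_negPart_le (μ ν : LocalRadonMeasure X) :
    (μ + ν).negPart ≤ μ.negPart + ν.negPart :=
  haveI := isFiniteMeasureOnCompacts_add μ.posPart ν.posPart
  haveI := isFiniteMeasureOnCompacts_add μ.negPart ν.negPart
  ofSub_negPart_le (μ.posPart + ν.posPart) (μ.negPart + ν.negPart)

theorem add_totalVariation_le (μ ν : LocalRadonMeasure X) :
    (μ + ν).totalVariation ≤ μ.totalVariation + ν.totalVariation := by
  refine (add_le_add (add_posPart_le μ ν) (add_negPart_le μ ν)).trans (le_of_eq ?_)
  unfold totalVariation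
  abel

theorem integral_add [LocallyCompactSpace X] [SecondCountableTopology X] [OpensMeasurableSpace X]
    (μ ν : LocalRadonMeasure X) {f : X → ℝ} (hμ : Integrable f μ.totalVariation)
    (hν : Integrable f ν.totalVariation) :
    (μ + ν).integral f = μ.integral f + ν.integral f := by
  have i1 := isFiniteMeasureOnCompacts_add μ.posPart ν.posPart
  have i2 := isFiniteMeasureOnCompacts_add μ.negPart ν.negPart
  have i3 := sigmaFinite_of_isFiniteMeasureOnCompacts (μ.posPart + ν.posPart)
  have i4 := sigmaFinite_of_isFiniteMeasureOnCompacts (μ.negPart + ν.negPart)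
  have h1 := hμ.mono_measure μ.posPart_le_totalVariation
  have h2 := hμ.mono_measure μ.negPart_le_totalVariation
  have h3 := hν.mono_measure ν.posPart_le_totalVariation
  have h4 := hν.mono_measure ν.negPart_le_totalVariation
  refine (integral_ofSub (μ.posPart + ν.posPart) (μ.negPart + ν.negPart)
    (h1.add_measure h3) (h2.add_measure h4)).trans ?_
  rw [integral_add_measure h1 h3, integral_add_measure h2 h4]
  unfold integral
  ring

end LocalRadonMeasure

namespace HalfSpaceProblem

/-! ### Test functions -/

variable {n : ℕ}

instance : LocallyCompactSpace (halfSpace n) := isOpen_halfSpace.locallyCompactSpace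

/-- For a test function `φ`, the function equal to `φ / x_N` off the boundary and to `φ_N` on the
boundary. The integral formula shows that it is continuous. -/
def divLast (φ : EuclideanSpace ℝ (Fin (n + 1)) → ℝ) (x : EuclideanSpace ℝ (Fin (n + 1))) : ℝ :=
  ∫ s in (0 : ℝ)..1, fderiv ℝ φ (point (tangential x) (s * x (Fin.last n))) (normalVector n)

theorem continuous_divLast {φ : EuclideanSpace ℝ (Fin (n + 1)) → ℝ} (hφ : ContDiff ℝ 1 φ) :
    Continuous (divLast φ) := by
  apply intervalIntegral.continuous_parametric_intervalIntegral_of_continuous'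
  apply ((hφ.continuous_fderiv one_ne_zero).comp _).clm_apply continuous_const
  have h1 : Continuous (tangential : EuclideanSpace ℝ (Fin (n + 1)) → _) :=
    (contDiff_tangential (m := 0)).continuous
  exact (pointCLE n).continuous.comp ((h1.comp continuous_fst).prodMk
    (continuous_snd.mul (continuous_last.comp continuous_fst)))

theorem divLast_point_zero (φ : EuclideanSpace ℝ (Fin (n + 1)) → ℝ)
    (x' : EuclideanSpace ℝ (Fin n)) : divLast φ (point x' 0) = normalDeriv φ x' := by
  simp [divLast, point_last, tangential_point, normalDeriv, normalVector]

theorem hasDerivAt_comp_point {φ : EuclideanSpace ℝ (Fin (n + 1)) → ℝ}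
    (x' : EuclideanSpace ℝ (Fin n)) (t : ℝ) (hφ : DifferentiableAt ℝ φ (point x' t)) :
    HasDerivAt (fun t => φ (point x' t)) (fderiv ℝ φ (point x' t) (normalVector n)) t := by
  have h1 : HasDerivAt (fun s : ℝ => point x' 0 + s • normalVector n) (normalVector n) t := by
    simpa using ((hasDerivAt_id t).smul_const (normalVector n)).const_add (point x' 0)
  have h2 : (fun s : ℝ => point x' 0 + s • normalVector n) = fun s => point x' s := by
    funext s
    rw [point_add_smul_normalVector, zero_add]
  rw [h2] at h1
  exact hφ.hasFDerivAt.comp_hasDerivAt t h1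

theorem last_mul_divLast {φ : EuclideanSpace ℝ (Fin (n + 1)) → ℝ} (hφ : ContDiff ℝ 1 φ)
    (h0 : ∀ x', φ (point x' 0) = 0) (x : EuclideanSpace ℝ (Fin (n + 1))) :
    x (Fin.last n) * divLast φ x = φ x := by
  set t := x (Fin.last n) with ht
  have h1 : ∀ s ∈ uIcc (0 : ℝ) 1, HasDerivAt (fun s => φ (point (tangential x) (s * t)))
      (fderiv ℝ φ (point (tangential x) (s * t)) (normalVector n) * t) s := by
    intro s _
    have := (hasDerivAt_comp_point (tangential x) (s * t)
      (hφ.differentiable one_ne_zero _)).comp s ((hasDerivAt_id s).mul_const t)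
    simpa [Function.comp_def] using this
  have hcont : Continuous fun s : ℝ =>
      fderiv ℝ φ (point (tangential x) (s * t)) (normalVector n) * t :=
    (((hφ.continuous_fderiv one_ne_zero).comp ((pointCLE n).continuous.comp
      (continuous_const.prodMk (continuous_id.mul continuous_const)))).clm_apply
      continuous_const).mul continuous_const
  have h2 := intervalIntegral.integral_eq_sub_of_hasDerivAt h1 (hcont.intervalIntegrable _ _)
  rw [intervalIntegral.integral_mul_const] at h2
  simp only [one_mul, zero_mul, h0, sub_zero] at h2
  rw [ht, point_tangential] at h2
  rw [← h2, mul_comm]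
  rfl

theorem IsTest.last_mul_divLast {φ : EuclideanSpace ℝ (Fin (n + 1)) → ℝ} (hφ : IsTest φ)
    (x : EuclideanSpace ℝ (Fin (n + 1))) : x (Fin.last n) * divLast φ x = φ x :=
  HalfSpaceProblem.last_mul_divLast (hφ.contDiff.of_le (by norm_num)) hφ.eq_zero x

theorem IsTest.hasCompactSupport_divLast {φ : EuclideanSpace ℝ (Fin (n + 1)) → ℝ}
    (hφ : IsTest φ) : HasCompactSupport (divLast φ) := by
  refine HasCompactSupport.of_support_subset_isCompact hφ.hasCompactSupport.isCompact
    fun x hx => ?_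
  by_contra h
  apply hx
  by_cases h0 : x (Fin.last n) = 0
  · have hx0 : x = point (tangential x) 0 := by rw [← h0, point_tangential]
    rw [hx0, divLast_point_zero, normalDeriv]
    rw [hx0] at h
    rw [image_eq_zero_of_notMem_tsupport (fun h' => h (tsupport_fderiv_subset ℝ h'))]
    rfl
  · have := hφ.last_mul_divLast x
    rw [image_eq_zero_of_notMem_tsupport h] at this
    exact (mul_eq_zero.1 this).resolve_left h0

theorem IsTest.continuous_divLast {φ : EuclideanSpace ℝ (Fin (n + 1)) → ℝ}
    (hφ : IsTest φ) : Continuous (divLast φ) :=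
  HalfSpaceProblem.continuous_divLast (hφ.contDiff.of_le (by norm_num))

/-- Test functions are bounded by multiples of `x_N`, hence integrable for weighted measures. -/
theorem IsTest.exists_bound {φ : EuclideanSpace ℝ (Fin (n + 1)) → ℝ} (hφ : IsTest φ) :
    ∃ C R : ℝ, 0 ≤ C ∧ (∀ x, |φ x| ≤ C * |x (Fin.last n)|) ∧ ∀ x, R < ‖x‖ → φ x = 0 := by
  obtain ⟨C, hC⟩ := hφ.hasCompactSupport_divLast.exists_bound_of_continuous hφ.continuous_divLast
  obtain ⟨R, hR⟩ := hφ.hasCompactSupport.isCompact.isBounded.subset_closedBall 0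
  refine ⟨C, R, (norm_nonneg _).trans (hC 0), fun x => ?_, fun x hx => ?_⟩
  · rw [← hφ.last_mul_divLast x, abs_mul, mul_comm]
    exact mul_le_mul_of_nonneg_right (hC x) (abs_nonneg _)
  · refine image_eq_zero_of_notMem_tsupport fun h => ?_
    have := hR h
    simp at this
    linarith

theorem IsTest.add {φ ψ : EuclideanSpace ℝ (Fin (n + 1)) → ℝ} (hφ : IsTest φ) (hψ : IsTest ψ) :
    IsTest (φ + ψ) :=
  ⟨hφ.contDiff.add hψ.contDiff, hφ.hasCompactSupport.add hψ.hasCompactSupport,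
    fun x' => by simp [hφ.eq_zero, hψ.eq_zero]⟩

theorem IsTest.smul {φ : EuclideanSpace ℝ (Fin (n + 1)) → ℝ} (hφ : IsTest φ) (c : ℝ) :
    IsTest (c • φ) :=
  ⟨hφ.contDiff.const_smul c, hφ.hasCompactSupport.smul_left (f := fun _ => c),
    fun x' => by simp [hφ.eq_zero]⟩

theorem IsTest.normalDeriv_add {φ ψ : EuclideanSpace ℝ (Fin (n + 1)) → ℝ} (hφ : IsTest φ)
    (hψ : IsTest ψ) : normalDeriv (φ + ψ) = normalDeriv φ + normalDeriv ψ := by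
  funext x'
  simp only [normalDeriv, Pi.add_apply]
  rw [fderiv_add (hφ.contDiff.differentiable two_ne_zero _)
    (hψ.contDiff.differentiable two_ne_zero _)]
  rfl

theorem IsTest.normalDeriv_smul {φ : EuclideanSpace ℝ (Fin (n + 1)) → ℝ} (hφ : IsTest φ) (c : ℝ) :
    normalDeriv (c • φ) = c • normalDeriv φ := by
  funext x'
  simp only [normalDeriv, Pi.smul_apply]
  rw [fderiv_const_smul (hφ.contDiff.differentiable two_ne_zero _)]
  rfl

theorem continuous_normalDeriv {φ : EuclideanSpace ℝ (Fin (n + 1)) → ℝ} (hφ : ContDiff ℝ 2 φ) :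
    Continuous (normalDeriv φ) :=
  (((hφ.continuous_fderiv two_ne_zero).comp (continuous_point 0))).clm_apply continuous_const

theorem hasCompactSupport_comp_point {F : Type*} [Zero F]
    {f : EuclideanSpace ℝ (Fin (n + 1)) → F}
    (hf : HasCompactSupport f) (t : ℝ) : HasCompactSupport (fun x' => f (point x' t)) := by
  obtain ⟨R, hR⟩ := hf.isCompact.isBounded.subset_closedBall 0
  refine HasCompactSupport.intro (isCompact_closedBall 0 R) fun x' hx' => ?_
  refine image_eq_zero_of_notMem_tsupport fun h => hx' ?_
  have := hR h
  simp only [Metric.mem_closedBall, dist_zero_right] at this ⊢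
  exact (norm_le_norm_point x' t).trans this

theorem IsTest.hasCompactSupport_normalDeriv {φ : EuclideanSpace ℝ (Fin (n + 1)) → ℝ}
    (hφ : IsTest φ) : HasCompactSupport (normalDeriv φ) := by
  have := hasCompactSupport_comp_point hφ.hasCompactSupport_divLast 0
  simpa [divLast_point_zero] using this

/-- The weight `x_N` in the definition of `IsWeightedLocal` controls functions that vanish to first
order at the boundary. -/
theorem integrable_of_le_last {μ : LocalRadonMeasure (halfSpace n)} (hμ : IsWeightedLocal μ)
    {f : halfSpace n → ℝ} (hf : Measurable f) {C R : ℝ}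
    (hC : ∀ x, |f x| ≤ C * x.1 (Fin.last n)) (hR : ∀ x, R < ‖x.1‖ → f x = 0) :
    Integrable f μ.totalVariation := by
  set Ω : Set (halfSpace n) := {x | ‖x.1‖ ≤ R}
  have hΩm : MeasurableSet Ω := measurableSet_le (by fun_prop) measurable_const
  have hΩ : Bornology.IsBounded Ω := by
    refine (Metric.isBounded_iff_subset_closedBall
      (⟨normalVector n, by simp [halfSpace, normalVector]⟩ : halfSpace n)).2
      ⟨R + ‖normalVector n‖, fun x hx => ?_⟩
    simp only [Metric.mem_closedBall, Subtype.dist_eq, dist_eq_norm]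
    exact (norm_sub_le _ _).trans (by gcongr; exact hx)
  have hi : IntegrableOn (fun x : halfSpace n => C * x.1 (Fin.last n)) Ω μ.totalVariation := by
    refine Integrable.const_mul ⟨?_, ?_⟩ C
    · exact (continuous_last.comp continuous_subtype_val).aestronglyMeasurable
    · refine lt_of_le_of_lt (lintegral_mono fun x => ?_) (hμ Ω hΩ)
      rw [← ofReal_norm, Real.norm_of_nonneg x.2.le]
  have h2 : IntegrableOn f Ω μ.totalVariation :=
    hi.mono' hf.aestronglyMeasurable (ae_of_all _ hC)
  refine (integrableOn_iff_integrable_of_support_subset fun x hx => ?_).1 h2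
  by_contra h
  exact hx (hR x (not_le.1 h))

theorem IsTest.integrable {φ : EuclideanSpace ℝ (Fin (n + 1)) → ℝ} (hφ : IsTest φ)
    {μ : LocalRadonMeasure (halfSpace n)} (hμ : IsWeightedLocal μ) :
    Integrable (fun x : halfSpace n => φ x) μ.totalVariation := by
  obtain ⟨C, R, -, hC, hR⟩ := hφ.exists_bound
  refine integrable_of_le_last hμ (hφ.contDiff.continuous.measurable.comp measurable_subtype_coe)
    (fun x => (hC x.1).trans_eq (by rw [abs_of_pos x.2])) (fun x hx => hR _ hx)

theorem LocIntegrableUpToBoundary.integrableOn_inter {u : EuclideanSpace ℝ (Fin (n + 1)) → ℝ}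
    (hu : LocIntegrableUpToBoundary u) (R : ℝ) :
    IntegrableOn u (halfSpace n ∩ Metric.ball 0 R) volume :=
  hu _ (isOpen_halfSpace.inter Metric.isOpen_ball)
    (Metric.isBounded_ball.subset inter_subset_right) inter_subset_left

theorem LocIntegrableUpToBoundary.locallyIntegrable_indicator
    {u : EuclideanSpace ℝ (Fin (n + 1)) → ℝ} (hu : LocIntegrableUpToBoundary u) :
    LocallyIntegrable ((halfSpace n).indicator u) volume := by
  rw [locallyIntegrable_iff]
  intro K hK
  obtain ⟨R, hR⟩ := hK.isBounded.subset_ball 0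
  rw [IntegrableOn, integrable_indicator_iff measurableSet_halfSpace, IntegrableOn,
    Measure.restrict_restrict measurableSet_halfSpace]
  exact (hu.integrableOn_inter R).mono_set (inter_subset_inter_right _ hR)

theorem LocIntegrableUpToBoundary.integrableOn_mul {u : EuclideanSpace ℝ (Fin (n + 1)) → ℝ}
    (hu : LocIntegrableUpToBoundary u) {f : EuclideanSpace ℝ (Fin (n + 1)) → ℝ}
    (hf : Continuous f) (hf' : HasCompactSupport f) :
    IntegrableOn (fun x => u x * f x) (halfSpace n) volume := by
  have h1 := hu.locallyIntegrable_indicator.integrable_smul_left_of_hasCompactSupport hf hf'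
  refine (integrable_indicator_iff measurableSet_halfSpace).1 (h1.congr (ae_of_all _ fun x => ?_))
  by_cases hx : x ∈ halfSpace n <;> simp [hx, mul_comm]

/-! ### Positive functionals on the test functions -/

open scoped CompactlySupported in
/-- A linear functional on the test functions that is nonnegative on those nonnegative in the
half-space is integration of `φ / x_N` against a measure on the closed half-space: the functions
`φ / x_N` form a subspace of `C_c` of the closed half-space that majorizes every function, so the
functional extends positively to all of `C_c` by the Riesz extension theorem, and the
Riesz–Markov–Kakutani theorem applies. -/
theorem exists_measure_of_nonneg (L : (EuclideanSpace ℝ (Fin (n + 1)) → ℝ) → ℝ)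
    (hadd : ∀ φ ψ, IsTest φ → IsTest ψ → L (φ + ψ) = L φ + L ψ)
    (hsmul : ∀ (c : ℝ) φ, IsTest φ → L (c • φ) = c * L φ)
    (hpos : ∀ φ, IsTest φ → (∀ x ∈ halfSpace n, 0 ≤ φ x) → 0 ≤ L φ) :
    ∃ σ : Measure (EuclideanSpace ℝ (Fin (n + 1))), IsFiniteMeasureOnCompacts σ ∧
      σ {x | x (Fin.last n) < 0} = 0 ∧ ∀ φ, IsTest φ → L φ = ∫ x, divLast φ x ∂σ := by
  set X := {x : EuclideanSpace ℝ (Fin (n + 1)) // 0 ≤ x (Fin.last n)}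
  have hclosed : IsClosed {x : EuclideanSpace ℝ (Fin (n + 1)) | 0 ≤ x (Fin.last n)} :=
    isClosed_le continuous_const continuous_last
  have : LocallyCompactSpace X := hclosed.locallyCompactSpace
  have hemb : IsClosedEmbedding (Subtype.val : X → EuclideanSpace ℝ (Fin (n + 1))) :=
    hclosed.isClosedEmbedding_subtypeVal
  -- The functional only depends on the values in the half-space.
  have huniq : ∀ φ ψ, IsTest φ → IsTest ψ → (∀ x ∈ halfSpace n, φ x = ψ x) → L φ = L ψ := by
    intro φ ψ hφ hψ h
    have hψ' := hψ.smul (-1)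
    have h1 := hpos _ (hφ.add hψ') fun x hx => by simp [h x hx]
    have h2 := hpos _ ((hφ.add hψ').smul (-1)) fun x hx => by simp [h x hx]
    rw [hsmul _ _ (hφ.add hψ'), hadd _ _ hφ hψ', hsmul _ _ hψ] at h2
    rw [hadd _ _ hφ hψ', hsmul _ _ hψ] at h1
    linarith
  -- The restrictions to the closed half-space of the functions `φ / x_N`, for test functions `φ`.
  let D : Submodule ℝ C_c(X, ℝ) :=
    { carrier := {f | ∃ φ, IsTest φ ∧ ∀ x : X, φ x.1 = x.1 (Fin.last n) * f x}
      add_mem' := by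
        rintro f g ⟨φ, hφ, h1⟩ ⟨ψ, hψ, h2⟩
        exact ⟨φ + ψ, hφ.add hψ, fun x => by simp [h1, h2, mul_add]⟩
      zero_mem' := ⟨0, ⟨contDiff_const, HasCompactSupport.zero, fun _ => rfl⟩, fun x => by simp⟩
      smul_mem' := by
        rintro c f ⟨φ, hφ, h1⟩
        refine ⟨c • φ, hφ.smul c, fun x => ?_⟩
        simp [h1, mul_left_comm] }
  choose T hT hTf using fun f : D => f.2
  have hL : ∀ (f : D) φ, IsTest φ → (∀ x : X, φ x.1 = x.1 (Fin.last n) * f.1 x) →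
      L (T f) = L φ := fun f φ hφ h =>
    huniq _ _ (hT f) hφ fun x hx => by
      rw [hTf f ⟨x, le_of_lt hx⟩, h ⟨x, le_of_lt hx⟩]
  let F : C_c(X, ℝ) →ₗ.[ℝ] ℝ :=
    { domain := D
      toFun :=
        { toFun := fun f => L (T f)
          map_add' := fun f g => by
            rw [← hadd _ _ (hT f) (hT g)]
            exact hL _ _ ((hT f).add (hT g)) fun x => by simp [hTf, mul_add]
          map_smul' := fun c f => by
            rw [RingHom.id_apply, smul_eq_mul, ← hsmul _ _ (hT f)]
            exact hL _ _ ((hT f).smul c) fun x => by simp [hTf, mul_left_comm] } }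
  let S : PointedCone ℝ C_c(X, ℝ) :=
    { carrier := {f | ∀ x, 0 ≤ f x}
      add_mem' := fun {f g} hf hg x => add_nonneg (hf x) (hg x)
      zero_mem' := fun x => le_rfl
      smul_mem' := fun c f hf x => mul_nonneg c.2 (hf x) }
  obtain ⟨G, hGF, hGpos⟩ := riesz_extension S F
    (by
      intro f hf
      refine hpos _ (hT f) fun x hx => ?_
      rw [hTf f ⟨x, le_of_lt hx⟩]
      exact mul_nonneg (le_of_lt hx) (hf _))
    (by
      -- A multiple of a bump function belongs to `D` and majorizes `-y`.
      intro y
      obtain ⟨C, hC⟩ := y.hasCompactSupport.exists_bound_of_continuous y.continuous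
      obtain ⟨R, hR⟩ := (y.hasCompactSupport.isCompact.image
        continuous_subtype_val).isBounded.subset_closedBall 0
      let η : ContDiffBump (0 : EuclideanSpace ℝ (Fin (n + 1))) :=
        ⟨max R 1, max R 1 + 1, by positivity, by linarith⟩
      let f : C_c(X, ℝ) := ⟨⟨fun x => |C| * η x.1,
        continuous_const.mul (η.continuous.comp continuous_subtype_val)⟩,
        (η.hasCompactSupport.comp_isClosedEmbedding hemb).mul_left⟩
      have hf : f ∈ D := by
        refine ⟨fun x => x (Fin.last n) * (|C| * η x),
          ⟨contDiff_last.mul (contDiff_const.mul η.contDiff), η.hasCompactSupport.mul_left.mul_left,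
            fun x' => by simp [point_last]⟩, fun x => rfl⟩
      refine ⟨⟨f, hf⟩, fun x => ?_⟩
      have hx : -|C| ≤ y x := (abs_le.1 ((hC x).trans (le_abs_self C))).1
      by_cases hxK : x ∈ tsupport y
      · have h1 : η x.1 = 1 := η.one_of_mem_closedBall
          (Metric.closedBall_subset_closedBall (le_max_left _ _) (hR ⟨x, hxK, rfl⟩))
        change 0 ≤ |C| * η x.1 + y x
        rw [h1]
        linarith
      · change 0 ≤ |C| * η x.1 + y x
        rw [image_eq_zero_of_notMem_tsupport hxK, add_zero]
        exact mul_nonneg (abs_nonneg _) η.nonneg)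
  let Λ : C_c(X, ℝ) →ₚ[ℝ] ℝ := PositiveLinearMap.mk₀ G fun f hf => hGpos f fun x => hf x
  have : IsFiniteMeasureOnCompacts (RealRMK.rieszMeasure Λ) :=
    ⟨fun K hK => by
      have : (RealRMK.rieszMeasure Λ).Regular := by infer_instance
      exact hK.measure_lt_top⟩
  refine ⟨(RealRMK.rieszMeasure Λ).map Subtype.val, ⟨fun K hK => ?_⟩, ?_, fun φ hφ => ?_⟩
  · rw [hemb.measurableEmbedding.map_apply]
    exact (hemb.isCompact_preimage hK).measure_lt_top
  · rw [hemb.measurableEmbedding.map_apply]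
    convert measure_empty
    · ext x
      simpa using x.2
    · infer_instance
  · rw [hemb.measurableEmbedding.integral_map]
    let f : C_c(X, ℝ) := ⟨⟨fun x => divLast φ x.1, hφ.continuous_divLast.comp
      continuous_subtype_val⟩, hφ.hasCompactSupport_divLast.comp_isClosedEmbedding hemb⟩
    have hf : f ∈ D := ⟨φ, hφ, fun x => (hφ.last_mul_divLast x.1).symm⟩
    have h1 := RealRMK.integral_rieszMeasure Λ f
    have h2 : Λ f = L (T ⟨f, hf⟩) := hGF ⟨f, hf⟩
    rw [h2, hL ⟨f, hf⟩ φ hφ fun x => (hφ.last_mul_divLast x.1).symm] at h1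
    exact h1.symm

theorem isClosedEmbedding_point_zero :
    IsClosedEmbedding (fun x' : EuclideanSpace ℝ (Fin n) => point x' 0) := by
  exact Function.LeftInverse.isClosedEmbedding (f := tangential)
    (fun x' => tangential_point x' 0) (contDiff_tangential (m := 0)).continuous (continuous_point 0)

theorem range_point_zero :
    range (fun x' : EuclideanSpace ℝ (Fin n) => point x' 0) = {x | x (Fin.last n) = 0} := by
  ext x
  constructor
  · rintro ⟨x', rfl⟩
    exact point_last x' 0
  · intro (hx : x (Fin.last n) = 0)
    exact ⟨tangential x, by rw [← hx]; exact point_tangential x⟩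

/-- A positive functional on the test functions is the sum of a weighted positive measure in the
half-space and a positive measure acting on the normal derivative at the boundary. -/
theorem exists_measures_of_nonneg (L : (EuclideanSpace ℝ (Fin (n + 1)) → ℝ) → ℝ)
    (hadd : ∀ φ ψ, IsTest φ → IsTest ψ → L (φ + ψ) = L φ + L ψ)
    (hsmul : ∀ (c : ℝ) φ, IsTest φ → L (c • φ) = c * L φ)
    (hpos : ∀ φ, IsTest φ → (∀ x ∈ halfSpace n, 0 ≤ φ x) → 0 ≤ L φ) :
    ∃ (lam : Measure (halfSpace n)) (κ : Measure (EuclideanSpace ℝ (Fin n))),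
      IsFiniteMeasureOnCompacts lam ∧ IsFiniteMeasureOnCompacts κ ∧
      (∀ Ω : Set (halfSpace n), Bornology.IsBounded Ω →
        ∫⁻ x in Ω, ENNReal.ofReal (x.1 (Fin.last n)) ∂lam < ⊤) ∧
      ∀ φ, IsTest φ → L φ = ∫ x, φ x.1 ∂lam + ∫ x', normalDeriv φ x' ∂κ := by
  obtain ⟨σ, hσ, hσ0, hL⟩ := exists_measure_of_nonneg L hadd hsmul hpos
  set σ₀ : Measure (halfSpace n) := σ.comap Subtype.val
  have hw : Measurable fun x : halfSpace n => (x.1 (Fin.last n)).toNNReal⁻¹ :=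
    (((continuous_last.comp continuous_subtype_val).measurable).real_toNNReal).inv
  -- The part of `σ` in the open half-space gives `lam` after division by `x_N`; the part on the
  -- boundary acts on `divLast φ`, which is the normal derivative there.
  set lam : Measure (halfSpace n) :=
    σ₀.withDensity fun x => ((x.1 (Fin.last n)).toNNReal⁻¹ : ℝ≥0)
  have hemb : MeasurableEmbedding (Subtype.val : halfSpace n → _) :=
    MeasurableEmbedding.subtype_coe measurableSet_halfSpace
  have hbdd : ∀ Ω : Set (halfSpace n), Bornology.IsBounded Ω → σ₀ Ω < ⊤ := by
    intro Ω hΩ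
    rw [hemb.comap_apply]
    obtain ⟨R, hR⟩ := ((LipschitzWith.subtype_val
      (halfSpace n)).isBounded_image hΩ).subset_closedBall 0
    exact (measure_mono hR).trans_lt (isCompact_closedBall 0 R).measure_lt_top
  have hweight : ∀ Ω : Set (halfSpace n), Bornology.IsBounded Ω →
      ∫⁻ x in Ω, ENNReal.ofReal (x.1 (Fin.last n)) ∂lam < ⊤ := by
    intro Ω hΩ
    have hΩ' : MeasurableSet (closure Ω) := isClosed_closure.measurableSet
    refine (lintegral_mono_set subset_closure).trans_lt ?_
    rw [restrict_withDensity hΩ',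
      lintegral_withDensity_eq_lintegral_mul _ hw.coe_nnreal_ennreal (by fun_prop)]
    refine lt_of_eq_of_lt (lintegral_congr fun x => ?_) (b := ∫⁻ x in closure Ω, 1 ∂σ₀) ?_
    · have hx : (x.1 (Fin.last n)).toNNReal ≠ 0 := (Real.toNNReal_pos.2 x.2).ne'
      rw [Pi.mul_apply, ENNReal.ofReal, ← ENNReal.coe_mul, inv_mul_cancel₀ hx]
      rfl
    · simpa using hbdd _ hΩ.closure
  have hpt := isClosedEmbedding_point_zero (n := n)
  refine ⟨lam, σ.comap (fun x' => point x' 0), ⟨fun K hK => ?_⟩, ⟨fun K hK => ?_⟩, hweight,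
    fun φ hφ => ?_⟩
  · rw [withDensity_apply _ hK.measurableSet]
    rcases K.eq_empty_or_nonempty with rfl | hne
    · simp
    obtain ⟨x₀, -, hx₀⟩ := hK.exists_isMinOn hne
      ((continuous_last.comp continuous_subtype_val).continuousOn)
    refine (setLIntegral_mono (g := fun _ => ((x₀.1 (Fin.last n)).toNNReal⁻¹ : ℝ≥0))
      measurable_const fun x hx => ?_).trans_lt ?_
    · have h1 : (x₀.1 (Fin.last n)).toNNReal ≤ (x.1 (Fin.last n)).toNNReal :=
        Real.toNNReal_le_toNNReal (hx₀ hx)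
      exact_mod_cast inv_anti₀ (Real.toNNReal_pos.2 x₀.2) h1
    · rw [setLIntegral_const]
      exact ENNReal.mul_lt_top ENNReal.coe_lt_top (hbdd K hK.isBounded)
  · rw [hpt.measurableEmbedding.comap_apply]
    exact (hK.image hpt.continuous).measure_lt_top
  · have hint : Integrable (divLast φ) σ :=
      hφ.continuous_divLast.integrable_of_hasCompactSupport hφ.hasCompactSupport_divLast
    have h1 : ∫ x, φ x.1 ∂lam = ∫ x in halfSpace n, divLast φ x ∂σ := by
      rw [integral_withDensity_eq_integral_smul hw,
        ← integral_subtype_comap measurableSet_halfSpace]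
      refine integral_congr_ae (ae_of_all _ fun x => ?_)
      have hx : x.1 (Fin.last n) ≠ 0 := (show 0 < x.1 (Fin.last n) from x.2).ne'
      simp only [NNReal.smul_def, NNReal.coe_inv, smul_eq_mul]
      rw [Real.coe_toNNReal _ (le_of_lt x.2), ← hφ.last_mul_divLast x.1, inv_mul_cancel_left₀ hx]
    have h2 : ∫ x', normalDeriv φ x' ∂(σ.comap fun x' => point x' 0) =
        ∫ x in {x | x (Fin.last n) = 0}, divLast φ x ∂σ := by
      rw [← range_point_zero, ← hpt.measurableEmbedding.map_comap,
        hpt.measurableEmbedding.integral_map]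
      simp only [divLast_point_zero]
    rw [hL φ hφ, h1, h2, ← setIntegral_union _ _ hint.integrableOn hint.integrableOn,
      setIntegral_eq_integral_of_ae_compl_eq_zero]
    · refine (measure_eq_zero_iff_ae_notMem.1 hσ0).mono fun x hx hx' => (hx ?_).elim
      simp only [halfSpace, mem_union, mem_ofPred_eq, not_or, not_lt] at hx' ⊢
      exact lt_of_le_of_ne hx'.1 hx'.2
    · rw [Set.disjoint_left]
      intro x (hx : 0 < x (Fin.last n)) hx'
      exact hx.ne' hx'
    · exact continuous_last.measurable (measurableSet_singleton 0)

/-! ### Weak subsolutions are weak solutions -/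

/-- Every weak subsolution is a weak solution: the nonnegative defect in the inequality is a
positive measure `lam` in the half-space and a positive measure `κ` on the boundary. -/
theorem IsWeakSubsolution.exists_isWeakSolution {μ : LocalRadonMeasure (halfSpace n)}
    {ν : LocalRadonMeasure (EuclideanSpace ℝ (Fin n))} {u : EuclideanSpace ℝ (Fin (n + 1)) → ℝ}
    (hu : IsWeakSubsolution μ ν u) :
    ∃ (lam : LocalRadonMeasure (halfSpace n)) (ν₀ : LocalRadonMeasure (EuclideanSpace ℝ (Fin n))),
      lam.IsPositive ∧ IsWeightedLocal lam ∧ ν₀ ≤ ν ∧ IsWeakSolution (μ + lam) ν₀ u := by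
  obtain ⟨hμ, hul, hsub⟩ := hu
  have iu : ∀ φ, IsTest φ →
      IntegrableOn (fun x => u x * Laplacian.laplacian φ x) (halfSpace n) volume := fun φ hφ =>
    hul.integrableOn_mul (continuous_laplacian hφ.contDiff)
      (hasCompactSupport_laplacian hφ.hasCompactSupport)
  have iμ : ∀ φ, IsTest φ → Integrable (fun x : halfSpace n => φ x) μ.totalVariation :=
    fun φ hφ => hφ.integrable hμ
  have iν : ∀ (f : EuclideanSpace ℝ (Fin n) → ℝ) (m : Measure (EuclideanSpace ℝ (Fin n)))
      [IsFiniteMeasureOnCompacts m], Continuous f → HasCompactSupport f → Integrable f m :=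
    fun f m _ h1 h2 => h1.integrable_of_hasCompactSupport h2
  have hlap_add : ∀ φ ψ : EuclideanSpace ℝ (Fin (n + 1)) → ℝ, IsTest φ → IsTest ψ →
      ∀ x, Laplacian.laplacian (φ + ψ) x = Laplacian.laplacian φ x + Laplacian.laplacian ψ x :=
    fun φ ψ hφ hψ x =>
    ContDiffAt.laplacian_add hφ.contDiff.contDiffAt hψ.contDiff.contDiffAt
  have hlap_smul : ∀ (c : ℝ) (φ : EuclideanSpace ℝ (Fin (n + 1)) → ℝ), IsTest φ →
      ∀ x, Laplacian.laplacian (c • φ) x = c * Laplacian.laplacian φ x := fun c φ hφ x =>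
    InnerProductSpace.laplacian_smul c hφ.contDiff.contDiffAt
  have cν := fun φ (hφ : IsTest φ) => continuous_normalDeriv (n := n) hφ.contDiff
  obtain ⟨lam, κ, hlam, hκ, hw, hL⟩ := exists_measures_of_nonneg (n := n)
    (fun φ => (∫ x in halfSpace n, u x * Laplacian.laplacian φ x) -
      (μ.integral (fun x => φ x) - ν.integral (normalDeriv φ)))
    (by
      intro φ ψ hφ hψ
      have h1 : ∫ x in halfSpace n, u x * Laplacian.laplacian (φ + ψ) x =
          (∫ x in halfSpace n, u x * Laplacian.laplacian φ x) +
          ∫ x in halfSpace n, u x * Laplacian.laplacian ψ x := by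
        rw [← integral_add (iu φ hφ) (iu ψ hψ)]
        simp only [hlap_add φ ψ hφ hψ, mul_add]
      rw [h1, hφ.normalDeriv_add hψ]
      simp only [LocalRadonMeasure.integral, Pi.add_apply]
      rw [integral_add ((iμ φ hφ).mono_measure μ.posPart_le_totalVariation)
          ((iμ ψ hψ).mono_measure μ.posPart_le_totalVariation),
        integral_add ((iμ φ hφ).mono_measure μ.negPart_le_totalVariation)
          ((iμ ψ hψ).mono_measure μ.negPart_le_totalVariation),
        integral_add (iν _ _ (cν φ hφ) hφ.hasCompactSupport_normalDeriv)
          (iν _ _ (cν ψ hψ) hψ.hasCompactSupport_normalDeriv),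
        integral_add (iν _ _ (cν φ hφ) hφ.hasCompactSupport_normalDeriv)
          (iν _ _ (cν ψ hψ) hψ.hasCompactSupport_normalDeriv)]
      ring)
    (by
      intro c φ hφ
      have h1 : ∫ x in halfSpace n, u x * Laplacian.laplacian (c • φ) x =
          c * ∫ x in halfSpace n, u x * Laplacian.laplacian φ x := by
        rw [← integral_const_mul]
        simp only [hlap_smul c φ hφ, mul_left_comm]
      rw [h1, hφ.normalDeriv_smul]
      simp only [LocalRadonMeasure.integral, Pi.smul_apply, smul_eq_mul, integral_const_mul]
      ring)
    (fun φ hφ h => sub_nonneg.2 (hsub φ hφ h))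
  let Lam : LocalRadonMeasure (halfSpace n) :=
    ⟨lam, 0, hlam, ⟨fun K _ => by simp⟩, Measure.MutuallySingular.zero_right⟩
  have hLamT : Lam.totalVariation = lam := add_zero lam
  have hLamw : IsWeightedLocal Lam := by
    intro Ω hΩ
    rw [hLamT]
    exact hw Ω hΩ
  have i1 := LocalRadonMeasure.isFiniteMeasureOnCompacts_add ν.negPart κ
  have i2 := LocalRadonMeasure.sigmaFinite_of_isFiniteMeasureOnCompacts (ν.negPart + κ)
  have i3 := LocalRadonMeasure.sigmaFinite_of_isFiniteMeasureOnCompacts ν.posPart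
  have hν₀ : ∀ f : EuclideanSpace ℝ (Fin n) → ℝ, Continuous f → HasCompactSupport f →
      (LocalRadonMeasure.ofSub ν.posPart (ν.negPart + κ)).integral f =
        ν.integral f - ∫ x, f x ∂κ := by
    intro f h1 h2
    rw [LocalRadonMeasure.integral_ofSub _ _ (iν f _ h1 h2) (iν f _ h1 h2),
      integral_add_measure (iν f _ h1 h2) (iν f _ h1 h2), LocalRadonMeasure.integral]
    ring
  refine ⟨Lam, LocalRadonMeasure.ofSub ν.posPart (ν.negPart + κ), rfl, hLamw, ?_, ?_, hul, ?_⟩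
  · intro f h1 h2 h3
    rw [hν₀ f h1 h2]
    have := integral_nonneg (μ := κ) (f := f) h3
    linarith
  · intro Ω hΩ
    refine (lintegral_mono' (Measure.restrict_mono le_rfl
      (LocalRadonMeasure.add_totalVariation_le μ Lam)) le_rfl).trans_lt ?_
    rw [Measure.restrict_add, lintegral_add_measure]
    exact ENNReal.add_lt_top.2 ⟨hμ Ω hΩ, hLamw Ω hΩ⟩
  · intro φ hφ
    rw [LocalRadonMeasure.integral_add μ Lam (iμ φ hφ) (hφ.integrable hLamw),
      hν₀ _ (cν φ hφ) hφ.hasCompactSupport_normalDeriv]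
    have h1 := hL φ hφ
    have h2 : Lam.integral (fun x => φ x) = ∫ x, φ x.1 ∂lam := by
      change ∫ x, φ x.1 ∂lam - ∫ x, φ x.1 ∂(0 : Measure (halfSpace n)) = _
      simp
    rw [h2]
    linarith

/-! ### Sobolev traces and integration by parts above a hyperplane -/

theorem integral_fderiv_normalVector_above {W : EuclideanSpace ℝ (Fin (n + 1)) → ℝ}
    (hW : ContDiff ℝ 1 W) (hW' : HasCompactSupport W) (ε : ℝ) :
    ∫ x in {x | ε < x (Fin.last n)}, fderiv ℝ W x (normalVector n) =
      -∫ x', W (point x' ε) := by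
  have hc : Continuous fun x => fderiv ℝ W x (normalVector n) :=
    (hW.continuous_fderiv one_ne_zero).clm_apply continuous_const
  have hs : HasCompactSupport fun x => fderiv ℝ W x (normalVector n) :=
    hW'.fderiv_apply (𝕜 := ℝ) _
  have hpre : pointCLE n ⁻¹' {x | ε < x (Fin.last n)} = univ ×ˢ Ioi ε := by
    ext p
    simp [pointCLE_apply, point_last]
  have hint : Integrable (fun p => fderiv ℝ W (pointCLE n p) (normalVector n))
      (volume.prod volume) :=
    (measurePreserving_pointCLE.integrable_comp_emb measurableEmbedding_pointCLE).2
      (hc.integrable_of_hasCompactSupport hs)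
  rw [← measurePreserving_pointCLE.setIntegral_preimage_emb measurableEmbedding_pointCLE, hpre,
    setIntegral_prod _ hint.integrableOn, setIntegral_univ, ← integral_neg]
  refine integral_congr_ae (ae_of_all _ fun x' => ?_)
  have hd : ∀ t, HasDerivAt (fun t => W (point x' t))
      (fderiv ℝ W (point x' t) (normalVector n)) t := fun t =>
    hasDerivAt_comp_point x' t (hW.differentiable one_ne_zero _)
  have hemb : IsClosedEmbedding (fun t : ℝ => point x' t) :=
    Function.LeftInverse.isClosedEmbedding (f := fun x => x (Fin.last n)) (fun t => point_last x' t)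
      continuous_last ((pointCLE n).continuous.comp (Continuous.prodMk_right x'))
  have h0 : Tendsto (fun t => W (point x' t)) atTop (𝓝 0) := by
    have h1 : HasCompactSupport (fun t => W (point x' t)) := hW'.comp_isClosedEmbedding hemb
    exact h1.is_zero_at_infty.mono_left atTop_le_cocompact
  have h3 := integral_Ioi_of_hasDerivAt_of_tendsto (a := ε) (hd ε).continuousAt.continuousWithinAt
    (fun t _ => hd t) (((hc.comp hemb.continuous).integrable_of_hasCompactSupport
      (hs.comp_isClosedEmbedding hemb)).integrableOn) h0
  rw [zero_sub] at h3
  exact h3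

theorem tendsto_integral_mul_of_tendsto_eLpNorm {α : Type*} [MeasurableSpace α] {μ : Measure α}
    [IsFiniteMeasure μ] {p : ℝ≥0∞} (hp : 1 ≤ p) {f : ℕ → α → ℝ} {g b : α → ℝ}
    (hf : ∀ k, AEStronglyMeasurable (f k) μ) (hg : MemLp g p μ)
    (hlim : Tendsto (fun k => eLpNorm (fun x => f k x - g x) p μ) atTop (𝓝 0))
    (hb : AEStronglyMeasurable b μ) {C : ℝ} (hC : ∀ x, |b x| ≤ C) :
    Tendsto (fun k => ∫ x, f k x * b x ∂μ) atTop (𝓝 (∫ x, g x * b x ∂μ)) := by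
  have hgi : Integrable g μ := hg.integrable hp
  have h1 : Tendsto (fun k => eLpNorm (fun x => f k x - g x) 1 μ) atTop (𝓝 0) := by
    have h2 : Tendsto (fun k => eLpNorm (fun x => f k x - g x) p μ *
        μ univ ^ (1 / (1 : ℝ≥0∞).toReal - 1 / p.toReal)) atTop (𝓝 0) := by
      rw [← zero_mul (μ univ ^ (1 / (1 : ℝ≥0∞).toReal - 1 / p.toReal))]
      refine ENNReal.Tendsto.mul_const hlim (Or.inr ?_)
      refine ENNReal.rpow_ne_top_of_nonneg ?_ (measure_ne_top _ _)
      rcases eq_or_ne p ⊤ with rfl | hp'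
      · simp
      · have h3 : 1 ≤ p.toReal := by
          rw [← ENNReal.toReal_one]
          exact ENNReal.toReal_mono hp' hp
        simpa using inv_le_one_of_one_le₀ h3
    refine tendsto_of_tendsto_of_tendsto_of_le_of_le tendsto_const_nhds h2 (fun _ => zero_le)
      fun k => ?_
    exact eLpNorm_le_eLpNorm_mul_rpow_measure_univ hp ((hf k).sub hg.1)
  have hbi : Integrable (fun x => g x * b x) μ :=
    hgi.mul_bdd (c := C) hb (ae_of_all _ fun x => hC x)
  have h4 : Tendsto (fun k => eLpNorm (fun x => f k x * b x - g x * b x) 1 μ) atTop (𝓝 0) := by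
    have h5 : Tendsto (fun k => ENNReal.ofReal C * eLpNorm (fun x => f k x - g x) 1 μ) atTop
        (𝓝 0) := by
      rw [← mul_zero (ENNReal.ofReal C)]
      exact ENNReal.Tendsto.const_mul h1 (Or.inr ENNReal.ofReal_ne_top)
    refine tendsto_of_tendsto_of_tendsto_of_le_of_le tendsto_const_nhds h5 (fun _ => zero_le)
      fun k => ?_
    refine eLpNorm_le_mul_eLpNorm_of_ae_le_mul (ae_of_all _ fun x => ?_) 1
    rw [← sub_mul, norm_mul, mul_comm]
    exact mul_le_mul_of_nonneg_right (hC x) (norm_nonneg _)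
  have h6 : ∀ᶠ k in atTop, Integrable (fun x => f k x * b x) μ := by
    have h7 : ∀ᶠ k in atTop, eLpNorm (fun x => f k x - g x) 1 μ < 1 :=
      h1.eventually_lt_const one_pos
    filter_upwards [h7] with k hk
    have h8 : Integrable (fun x => f k x - g x) μ :=
      memLp_one_iff_integrable.1 ⟨(hf k).sub hg.1, hk.trans ENNReal.one_lt_top⟩
    have h9 : Integrable (f k) μ := (h8.add hgi).congr (ae_of_all _ fun x => by simp)
    exact h9.mul_bdd (c := C) hb (ae_of_all _ fun x => hC x)
  exact tendsto_integral_of_L1' _ hbi.aestronglyMeasurable h6 h4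

theorem gradient_apply (w : EuclideanSpace ℝ (Fin (n + 1)) → ℝ)
    (x : EuclideanSpace ℝ (Fin (n + 1))) (i : Fin (n + 1)) :
    gradient w x i = fderiv ℝ w x (EuclideanSpace.single i 1) := by
  have h : inner ℝ (gradient w x) (EuclideanSpace.single i (1 : ℝ)) =
      fderiv ℝ w x (EuclideanSpace.single i 1) := by
    rw [gradient, InnerProductSpace.toDual_symm_apply]
  rw [← h, EuclideanSpace.inner_single_right]
  simp

theorem eLpNorm_apply_le {α : Type*} [MeasurableSpace α] {μ : Measure α} {p : ℝ≥0∞} {d : ℕ}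
    (F : α → EuclideanSpace ℝ (Fin d)) (i : Fin d) :
    eLpNorm (fun x => F x i) p μ ≤ eLpNorm F p μ :=
  eLpNorm_mono fun x => PiLp.norm_apply_le (F x) i

theorem contDiff_mul_of_tsupport_subset {E : Type*} [NormedAddCommGroup E] [NormedSpace ℝ E]
    {U : Set E} (hU : IsOpen U) {w ζ : E → ℝ} {m : WithTop ℕ∞} (hw : ContDiffOn ℝ m w U)
    (hζ : ContDiff ℝ m ζ) (hs : tsupport ζ ⊆ U) : ContDiff ℝ m (fun x => w x * ζ x) := by
  rw [contDiff_iff_contDiffAt]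
  intro x
  by_cases hx : x ∈ tsupport ζ
  · exact (hw.contDiffAt (hU.mem_nhds (hs hx))).mul hζ.contDiffAt
  · have h : (fun x => w x * ζ x) =ᶠ[𝓝 x] fun _ => 0 := by
      filter_upwards [notMem_tsupport_iff_eventuallyEq.1 hx] with y hy
      simp [hy]
    exact contDiffAt_const.congr_of_eventuallyEq h

/-- Integration by parts above the hyperplane `{x_N = ε}`, for a Sobolev function with trace `g`. -/
theorem IsSobolevTrace.integral_above {p : ℝ≥0} (hp : 1 ≤ p)
    {u : EuclideanSpace ℝ (Fin (n + 1)) → ℝ} {ε : ℝ} (hε : 0 < ε) {g : EuclideanSpace ℝ (Fin n) → ℝ}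
    (h : IsSobolevTrace p u ε g) :
    ∃ G : EuclideanSpace ℝ (Fin (n + 1)) → EuclideanSpace ℝ (Fin (n + 1)), IsW1pLoc p u G ∧
      ∀ ζ : EuclideanSpace ℝ (Fin (n + 1)) → ℝ, ContDiff ℝ 1 ζ → HasCompactSupport ζ →
        tsupport ζ ⊆ halfSpace n →
        (∫ x in {x | ε < x (Fin.last n)}, G x (Fin.last n) * ζ x) +
          ∫ x in {x | ε < x (Fin.last n)}, u x * fderiv ℝ ζ x (normalVector n) =
          -∫ x', g x' * ζ (point x' ε) := by
  obtain ⟨hg, G, hG, w, hw, hconv, htr⟩ := h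
  refine ⟨G, hG, fun ζ hζ hζc hζs => ?_⟩
  have hp' : (1 : ℝ≥0∞) ≤ p := by exact_mod_cast hp
  set K := tsupport ζ
  have hK : IsCompact K := hζc
  set A := {x : EuclideanSpace ℝ (Fin (n + 1)) | ε < x (Fin.last n)}
  have hA : MeasurableSet A := measurableSet_lt measurable_const continuous_last.measurable
  set μ := (volume.restrict K).restrict A
  have : IsFiniteMeasure (volume.restrict K) := ⟨by simpa using hK.measure_lt_top⟩
  have hle : μ ≤ volume.restrict K := Measure.restrict_le_self
  have hμA : ∀ f : EuclideanSpace ℝ (Fin (n + 1)) → ℝ, (∀ x, x ∉ K → f x = 0) →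
      ∫ x in A, f x = ∫ x, f x ∂μ := by
    intro f hf
    rw [show μ = volume.restrict (A ∩ K) from Measure.restrict_restrict hA]
    refine setIntegral_eq_of_subset_of_forall_sdiff_eq_zero hA inter_subset_left fun x hx => ?_
    exact hf x fun h => hx.2 ⟨hx.1, h⟩
  obtain ⟨C, hC⟩ := hζc.exists_bound_of_continuous hζ.continuous
  have hdc : Continuous fun x => fderiv ℝ ζ x (normalVector n) :=
    (hζ.continuous_fderiv one_ne_zero).clm_apply continuous_const
  obtain ⟨C', hC'⟩ := (hζc.fderiv_apply (𝕜 := ℝ) (normalVector n)).exists_bound_of_continuous hdc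
  have hζ0 : ∀ x, x ∉ K → ζ x = 0 := fun x hx => image_eq_zero_of_notMem_tsupport hx
  have hdζ0 : ∀ x, x ∉ K → fderiv ℝ ζ x (normalVector n) = 0 := fun x hx => by
    rw [image_eq_zero_of_notMem_tsupport fun h' => hx (tsupport_fderiv_subset ℝ h')]
    rfl
  have hwK : ∀ k, ContinuousOn (w k) K := fun k => (hw k).continuousOn.mono hζs
  have hdwK : ∀ k, ContinuousOn (fun x => fderiv ℝ (w k) x (normalVector n)) K := fun k =>
    (((hw k).continuousOn_fderiv_of_isOpen isOpen_halfSpace le_rfl).clm_apply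
      continuousOn_const).mono hζs
  have hmeas : ∀ f : EuclideanSpace ℝ (Fin (n + 1)) → ℝ, ContinuousOn f K →
      AEStronglyMeasurable f μ := fun f hf =>
    (hf.aestronglyMeasurable hK.measurableSet).mono_measure hle
  have hint : ∀ f : EuclideanSpace ℝ (Fin (n + 1)) → ℝ, ContinuousOn f K →
      Integrable f μ := fun f hf =>
    Integrable.mono_measure (hf.integrableOn_compact hK) hle
  -- The formula for the approximating functions.
  have hk : ∀ k, ∫ x, fderiv ℝ (w k) x (normalVector n) * ζ x ∂μ +
      ∫ x, w k x * fderiv ℝ ζ x (normalVector n) ∂μ = -∫ x', w k (point x' ε) * ζ (point x' ε) := by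
    intro k
    have hi1 : Integrable (fun x => fderiv ℝ (w k) x (normalVector n) * ζ x) μ :=
      hint _ ((hdwK k).mul hζ.continuous.continuousOn)
    have hi2 : Integrable (fun x => w k x * fderiv ℝ ζ x (normalVector n)) μ :=
      hint _ ((hwK k).mul hdc.continuousOn)
    rw [← integral_fderiv_normalVector_above (contDiff_mul_of_tsupport_subset isOpen_halfSpace (hw k)
      hζ hζs) hζc.mul_left ε, ← integral_add hi1 hi2, hμA]
    · have hKμ : ∀ᵐ x ∂μ, x ∈ K := ae_mono hle (ae_restrict_mem hK.measurableSet)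
      refine integral_congr_ae (hKμ.mono fun x hx => ?_)
      have h1 := ((hw k).contDiffAt (isOpen_halfSpace.mem_nhds
        (hζs hx))).differentiableAt one_ne_zero
      have h2 := h1.hasFDerivAt.mul (hζ.differentiable one_ne_zero x).hasFDerivAt
      refine Eq.trans ?_ (congrArg (fun L => L (normalVector n)) h2.fderiv).symm
      simp only [_root_.add_apply, _root_.smul_apply, smul_eq_mul]
      ring
    · intro x hx
      rw [image_eq_zero_of_notMem_tsupport fun h' => hx (closure_mono
        (Function.support_mul_subset_right _ _) (tsupport_fderiv_subset ℝ h'))]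
      rfl
  -- Passage to the limit.
  have l1 : Tendsto (fun k => ∫ x, fderiv ℝ (w k) x (normalVector n) * ζ x ∂μ) atTop
      (𝓝 (∫ x, G x (Fin.last n) * ζ x ∂μ)) := by
    refine tendsto_integral_mul_of_tendsto_eLpNorm hp' (fun k => hmeas _ (hdwK k)) ?_ ?_
      hζ.continuous.aestronglyMeasurable hC
    · have h1 := (hG.memLp_grad K hK hζs).mono_measure hle
      exact ⟨continuous_last.comp_aestronglyMeasurable h1.1,
        (eLpNorm_apply_le _ _).trans_lt h1.2⟩
    · refine tendsto_of_tendsto_of_tendsto_of_le_of_le tendsto_const_nhds (hconv K hK hζs).2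
        (fun _ => zero_le) fun k => ?_
      refine le_trans ?_ ((eLpNorm_apply_le _ (Fin.last n)).trans (eLpNorm_mono_measure _ hle))
      refine le_of_eq (eLpNorm_congr_ae (ae_of_all _ fun x => ?_))
      simp [gradient_apply, normalVector]
  have l2 : Tendsto (fun k => ∫ x, w k x * fderiv ℝ ζ x (normalVector n) ∂μ) atTop
      (𝓝 (∫ x, u x * fderiv ℝ ζ x (normalVector n) ∂μ)) := by
    refine tendsto_integral_mul_of_tendsto_eLpNorm hp' (fun k => hmeas _ (hwK k))
      ((hG.memLp K hK hζs).mono_measure hle) ?_ hdc.aestronglyMeasurable hC'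
    exact tendsto_of_tendsto_of_tendsto_of_le_of_le tendsto_const_nhds (hconv K hK hζs).1
        (fun _ => zero_le) fun k => eLpNorm_mono_measure _ hle
  have l3 : Tendsto (fun k => ∫ x', w k (point x' ε) * ζ (point x' ε)) atTop
      (𝓝 (∫ x', g x' * ζ (point x' ε))) := by
    obtain ⟨R, hR⟩ := (hasCompactSupport_comp_point hζc ε).isCompact.isBounded.subset_ball 0
    have hball : ∀ f : EuclideanSpace ℝ (Fin n) → ℝ, ∫ x', f x' * ζ (point x' ε) =
        ∫ x' in Metric.ball 0 R, f x' * ζ (point x' ε) := by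
      intro f
      refine (setIntegral_eq_integral_of_forall_compl_eq_zero fun x hx => ?_).symm
      rw [image_eq_zero_of_notMem_tsupport (f := fun x' => ζ (point x' ε)) fun h' => hx (hR h'),
        mul_zero]
    have : IsFiniteMeasure (volume.restrict (Metric.ball (0 : EuclideanSpace ℝ (Fin n)) R)) :=
      ⟨by rw [Measure.restrict_apply_univ]; exact measure_ball_lt_top⟩
    rw [hball g]
    simp only [hball fun x' => w _ (point x' ε)]
    refine tendsto_integral_mul_of_tendsto_eLpNorm hp' (fun k => ?_) (hg R) (htr R)
      (hζ.continuous.comp (continuous_point ε)).aestronglyMeasurable fun x' => hC (point x' ε)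
    exact ((hw k).continuousOn.comp_continuous (continuous_point ε)
      fun x' => by rwa [halfSpace, mem_ofPred_eq, point_last]).aestronglyMeasurable
  rw [hμA _ fun x hx => by rw [hζ0 x hx, mul_zero], hμA _ fun x hx => by rw [hdζ0 x hx, mul_zero]]
  have l4 := l1.add l2
  simp only [hk] at l4
  exact tendsto_nhds_unique l4 l3.neg

/-! ### The limit of the traces of a weak solution -/

/-- The smooth function that is `1` for `t ≤ a` and `0` for `t ≥ b`. -/
def stepDown (a b t : ℝ) : ℝ := 1 - Real.smoothTransition ((t - a) / (b - a))

theorem contDiff_stepDown (a b : ℝ) {m : ℕ∞} : ContDiff ℝ m (stepDown a b) :=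
  contDiff_const.sub (Real.smoothTransition.contDiff.comp
    ((contDiff_id.sub contDiff_const).div_const _))

theorem stepDown_of_le {a b t : ℝ} (h : a < b) (ht : t ≤ a) : stepDown a b t = 1 := by
  rw [stepDown, Real.smoothTransition.zero_of_nonpos, sub_zero]
  exact div_nonpos_of_nonpos_of_nonneg (by linarith) (by linarith)

theorem stepDown_of_ge {a b t : ℝ} (h : a < b) (ht : b ≤ t) : stepDown a b t = 0 := by
  rw [stepDown, Real.smoothTransition.one_of_one_le, sub_self]
  rw [le_div_iff₀ (by linarith)]
  linarith

theorem stepDown_nonneg (a b t : ℝ) : 0 ≤ stepDown a b t :=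
  sub_nonneg.2 (Real.smoothTransition.le_one _)

theorem stepDown_le_one (a b t : ℝ) : stepDown a b t ≤ 1 :=
  sub_le_self _ (Real.smoothTransition.nonneg _)

theorem deriv_stepDown_of_lt {a b t : ℝ} (h : a < b) (ht : t < a) : deriv (stepDown a b) t = 0 := by
  have : stepDown a b =ᶠ[𝓝 t] fun _ => 1 := by
    filter_upwards [Iio_mem_nhds ht] with s hs using stepDown_of_le h (le_of_lt hs)
  rw [this.deriv_eq, deriv_const]

theorem deriv_stepDown_of_le {a b t : ℝ} (h : a < b) (ht : t ≤ a) :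
    deriv (stepDown a b) t = 0 := by
  have hc : Continuous (deriv (stepDown a b)) :=
    (contDiff_stepDown a b (m := 1)).continuous_deriv le_rfl
  have hcl : IsClosed {s | deriv (stepDown a b) s = 0} := isClosed_eq hc continuous_const
  have : closure (Iio a) ⊆ {s | deriv (stepDown a b) s = 0} :=
    hcl.closure_subset_iff.2 fun s hs => deriv_stepDown_of_lt h hs
  rw [closure_Iio] at this
  exact this ht

/-- The primitive of `stepDown a b` vanishing at `0`: for `0 ≤ a` it equals `t` up to `a` and is
constant from `b` on. -/
def ramp (a b t : ℝ) : ℝ := ∫ s in (0 : ℝ)..t, stepDown a b s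

theorem hasDerivAt_ramp (a b t : ℝ) : HasDerivAt (ramp a b) (stepDown a b t) t :=
  have hc : Continuous (stepDown a b) := (contDiff_stepDown a b (m := 0)).continuous
  intervalIntegral.integral_hasDerivAt_right (hc.intervalIntegrable _ _)
    (hc.stronglyMeasurableAtFilter _ _) hc.continuousAt

theorem hasDerivAt_stepDown (a b t : ℝ) :
    HasDerivAt (stepDown a b) (deriv (stepDown a b) t) t :=
  ((contDiff_stepDown a b (m := 1)).differentiable one_ne_zero t).hasDerivAt

theorem contDiff_ramp (a b : ℝ) : ContDiff ℝ 2 (ramp a b) := by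
  have h : deriv (ramp a b) = stepDown a b := funext fun t => (hasDerivAt_ramp a b t).deriv
  rw [show (2 : WithTop ℕ∞) = 1 + 1 by norm_num, contDiff_succ_iff_deriv]
  exact ⟨fun t => (hasDerivAt_ramp a b t).differentiableAt, by simp, h ▸ contDiff_stepDown a b⟩

theorem ramp_zero (a b : ℝ) : ramp a b 0 = 0 := intervalIntegral.integral_same

theorem ramp_nonneg (a b : ℝ) {t : ℝ} (ht : 0 ≤ t) : 0 ≤ ramp a b t :=
  intervalIntegral.integral_nonneg ht fun s _ => stepDown_nonneg a b s

theorem intervalIntegrable_stepDown (a b s t : ℝ) :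
    IntervalIntegrable (stepDown a b) volume s t :=
  (contDiff_stepDown a b (m := 0)).continuous.intervalIntegrable _ _

theorem ramp_le_self (a b : ℝ) {t : ℝ} (ht : 0 ≤ t) : ramp a b t ≤ t := by
  have := intervalIntegral.integral_mono_on ht (intervalIntegrable_stepDown a b 0 t)
    (intervalIntegrable_const (c := (1 : ℝ))) fun s _ => stepDown_le_one a b s
  rw [intervalIntegral.integral_const, sub_zero, smul_eq_mul, mul_one] at this
  exact this

theorem ramp_le {a b t : ℝ} (ha : 0 ≤ a) (hab : a < b) (ht : 0 ≤ t) : ramp a b t ≤ b := by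
  rcases le_total t b with h | h
  · exact (ramp_le_self a b ht).trans h
  · rw [ramp, ← intervalIntegral.integral_add_adjacent_intervals
      (intervalIntegrable_stepDown a b 0 b) (intervalIntegrable_stepDown a b b t)]
    have h1 : ∫ s in b..t, stepDown a b s = 0 := by
      rw [intervalIntegral.integral_congr (g := fun _ => (0 : ℝ))]
      · simp
      · intro s hs
        rw [uIcc_of_le h] at hs
        exact stepDown_of_ge hab hs.1
    rw [h1, add_zero]
    exact ramp_le_self a b (ha.trans hab.le)

/-- The function `ψ(x')` multiplied by a smooth cutoff in `x_N` that is `1` for `|x_N| ≤ 1` and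
vanishes for `|x_N| ≥ 2`. -/
def cylinder (ψ : EuclideanSpace ℝ (Fin n) → ℝ) (x : EuclideanSpace ℝ (Fin (n + 1))) : ℝ :=
  ψ (tangential x) * (⟨1, 2, one_pos, one_lt_two⟩ : ContDiffBump (0 : ℝ)) (x (Fin.last n))

theorem contDiff_cylinder {ψ : EuclideanSpace ℝ (Fin n) → ℝ} (hψ : ContDiff ℝ 2 ψ) :
    ContDiff ℝ 2 (cylinder ψ) :=
  (hψ.comp contDiff_tangential).mul (ContDiffBump.contDiff _ |>.comp contDiff_last)

theorem hasCompactSupport_cylinder {ψ : EuclideanSpace ℝ (Fin n) → ℝ}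
    (hψ : HasCompactSupport ψ) : HasCompactSupport (cylinder ψ) := by
  set η : ContDiffBump (0 : ℝ) := ⟨1, 2, one_pos, one_lt_two⟩
  refine HasCompactSupport.intro ((hψ.isCompact.prod η.hasCompactSupport.isCompact).image
    (pointCLE n).continuous) fun x hx => ?_
  by_contra h
  refine hx ⟨(tangential x, x (Fin.last n)), ⟨subset_tsupport _ ?_, subset_tsupport _ ?_⟩,
    point_tangential x⟩
  · exact left_ne_zero_of_mul h
  · exact right_ne_zero_of_mul h

theorem cylinder_point_of_abs_le (ψ : EuclideanSpace ℝ (Fin n) → ℝ) (x' : EuclideanSpace ℝ (Fin n))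
    {t : ℝ} (ht : |t| ≤ 1) : cylinder ψ (point x' t) = ψ x' := by
  rw [cylinder, tangential_point, point_last, ContDiffBump.one_of_mem_closedBall, mul_one]
  simpa using ht

theorem fderiv_cylinder_normalVector {ψ : EuclideanSpace ℝ (Fin n) → ℝ} (hψ : ContDiff ℝ 2 ψ)
    {x : EuclideanSpace ℝ (Fin (n + 1))} (hx : |x (Fin.last n)| < 1) :
    fderiv ℝ (cylinder ψ) x (normalVector n) = 0 := by
  have h1 := hasDerivAt_comp_point (tangential x) (x (Fin.last n))
    ((contDiff_cylinder hψ).differentiable two_ne_zero _)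
  have h2 : (fun t => cylinder ψ (point (tangential x) t)) =ᶠ[𝓝 (x (Fin.last n))]
      fun _ => ψ (tangential x) := by
    filter_upwards [continuous_abs.continuousAt.eventually_lt_const hx] with t ht
    exact cylinder_point_of_abs_le ψ _ (le_of_lt ht)
  have h3 := h1.unique (h2.hasDerivAt_iff.2 (hasDerivAt_const _ _))
  rwa [point_tangential] at h3

/-- The trace at height `ε` is the limit of weighted means over thin layers above height `ε`. -/
theorem IsSobolevTrace.exists_layer {p : ℝ≥0} (hp : 1 ≤ p)
    {u : EuclideanSpace ℝ (Fin (n + 1)) → ℝ} {ε : ℝ} (hε : 0 < ε) (hε1 : ε < 1 / 2)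
    {g : EuclideanSpace ℝ (Fin n) → ℝ} (h : IsSobolevTrace p u ε g)
    {ψ : EuclideanSpace ℝ (Fin n) → ℝ} (hψ : ContDiff ℝ 2 ψ) (hψc : HasCompactSupport ψ)
    {η : ℝ} (hη : 0 < η) :
    ∃ b, ε < b ∧ b ≤ 2 * ε ∧
      |(∫ x in halfSpace n, u x * (cylinder ψ x * deriv (stepDown ε b) (x (Fin.last n)))) +
        ∫ x', ψ x' * g x'| ≤ η := by
  obtain ⟨G, hG, hform⟩ := h.integral_above hp hε
  set Ψ := cylinder ψ
  have hΨ : ContDiff ℝ 2 Ψ := contDiff_cylinder hψ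
  have hΨc : HasCompactSupport Ψ := hasCompactSupport_cylinder hψc
  set A := {x : EuclideanSpace ℝ (Fin (n + 1)) | ε < x (Fin.last n)}
  have hA : MeasurableSet A := measurableSet_lt measurable_const continuous_last.measurable
  -- A cutoff near the boundary, where `G` need not be integrable.
  set c : ℝ → ℝ := fun t => 1 - stepDown (ε / 4) (ε / 2) t
  have hc : ContDiff ℝ 1 c := contDiff_const.sub (contDiff_stepDown _ _)
  have hc1 : ∀ t, ε / 2 ≤ t → c t = 1 := fun t ht => by
    simp only [c]
    rw [stepDown_of_ge (by linarith) ht, sub_zero]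
  set Z : EuclideanSpace ℝ (Fin (n + 1)) → ℝ := fun x => Ψ x * c (x (Fin.last n))
  have hZ : ContDiff ℝ 1 Z := (hΨ.of_le (by norm_num)).mul (hc.comp contDiff_last)
  have hZc : HasCompactSupport Z := hΨc.mul_right
  have hZs : tsupport Z ⊆ halfSpace n := by
    have : tsupport Z ⊆ {x | ε / 4 ≤ x (Fin.last n)} := by
      refine closure_minimal (fun x hx => ?_) (isClosed_le continuous_const continuous_last)
      by_contra h'
      refine hx ?_
      simp only [Z, c]
      rw [stepDown_of_le (by linarith) (le_of_lt (not_le.1 h')), sub_self, mul_zero]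
    intro x hx
    have h1 : ε / 4 ≤ x (Fin.last n) := this hx
    change 0 < x (Fin.last n)
    linarith
  have hK := hZc.isCompact
  -- The formula for the layer between the heights `ε` and `b`.
  have hlayer : ∀ b, ε < b → b < 1 →
      (∫ x in halfSpace n, u x * (Ψ x * deriv (stepDown ε b) (x (Fin.last n)))) +
        ∫ x', ψ x' * g x' =
      -∫ x in A, G x (Fin.last n) * (Z x * stepDown ε b (x (Fin.last n))) := by
    intro b hb hb1
    have hζ : ContDiff ℝ 1 fun x => Z x * stepDown ε b (x (Fin.last n)) :=
      hZ.mul ((contDiff_stepDown ε b).comp contDiff_last)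
    have h1 := hform _ hζ hZc.mul_right
      ((closure_mono (Function.support_mul_subset_left _ _)).trans hZs)
    have h2 : ∫ x', g x' * (Z (point x' ε) * stepDown ε b (point x' ε (Fin.last n))) =
        ∫ x', ψ x' * g x' := by
      refine integral_congr_ae (ae_of_all _ fun x' => ?_)
      simp only [Z, Ψ, point_last]
      rw [stepDown_of_le hb le_rfl, hc1 _ (by linarith), cylinder_point_of_abs_le, mul_one, mul_one,
        mul_comm]
      rw [abs_of_pos hε]
      linarith
    have h3 : ∫ x in A, u x * fderiv ℝ (fun x => Z x * stepDown ε b (x (Fin.last n))) x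
          (normalVector n) =
        ∫ x in halfSpace n, u x * (Ψ x * deriv (stepDown ε b) (x (Fin.last n))) := by
      have hR : ∫ x in halfSpace n, u x * (Ψ x * deriv (stepDown ε b) (x (Fin.last n))) =
          ∫ x in A, u x * (Ψ x * deriv (stepDown ε b) (x (Fin.last n))) := by
        refine setIntegral_eq_of_subset_of_forall_sdiff_eq_zero measurableSet_halfSpace
          (fun x (hx : ε < _) => hε.trans hx) fun x hx => ?_
        rw [deriv_stepDown_of_le hb (not_lt.1 hx.2), mul_zero, mul_zero]
      rw [hR]
      refine setIntegral_congr_fun hA fun x (hx : ε < x (Fin.last n)) => ?_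
      have h4 := hasDerivAt_comp_point (tangential x) (x (Fin.last n))
        (hζ.differentiable one_ne_zero _)
      have h5 := (hasDerivAt_comp_point (tangential x) (x (Fin.last n))
        (hΨ.differentiable two_ne_zero _)).mul (hasDerivAt_stepDown ε b (x (Fin.last n)))
      have h6 := h4.unique (h5.congr_of_eventuallyEq (by
        filter_upwards [Ioi_mem_nhds (show ε / 2 < x (Fin.last n) by linarith)] with t ht
        simp only [Z, point_last, Pi.mul_apply]
        rw [hc1 t (le_of_lt ht), mul_one]))
      rw [point_tangential] at h6
      simp only
      rw [h6]
      congr 1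
      have h7 : fderiv ℝ Ψ x (normalVector n) * stepDown ε b (x (Fin.last n)) = 0 := by
        rcases lt_or_ge (x (Fin.last n)) 1 with h8 | h8
        · rw [fderiv_cylinder_normalVector hψ, zero_mul]
          rwa [abs_of_pos (hε.trans hx)]
        · rw [stepDown_of_ge hb (hb1.le.trans h8), mul_zero]
      rw [h7, zero_add]
    rw [h2, h3] at h1
    linarith
  have hlim : Tendsto (fun b => ∫ x in A, G x (Fin.last n) * (Z x * stepDown ε b (x (Fin.last n))))
      (𝓝[>] ε) (𝓝 (∫ x in A, (0 : ℝ))) := by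
    have hGi : IntegrableOn G (tsupport Z) volume := by
      have : IsFiniteMeasure (volume.restrict (tsupport Z)) := ⟨by simpa using hK.measure_lt_top⟩
      exact (hG.memLp_grad _ hK hZs).integrable (by exact_mod_cast hp)
    obtain ⟨C, hC⟩ := hZc.exists_bound_of_continuous hZ.continuous
    have hGZ : Integrable (fun x => G x (Fin.last n) * Z x) volume := by
      have h1 : IntegrableOn (fun x => G x (Fin.last n)) (tsupport Z) volume :=
        (EuclideanSpace.proj (Fin.last n) :
          EuclideanSpace ℝ (Fin (n + 1)) →L[ℝ] ℝ).integrable_comp hGi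
      have h2 : IntegrableOn (fun x => G x (Fin.last n) * Z x) (tsupport Z) volume :=
        h1.mul_bdd (c := C) hZ.continuous.aestronglyMeasurable (ae_of_all _ hC)
      refine (integrableOn_iff_integrable_of_support_subset fun x hx => ?_).1 h2
      exact subset_tsupport _ (right_ne_zero_of_mul hx)
    have hsm : ∀ b, Continuous fun x : EuclideanSpace ℝ (Fin (n + 1)) =>
        stepDown ε b (x (Fin.last n)) := fun b =>
      (contDiff_stepDown ε b (m := 0)).continuous.comp continuous_last
    refine tendsto_integral_filter_of_dominated_convergence
      (fun x => ‖G x (Fin.last n) * Z x‖) (Eventually.of_forall fun b => ?_)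
      (Eventually.of_forall fun b => ae_of_all _ fun x => ?_) hGZ.norm.integrableOn ?_
    · have := (hGZ.integrableOn (s := A)).aestronglyMeasurable.mul (hsm b).aestronglyMeasurable
      refine this.congr (ae_of_all _ fun x => ?_)
      simp [mul_assoc]
    · rw [← mul_assoc, norm_mul]
      refine mul_le_of_le_one_right (norm_nonneg _) ?_
      rw [Real.norm_of_nonneg (stepDown_nonneg _ _ _)]
      exact stepDown_le_one _ _ _
    · refine (ae_restrict_mem hA).mono fun x (hx : ε < x (Fin.last n)) => ?_
      refine tendsto_const_nhds.congr' ?_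
      filter_upwards [Ioo_mem_nhdsGT hx] with b hb
      rw [stepDown_of_ge hb.1 hb.2.le, mul_zero, mul_zero]
  rw [integral_zero] at hlim
  have h1 := (tendsto_order.1 hlim.abs).2 η (by simpa using hη)
  have h2 : ∀ᶠ b in 𝓝[>] ε, b ∈ Ioo ε (2 * ε) := Ioo_mem_nhdsGT (by linarith)
  obtain ⟨b, hb1, hb2⟩ := (h1.and h2).exists
  refine ⟨b, hb2.1, hb2.2.le, ?_⟩
  rw [hlayer b hb2.1 (by linarith [hb2.2]), abs_neg]
  exact hb1.le

theorem isTest_cylinder_mul_ramp {ψ : EuclideanSpace ℝ (Fin n) → ℝ} (hψ : ContDiff ℝ 2 ψ)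
    (hψc : HasCompactSupport ψ) (a b : ℝ) :
    IsTest fun x => cylinder ψ x * ramp a b (x (Fin.last n)) :=
  ⟨(contDiff_cylinder hψ).mul ((contDiff_ramp a b).comp contDiff_last),
    (hasCompactSupport_cylinder hψc).mul_right, fun x' => by
      rw [point_last, ramp_zero, mul_zero]⟩

theorem normalDeriv_cylinder_mul_ramp {ψ : EuclideanSpace ℝ (Fin n) → ℝ} (hψ : ContDiff ℝ 2 ψ)
    (hψc : HasCompactSupport ψ) {a b : ℝ} (ha : 0 < a) (hab : a < b) :
    normalDeriv (fun x => cylinder ψ x * ramp a b (x (Fin.last n))) = ψ := by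
  funext x'
  have h1 := hasDerivAt_comp_point x' 0
    ((isTest_cylinder_mul_ramp hψ hψc a b).contDiff.differentiable two_ne_zero _)
  have h2 := (hasDerivAt_comp_point x' 0
    ((contDiff_cylinder hψ).differentiable two_ne_zero _)).mul (hasDerivAt_ramp a b 0)
  have h3 : (fun t => cylinder ψ (point x' t)) * ramp a b = fun t =>
      cylinder ψ (point x' t) * ramp a b (point x' t (Fin.last n)) := by
    funext t
    rw [Pi.mul_apply, point_last]
  rw [h3] at h2
  have h4 := h1.unique h2
  rw [ramp_zero, mul_zero, zero_add, stepDown_of_le hab ha.le, mul_one,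
    cylinder_point_of_abs_le ψ x' (by simp)] at h4
  exact h4

theorem laplacian_cylinder_mul_ramp {ψ : EuclideanSpace ℝ (Fin n) → ℝ} (hψ : ContDiff ℝ 2 ψ)
    {a b : ℝ} (hab : a < b) (hb : b ≤ 1) {x : EuclideanSpace ℝ (Fin (n + 1))}
    (hx : x ∈ halfSpace n) :
    Laplacian.laplacian (fun x => cylinder ψ x * ramp a b (x (Fin.last n))) x =
      Laplacian.laplacian (cylinder ψ) x * ramp a b (x (Fin.last n)) +
        cylinder ψ x * deriv (stepDown a b) (x (Fin.last n)) := by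
  rw [laplacian_mul_comp_last (contDiff_cylinder hψ) (contDiff_ramp a b) (hasDerivAt_ramp a b)
    (hasDerivAt_stepDown a b)]
  have : fderiv ℝ (cylinder ψ) x (normalVector n) * stepDown a b (x (Fin.last n)) = 0 := by
    rcases lt_or_ge (x (Fin.last n)) 1 with h | h
    · rw [fderiv_cylinder_normalVector hψ, zero_mul]
      rwa [abs_of_pos hx]
    · rw [stepDown_of_ge hab (hb.trans h), mul_zero]
  rw [mul_assoc, this, mul_zero, add_zero]

/-- The traces of a weak solution converge to its boundary measure: the weak formulation is tested
with `ψ(x') θ(x_N)`, where `θ(t)` is a smooth version of `min t ε`, so that the second derivative of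
`θ` is minus an approximate point mass at `ε`, and all other terms vanish in the limit. -/
theorem IsWeakSolution.tendsto_trace {m : LocalRadonMeasure (halfSpace n)}
    {ν : LocalRadonMeasure (EuclideanSpace ℝ (Fin n))} {u : EuclideanSpace ℝ (Fin (n + 1)) → ℝ}
    (hu : IsWeakSolution m ν u) {p : ℝ≥0} (hp : 1 ≤ p) {U : ℝ → EuclideanSpace ℝ (Fin n) → ℝ}
    (hU : ∀ ε > 0, IsSobolevTrace p u ε (U ε)) {ψ : EuclideanSpace ℝ (Fin n) → ℝ}
    (hψ : ContDiff ℝ 2 ψ) (hψc : HasCompactSupport ψ) :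
    Tendsto (fun ε => ∫ x', ψ x' * U ε x') (𝓝[>] 0) (𝓝 (ν.integral ψ)) := by
  obtain ⟨hm, hul, hsol⟩ := hu
  have hΨ : ContDiff ℝ 2 (cylinder ψ) := contDiff_cylinder hψ
  have hΨc : HasCompactSupport (cylinder ψ) := hasCompactSupport_cylinder hψc
  have iuΔ : IntegrableOn (fun x => u x * Laplacian.laplacian (cylinder ψ) x) (halfSpace n)
      volume := hul.integrableOn_mul (continuous_laplacian hΨ) (hasCompactSupport_laplacian hΨc)
  set A := ∫ x in halfSpace n, |u x * Laplacian.laplacian (cylinder ψ) x|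
  -- `M ε` bounds the contribution of the measure `m`; it vanishes in the limit because `x_N` is
  -- `|m|`-integrable on bounded sets.
  set M : ℝ → ℝ := fun ε => ∫ x : halfSpace n,
    |cylinder ψ x| * min (x.1 (Fin.last n)) (2 * ε) ∂m.totalVariation
  obtain ⟨C, hC⟩ := hΨc.exists_bound_of_continuous hΨ.continuous
  obtain ⟨R, hR⟩ := hΨc.isCompact.isBounded.subset_closedBall 0
  have hlast : Measurable fun x : halfSpace n => x.1 (Fin.last n) :=
    (continuous_last.comp continuous_subtype_val).measurable
  have hcyl : Measurable fun x : halfSpace n => cylinder ψ x :=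
    (hΨ.continuous.comp continuous_subtype_val).measurable
  have hR0 : ∀ x : halfSpace n, R < ‖x.1‖ → cylinder ψ x = 0 := fun x hx =>
    image_eq_zero_of_notMem_tsupport fun h => by
      have := hR h
      simp only [Metric.mem_closedBall, dist_zero_right] at this
      linarith
  have iM : Integrable (fun x : halfSpace n => |cylinder ψ x| * x.1 (Fin.last n))
      m.totalVariation := by
    refine integrable_of_le_last (C := C) (R := R) hm (hcyl.abs.mul hlast) (fun x => ?_)
      fun x hx => by rw [hR0 x hx, abs_zero, zero_mul]
    rw [abs_mul, abs_abs, abs_of_pos (a := x.1 (Fin.last n)) x.2]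
    exact mul_le_mul_of_nonneg_right (hC x) (le_of_lt x.2)
  have hM : Tendsto M (𝓝[>] 0) (𝓝 0) := by
    suffices Tendsto M (𝓝[>] 0) (𝓝 (∫ _ : halfSpace n, (0 : ℝ) ∂m.totalVariation)) by
      simpa using this
    have hpos : ∀ᶠ ε : ℝ in 𝓝[>] 0, 0 < ε := self_mem_nhdsWithin
    refine tendsto_integral_filter_of_dominated_convergence _
      (Eventually.of_forall fun ε => (hcyl.abs.mul
        (hlast.min measurable_const)).aestronglyMeasurable)
      (hpos.mono fun ε hε => ae_of_all _ fun x => ?_) iM (ae_of_all _ fun x => ?_)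
    · have h1 : 0 ≤ min (x.1 (Fin.last n)) (2 * ε) := le_min (le_of_lt x.2) (by linarith)
      rw [Real.norm_of_nonneg (mul_nonneg (abs_nonneg _) h1)]
      exact mul_le_mul_of_nonneg_left (min_le_left _ _) (abs_nonneg _)
    · have h1 : Tendsto (fun ε : ℝ => |cylinder ψ x| * min (x.1 (Fin.last n)) (2 * ε)) (𝓝 0)
          (𝓝 (|cylinder ψ x| * min (x.1 (Fin.last n)) (2 * 0))) := by
        apply Continuous.tendsto
        fun_prop
      rw [mul_zero, min_eq_right (le_of_lt x.2), mul_zero] at h1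
      exact h1.mono_left nhdsWithin_le_nhds
  -- The quantitative estimate.
  have hest : ∀ᶠ ε : ℝ in 𝓝[>] 0,
      |(∫ x', ψ x' * U ε x') - ν.integral ψ| ≤ ε + 2 * ε * A + M ε := by
    filter_upwards [Ioo_mem_nhdsGT (show (0 : ℝ) < 1 / 2 by norm_num)] with ε hε
    obtain ⟨b, hb1, hb2, hb3⟩ := (hU ε hε.1).exists_layer hp hε.1 hε.2 hψ hψc hε.1
    set φ : EuclideanSpace ℝ (Fin (n + 1)) → ℝ :=
      fun x => cylinder ψ x * ramp ε b (x (Fin.last n))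
    have hφ : IsTest φ := isTest_cylinder_mul_ramp hψ hψc ε b
    have hramp : ∀ x ∈ halfSpace n, |ramp ε b (x (Fin.last n))| ≤ min (x (Fin.last n)) (2 * ε) := by
      intro x hx
      rw [abs_of_nonneg (ramp_nonneg _ _ (le_of_lt hx))]
      exact le_min (ramp_le_self _ _ (le_of_lt hx))
        ((ramp_le hε.1.le hb1 (le_of_lt hx)).trans hb2)
    have h1 := hsol φ hφ
    rw [normalDeriv_cylinder_mul_ramp hψ hψc hε.1 hb1] at h1
    have hrc : Continuous fun x : EuclideanSpace ℝ (Fin (n + 1)) => ramp ε b (x (Fin.last n)) :=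
      (contDiff_ramp ε b).continuous.comp continuous_last
    have i1 : IntegrableOn (fun x => u x *
        (Laplacian.laplacian (cylinder ψ) x * ramp ε b (x (Fin.last n)))) (halfSpace n) volume :=
      hul.integrableOn_mul ((continuous_laplacian hΨ).mul hrc)
        (hasCompactSupport_laplacian hΨc).mul_right
    have i2 : IntegrableOn (fun x => u x *
        (cylinder ψ x * deriv (stepDown ε b) (x (Fin.last n)))) (halfSpace n) volume :=
      hul.integrableOn_mul (hΨ.continuous.mul
        (((contDiff_stepDown ε b (m := 1)).continuous_deriv le_rfl).comp continuous_last))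
        hΨc.mul_right
    have h2 : ∫ x in halfSpace n, u x * Laplacian.laplacian φ x =
        (∫ x in halfSpace n, u x *
          (Laplacian.laplacian (cylinder ψ) x * ramp ε b (x (Fin.last n)))) +
        ∫ x in halfSpace n, u x * (cylinder ψ x * deriv (stepDown ε b) (x (Fin.last n))) := by
      rw [← integral_add i1 i2]
      refine setIntegral_congr_fun measurableSet_halfSpace fun x hx => ?_
      simp only [φ]
      rw [laplacian_cylinder_mul_ramp hψ hb1 (by linarith [hε.2]) hx, mul_add]
    have h3 : |∫ x in halfSpace n, u x *
        (Laplacian.laplacian (cylinder ψ) x * ramp ε b (x (Fin.last n)))| ≤ 2 * ε * A := by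
      refine (abs_integral_le_integral_abs).trans ?_
      rw [← integral_const_mul]
      refine setIntegral_mono_on i1.abs (iuΔ.abs.const_mul _) measurableSet_halfSpace
        fun x hx => ?_
      rw [← mul_assoc, abs_mul, mul_comm]
      exact mul_le_mul_of_nonneg_right ((hramp x hx).trans (min_le_right _ _)) (abs_nonneg _)
    have h4 : |m.integral fun x => φ x| ≤ M ε := by
      refine (m.abs_integral_le (hφ.integrable hm)).trans ?_
      refine integral_mono_of_nonneg (ae_of_all _ fun x => abs_nonneg _) ?_
        (ae_of_all _ fun x => ?_)
      · refine iM.mono' (hcyl.abs.mul (hlast.min measurable_const)).aestronglyMeasurable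
          (ae_of_all _ fun x => ?_)
        have h1 : 0 ≤ min (x.1 (Fin.last n)) (2 * ε) :=
          le_min (le_of_lt x.2) (by linarith [hε.1])
        rw [Real.norm_of_nonneg (mul_nonneg (abs_nonneg _) h1)]
        exact mul_le_mul_of_nonneg_left (min_le_left _ _) (abs_nonneg _)
      · simp only [φ, abs_mul]
        exact mul_le_mul_of_nonneg_left (hramp x x.2) (abs_nonneg _)
    rw [h2] at h1
    have h5 := abs_le.1 hb3
    have h6 := abs_le.1 h3
    have h7 := abs_le.1 h4
    rw [abs_le]
    constructor <;> linarith [h5.1, h5.2, h6.1, h6.2, h7.1, h7.2]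
  rw [tendsto_iff_norm_sub_tendsto_zero]
  have hz : Tendsto (fun ε : ℝ => ε + 2 * ε * A + M ε) (𝓝[>] 0) (𝓝 0) := by
    have h1 : Tendsto (fun ε : ℝ => ε + 2 * ε * A) (𝓝 0) (𝓝 (0 + 2 * 0 * A)) := by
      apply Continuous.tendsto
      fun_prop
    have h2 := (h1.mono_left nhdsWithin_le_nhds).add hM
    simpa using h2
  exact squeeze_zero' (Eventually.of_forall fun _ => norm_nonneg _) hest hz

/-- Local Radon measures that agree on `C²_c` agree on `C_c`. -/
theorem integral_eq_of_forall_contDiff {d : ℕ}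
    {ν ν' : LocalRadonMeasure (EuclideanSpace ℝ (Fin d))}
    (h : ∀ ψ : EuclideanSpace ℝ (Fin d) → ℝ, ContDiff ℝ 2 ψ → HasCompactSupport ψ →
      ν.integral ψ = ν'.integral ψ)
    {f : EuclideanSpace ℝ (Fin d) → ℝ} (hf : Continuous f) (hfc : HasCompactSupport f) :
    ν.integral f = ν'.integral f := by
  have happ : ∀ k : ℕ, ∃ g : EuclideanSpace ℝ (Fin d) → ℝ, ContDiff ℝ 2 g ∧
      (∀ x, dist (g x) (f x) < 1 / ((k : ℝ) + 1)) ∧ Function.support g ⊆ Function.support f :=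
    fun k => hf.exists_contDiff_approx 2 (ε := fun _ => 1 / ((k : ℝ) + 1)) continuous_const
      fun x => by positivity
  choose g hg hgd hgs using happ
  have hgc : ∀ k, HasCompactSupport (g k) := fun k => hfc.mono (hgs k)
  obtain ⟨C, hC⟩ := hfc.exists_bound_of_continuous hf
  have hlim : ∀ (a : Measure (EuclideanSpace ℝ (Fin d))) [IsFiniteMeasureOnCompacts a],
      Tendsto (fun k => ∫ x, g k x ∂a) atTop (𝓝 (∫ x, f x ∂a)) := by
    intro a _
    refine tendsto_integral_of_dominated_convergence
      ((tsupport f).indicator fun _ => C + 1) (fun k => (hg k).continuous.aestronglyMeasurable)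
      ?_ (fun k => ae_of_all _ fun x => ?_) (ae_of_all _ fun x => ?_)
    · rw [integrable_indicator_iff (isClosed_tsupport f).measurableSet]
      exact integrableOn_const hfc.isCompact.measure_lt_top.ne
    · by_cases hx : x ∈ tsupport f
      · rw [indicator_of_mem hx]
        have h1 := hgd k x
        have h2 : 1 / ((k : ℝ) + 1) ≤ 1 := by
          rw [div_le_one (by positivity)]
          linarith [(Nat.cast_nonneg k : (0 : ℝ) ≤ k)]
        rw [dist_eq_norm] at h1
        have h3 := norm_le_norm_add_norm_sub' (g k x) (f x)
        linarith [hC x]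
      · rw [indicator_of_notMem hx]
        have : g k x = 0 := by
          by_contra h'
          exact hx (subset_tsupport f (hgs k h'))
        rw [this, norm_zero]
    · rw [tendsto_iff_dist_tendsto_zero]
      exact squeeze_zero (fun _ => dist_nonneg) (fun k => (hgd k x).le)
        tendsto_one_div_add_atTop_nhds_zero_nat
  have h1 := (hlim ν.posPart).sub (hlim ν.negPart)
  have h2 := (hlim ν'.posPart).sub (hlim ν'.negPart)
  refine tendsto_nhds_unique h1 (h2.congr fun k => ?_)
  exact (h (g k) (hg k) (hgc k)).symm

/-! ### Mollifiers whose dyadic differences are Laplacians -/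

theorem antitone_stepDown {a b : ℝ} (h : a < b) : Antitone (stepDown a b) := fun _ _ hst =>
  sub_le_sub_left (Real.smoothTransition.monotone
    (div_le_div_of_nonneg_right (sub_le_sub_right hst a) (sub_pos.2 h).le)) 1

theorem deriv_stepDown_of_ge {a b t : ℝ} (h : a < b) (ht : b ≤ t) :
    deriv (stepDown a b) t = 0 := by
  have hc : Continuous (deriv (stepDown a b)) :=
    (contDiff_stepDown a b (m := 1)).continuous_deriv le_rfl
  have hcl : IsClosed {s | deriv (stepDown a b) s = 0} := isClosed_eq hc continuous_const
  have : closure (Ioi b) ⊆ {s | deriv (stepDown a b) s = 0} := by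
    refine hcl.closure_subset_iff.2 fun s (hs : b < s) => ?_
    have : stepDown a b =ᶠ[𝓝 s] fun _ => 0 := by
      filter_upwards [Ioi_mem_nhds hs] with r hr using stepDown_of_ge h (le_of_lt hr)
    rw [mem_ofPred_eq, this.deriv_eq, deriv_const]
  rw [closure_Ioi] at this
  exact this ht

theorem contDiff_rpow_mul_of_eq_zero {m : WithTop ℕ∞} {h : ℝ → ℝ} (hh : ContDiff ℝ m h) {a : ℝ}
    (ha : 0 < a) (h0 : ∀ s < a, h s = 0) (e : ℝ) : ContDiff ℝ m fun s => s ^ e * h s := by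
  rw [contDiff_iff_contDiffAt]
  intro s
  rcases lt_or_ge s a with hs | hs
  · refine contDiffAt_const (c := (0 : ℝ)) |>.congr_of_eventuallyEq ?_
    filter_upwards [Iio_mem_nhds hs] with r hr
    rw [h0 r hr, mul_zero]
  · exact (Real.contDiffAt_rpow_const_of_ne (by linarith)).mul hh.contDiffAt

theorem contDiff_two_of_hasDerivAt {f f' : ℝ → ℝ} (hf : ∀ s, HasDerivAt f (f' s) s)
    (hf' : ContDiff ℝ 1 f') : ContDiff ℝ 2 f := by
  have h : deriv f = f' := funext fun t => (hf t).deriv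
  rw [show (2 : WithTop ℕ∞) = 1 + 1 by norm_num, contDiff_succ_iff_deriv]
  exact ⟨fun t => (hf t).differentiableAt, by simp, h ▸ hf'⟩

/-- A radial mollifier `ρ` and a compactly supported `k` with `Δk = 2^N ρ(2x) - ρ(x)`. With
`σ` a smooth step that vanishes from `1` on, `k` is the radial function with gradient
`2 x |x|^{-N} (σ(|x|²) - σ(4 |x|²))`, a difference of two truncations of the gradient of the
fundamental solution; this forces `ρ(x) = -4 |x|^{2-N} σ'(|x|²)`, up to normalization. -/
theorem exists_mollifier_laplacian {d : ℕ} (hd : 1 ≤ d) :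
    ∃ ρ k : EuclideanSpace ℝ (Fin d) → ℝ, ContDiff ℝ 1 ρ ∧ ContDiff ℝ 2 k ∧
      (∀ x, 1 < ‖x‖ → ρ x = 0) ∧ (∀ x, 1 < ‖x‖ → k x = 0) ∧ ∫ x, ρ x = 1 ∧
      ∀ x, Laplacian.laplacian k x = 2 ^ d * ρ ((2 : ℝ) • x) - ρ x := by
  set σ : ℝ → ℝ := stepDown (1 / 2) 1
  have hσ : ContDiff ℝ 2 σ := contDiff_stepDown _ _ (m := 2)
  have hσd : ContDiff ℝ 1 (deriv σ) := by
    have h := hσ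
    rw [show (2 : WithTop ℕ∞) = 1 + 1 by norm_num, contDiff_succ_iff_deriv] at h
    exact h.2.2
  have h12 : (1 / 2 : ℝ) < 1 := by norm_num
  -- The radial profiles, as functions of `s = |x|²`.
  set e : ℝ := -(d / 2 : ℝ)
  set h : ℝ → ℝ := fun s => σ s - σ (4 * s)
  have hh : ContDiff ℝ 1 h :=
    (hσ.of_le one_le_two).sub ((hσ.of_le one_le_two).comp (contDiff_const.mul contDiff_id))
  have hh0 : ∀ s < (1 / 8 : ℝ), h s = 0 := fun s hs => by
    simp only [h, σ]
    rw [stepDown_of_le h12 (by linarith), stepDown_of_le h12 (by linarith), sub_self]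
  set κ₁ : ℝ → ℝ := fun s => s ^ e * h s
  have hκ₁ : ContDiff ℝ 1 κ₁ := contDiff_rpow_mul_of_eq_zero hh (by norm_num) hh0 e
  set κ : ℝ → ℝ := fun s => ∫ t in (1 : ℝ)..s, κ₁ t
  have hκd : ∀ s, HasDerivAt κ (κ₁ s) s := fun s =>
    intervalIntegral.integral_hasDerivAt_right (hκ₁.continuous.intervalIntegrable _ _)
      (hκ₁.continuous.stronglyMeasurableAtFilter _ _) hκ₁.continuous.continuousAt
  have hκ : ContDiff ℝ 2 κ := contDiff_two_of_hasDerivAt hκd hκ₁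
  have hκ₁d : ∀ s, HasDerivAt κ₁ (deriv κ₁ s) s := fun s =>
    (hκ₁.differentiable one_ne_zero s).hasDerivAt
  set r : ℝ → ℝ := fun s => s ^ (1 + e) * (-4 * deriv σ s)
  have hσ'0 : ∀ s ≤ (1 / 2 : ℝ), deriv σ s = 0 := fun s hs => deriv_stepDown_of_le h12 hs
  have hr : ContDiff ℝ 1 r := contDiff_rpow_mul_of_eq_zero (contDiff_const.mul hσd)
    (show (0 : ℝ) < 1 / 2 by norm_num) (fun s hs => by rw [hσ'0 s hs.le, mul_zero]) _
  have hr1 : ∀ s, 1 < s → r s = 0 := fun s hs => by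
    simp only [r, σ]
    rw [deriv_stepDown_of_ge h12 hs.le, mul_zero, mul_zero]
  have hr0 : ∀ s, 0 ≤ s → 0 ≤ r s := fun s hs => by
    have := (antitone_stepDown h12).deriv_nonpos (x := s)
    exact mul_nonneg (Real.rpow_nonneg hs _) (by simp only [σ]; linarith)
  have hκ1 : ∀ s, 1 < s → κ s = 0 := fun s hs => by
    simp only [κ]
    rw [intervalIntegral.integral_congr (g := fun _ => (0 : ℝ)), intervalIntegral.integral_zero]
    intro t ht
    rw [uIcc_of_le hs.le] at ht
    simp only [κ₁, h, σ]
    rw [stepDown_of_ge h12 ht.1, stepDown_of_ge h12 (by linarith [ht.1]), sub_self, mul_zero]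
  have hsq : ∀ x : EuclideanSpace ℝ (Fin d), 1 < ‖x‖ → 1 < ‖x‖ ^ 2 := fun x hx => by nlinarith
  -- The ordinary differential equation satisfied by the profiles.
  have hode : ∀ s, 0 ≤ s → 4 * s * deriv κ₁ s + 2 * d * κ₁ s = 2 ^ d * r (4 * s) - r s := by
    intro s hs
    rcases hs.eq_or_lt with rfl | hs
    · simp only [κ₁, r, mul_zero, zero_mul, zero_add]
      rw [hh0 0 (by norm_num), hσ'0 0 (by norm_num)]
      simp
    · have h1 : HasDerivAt h (deriv σ s - deriv σ (4 * s) * 4) s := by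
        have h2 := (hσ.differentiable two_ne_zero s).hasDerivAt
        have h3 := ((hσ.differentiable two_ne_zero (4 * s)).hasDerivAt).comp s
          ((hasDerivAt_id s).const_mul 4)
        have h4 := h2.sub h3
        rw [mul_one] at h4
        exact h4
      have h4 := ((Real.hasDerivAt_rpow_const (p := e) (Or.inl hs.ne')).mul h1)
      have h5 : deriv κ₁ s = e * s ^ (e - 1) * h s + s ^ e * (deriv σ s - deriv σ (4 * s) * 4) :=
        h4.deriv
      have h6 : s * s ^ (e - 1) = s ^ e := by
        rw [Real.rpow_sub_one hs.ne']
        field_simp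
      have h7 : s ^ (1 + e) = s * s ^ e := by rw [Real.rpow_add hs, Real.rpow_one]
      have h8 : (2 : ℝ) ^ d * (4 * s) ^ (1 + e) = 4 * (s * s ^ e) := by
        rw [Real.mul_rpow (by norm_num) hs.le, h7, Real.rpow_add (by norm_num), Real.rpow_one]
        have : (2 : ℝ) ^ d * 4 ^ e = 1 := by
          rw [show (4 : ℝ) = 2 ^ (2 : ℝ) by norm_num, ← Real.rpow_mul (by norm_num),
            ← Real.rpow_natCast, ← Real.rpow_add (by norm_num)]
          simp only [e]
          rw [show (d : ℝ) + 2 * -(d / 2 : ℝ) = 0 by ring, Real.rpow_zero]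
        linear_combination (4 * s * s ^ e) * this
      have h9 : e + d / 2 = 0 := by
        simp only [e]
        ring
      simp only [r]
      rw [h5, ← mul_assoc (2 ^ d : ℝ), h8, h7]
      simp only [κ₁]
      linear_combination (4 * e * h s) * h6 + (4 * (s ^ e * h s)) * h9
  set ρ₀ : EuclideanSpace ℝ (Fin d) → ℝ := fun x => r (‖x‖ ^ 2)
  have hρ₀ : ContDiff ℝ 1 ρ₀ := hr.comp (contDiff_norm_sq ℝ)
  have hρ₀1 : ∀ x, 1 < ‖x‖ → ρ₀ x = 0 := fun x hx => hr1 _ (hsq x hx)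
  have hρ₀c : HasCompactSupport ρ₀ := HasCompactSupport.intro (isCompact_closedBall 0 1)
    fun x hx => hρ₀1 x (by simpa using hx)
  obtain ⟨s, hs, hs'⟩ := exists_deriv_eq_slope σ h12 hσ.continuous.continuousOn
    (hσ.differentiable two_ne_zero).differentiableOn
  have hs0 : 0 < s := lt_trans (by norm_num) hs.1
  have hσs : deriv σ s ≠ 0 := by
    rw [hs']
    simp only [σ]
    rw [stepDown_of_le h12 le_rfl, stepDown_of_ge h12 le_rfl]
    norm_num
  have hpos : 0 < ∫ x, ρ₀ x := by
    refine hρ₀.continuous.integral_pos_of_hasCompactSupport_nonneg_nonzero hρ₀c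
      (fun x => hr0 _ (sq_nonneg _))
      (x := EuclideanSpace.single ⟨0, hd⟩ (Real.sqrt s)) ?_
    simp only [ρ₀, r]
    rw [PiLp.norm_single, Real.norm_of_nonneg (Real.sqrt_nonneg s), Real.sq_sqrt hs0.le]
    exact mul_ne_zero (Real.rpow_pos_of_pos hs0 _).ne' (mul_ne_zero (by norm_num) hσs)
  set c := ∫ x, ρ₀ x
  have hk0 : ContDiff ℝ 2 fun x : EuclideanSpace ℝ (Fin d) => κ (‖x‖ ^ 2) :=
    hκ.comp (contDiff_norm_sq ℝ)
  refine ⟨fun x => c⁻¹ * ρ₀ x, c⁻¹ • fun x => κ (‖x‖ ^ 2), contDiff_const.mul hρ₀,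
    (hk0.const_smul c⁻¹ :), fun x hx => by simp only [hρ₀1 x hx, mul_zero],
    fun x hx => by rw [Pi.smul_apply, hκ1 _ (hsq x hx), smul_zero], ?_, fun x => ?_⟩
  · rw [integral_const_mul, inv_mul_cancel₀ hpos.ne']
  · rw [InnerProductSpace.laplacian_smul _ hk0.contDiffAt,
      laplacian_comp_norm_sq hκ hκd hκ₁d x, hode _ (sq_nonneg _)]
    simp only [ρ₀, norm_smul, mul_pow]
    norm_num
    ring

/-- Mollifiers `ρ j` at scale `2^{-j}` on `ℝ^{n+1}` whose consecutive differences are the Laplacians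
of functions `k j`, with the bounds that scaling dictates. -/
structure DyadicMollifier (n : ℕ) where
  /-- the mollifier at scale `2^{-j}` -/
  ρ : ℕ → EuclideanSpace ℝ (Fin (n + 1)) → ℝ
  /-- the function with Laplacian `ρ (j + 1) - ρ j` -/
  k : ℕ → EuclideanSpace ℝ (Fin (n + 1)) → ℝ
  /-- a constant for the bounds -/
  C : ℝ
  contDiff_ρ : ∀ j, ContDiff ℝ 1 (ρ j)
  contDiff_k : ∀ j, ContDiff ℝ 2 (k j)
  ρ_eq_zero : ∀ j x, (2⁻¹ : ℝ) ^ j < ‖x‖ → ρ j x = 0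
  k_eq_zero : ∀ j x, (2⁻¹ : ℝ) ^ j < ‖x‖ → k j x = 0
  integral_ρ : ∀ j, ∫ x, ρ j x = 1
  abs_ρ_le : ∀ j x, |ρ j x| ≤ C * (2 ^ j) ^ (n + 1)
  abs_k_le : ∀ j x, |k j x| ≤ C * (2 ^ j) ^ (n - 1)
  norm_fderiv_k_le : ∀ j x, ‖fderiv ℝ (k j) x‖ ≤ C * (2 ^ j) ^ n
  laplacian_k : ∀ j x, Laplacian.laplacian (k j) x = ρ (j + 1) x - ρ j x

theorem nonempty_dyadicMollifier {n : ℕ} (hn : 1 ≤ n) : Nonempty (DyadicMollifier n) := by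
  obtain ⟨ρ, k, hρ, hk, hρ0, hk0, hρi, hΔ⟩ := exists_mollifier_laplacian (d := n + 1) (by omega)
  have hρc : HasCompactSupport ρ := HasCompactSupport.intro (isCompact_closedBall 0 1)
    fun x hx => hρ0 x (by simpa using hx)
  have hkc : HasCompactSupport k := HasCompactSupport.intro (isCompact_closedBall 0 1)
    fun x hx => hk0 x (by simpa using hx)
  obtain ⟨C₁, hC₁⟩ := hρc.exists_bound_of_continuous hρ.continuous
  obtain ⟨C₂, hC₂⟩ := hkc.exists_bound_of_continuous hk.continuous
  obtain ⟨C₃, hC₃⟩ := (hkc.fderiv ℝ).exists_bound_of_continuous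
    (hk.continuous_fderiv two_ne_zero)
  set C := max C₁ (max C₂ C₃)
  have hscale : ∀ (j : ℕ) (x : EuclideanSpace ℝ (Fin (n + 1))), (2⁻¹ : ℝ) ^ j < ‖x‖ →
      1 < ‖(2 ^ j : ℝ) • x‖ := by
    intro j x hx
    rw [norm_smul, Real.norm_of_nonneg (by positivity)]
    rw [inv_pow, inv_lt_iff_one_lt_mul₀ (by positivity)] at hx
    linarith
  have haff : ∀ (j : ℕ), (fun x : EuclideanSpace ℝ (Fin (n + 1)) => k ((2 ^ j : ℝ) • x)) =
      fun x => k ((2 ^ j : ℝ) • x + 0) := fun j => by simp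
  have hkj : ∀ j : ℕ, ContDiff ℝ 2
      fun x : EuclideanSpace ℝ (Fin (n + 1)) => k ((2 ^ j : ℝ) • x) :=
    fun j => hk.comp (contDiff_const_smul _)
  obtain ⟨l, rfl⟩ : ∃ l, n = l + 1 := ⟨n - 1, by omega⟩
  refine ⟨⟨fun j x => (2 ^ j) ^ (l + 2) * ρ ((2 ^ j : ℝ) • x),
    fun j => ((2 ^ j : ℝ) ^ l) • fun x => k ((2 ^ j : ℝ) • x), C,
    fun j => contDiff_const.mul (hρ.comp (contDiff_const_smul _)),
    fun j => ((hkj j).const_smul ((2 ^ j : ℝ) ^ l) :),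
    fun j x hx => ?_, fun j x hx => ?_, fun j => ?_, fun j x => ?_, fun j x => ?_, fun j x => ?_,
    fun j x => ?_⟩⟩
  · simp only [hρ0 _ (hscale j x hx), mul_zero]
  · rw [Pi.smul_apply, hk0 _ (hscale j x hx), smul_zero]
  · rw [integral_const_mul, Measure.integral_comp_smul, hρi, finrank_euclideanSpace_fin, smul_eq_mul,
      abs_of_pos (by positivity), mul_one, mul_inv_cancel₀ (by positivity)]
  · rw [abs_mul, abs_of_pos (by positivity), mul_comm]
    exact mul_le_mul_of_nonneg_right ((hC₁ _).trans (le_max_left _ _)) (by positivity)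
  · rw [Pi.smul_apply, smul_eq_mul, abs_mul, abs_of_pos (by positivity), mul_comm,
      Nat.add_sub_cancel]
    exact mul_le_mul_of_nonneg_right
      ((hC₂ _).trans ((le_max_left _ _).trans (le_max_right _ _))) (by positivity)
  · have h1 : HasFDerivAt (fun x : EuclideanSpace ℝ (Fin (l + 1 + 1)) => k ((2 ^ j : ℝ) • x))
        ((2 ^ j : ℝ) • fderiv ℝ k ((2 ^ j : ℝ) • x)) x := by
      have h2 := (hk.differentiable two_ne_zero ((2 ^ j : ℝ) • x)).hasFDerivAt.comp x
        ((hasFDerivAt_id x).const_smul (2 ^ j : ℝ))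
      rw [ContinuousLinearMap.comp_smul, ContinuousLinearMap.comp_id] at h2
      exact h2
    rw [(h1.const_smul ((2 ^ j : ℝ) ^ l)).fderiv, norm_smul, norm_smul,
      Real.norm_of_nonneg (by positivity), Real.norm_of_nonneg (by positivity), ← mul_assoc,
      ← pow_succ, mul_comm]
    exact mul_le_mul_of_nonneg_right
      ((hC₃ _).trans ((le_max_right _ _).trans (le_max_right _ _))) (by positivity)
  · rw [InnerProductSpace.laplacian_smul _ (hkj j).contDiffAt, haff,
      laplacian_comp_smul_add hk, add_zero, hΔ, smul_smul, ← pow_succ', smul_eq_mul]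
    ring

/-! ### Potentials of finite measures -/

/-- The potential of a finite measure with a bounded kernel of small support: interpolation between
the trivial bounds in `L^∞` and `L¹`. The measure `τ` is Lebesgue measure on the whole space or on a
hyperplane, which gives estimates for functions and for traces alike. -/
theorem eLpNorm_potential_le {d : ℕ} {F : Type*} [NormedAddCommGroup F] [NormedSpace ℝ F]
    [MeasurableSpace F] [BorelSpace F] [SecondCountableTopology F]
    {q : EuclideanSpace ℝ (Fin d) → F} (hq : Continuous q) {r M : ℝ}
    (hr : ∀ x, r < ‖x‖ → q x = 0) (hM : ∀ x, ‖q x‖ ≤ M)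
    (σ τ : Measure (EuclideanSpace ℝ (Fin d))) [IsFiniteMeasure σ] [SFinite τ] {A : ℝ≥0∞}
    (hA : ∀ y, τ (Metric.closedBall y r) ≤ A) {p : ℝ} (hp : 1 ≤ p) :
    eLpNorm (fun x => ∫ y, q (x - y) ∂σ) (ENNReal.ofReal p) τ ≤
      ENNReal.ofReal M * σ univ * A ^ (1 / p) := by
  have hp0 : 0 < p := by linarith
  have hMe : ∀ x, ‖q x‖ₑ ≤ ENNReal.ofReal M := fun x => by
    rw [← ofReal_norm]
    exact ENNReal.ofReal_le_ofReal (hM x)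
  have hsup : ∀ x, ‖∫ y, q (x - y) ∂σ‖ₑ ≤ ENNReal.ofReal M * σ univ := fun x => by
    refine (enorm_integral_le_lintegral_enorm _).trans ((lintegral_mono fun y => hMe _).trans ?_)
    rw [lintegral_const]
  have hmeas : Measurable fun z : EuclideanSpace ℝ (Fin d) × EuclideanSpace ℝ (Fin d) =>
      ‖q (z.1 - z.2)‖ₑ :=
    (hq.measurable.comp (measurable_fst.sub measurable_snd)).enorm
  have hL1 : ∫⁻ x, ‖∫ y, q (x - y) ∂σ‖ₑ ∂τ ≤ ENNReal.ofReal M * σ univ * A := by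
    calc ∫⁻ x, ‖∫ y, q (x - y) ∂σ‖ₑ ∂τ ≤ ∫⁻ x, ∫⁻ y, ‖q (x - y)‖ₑ ∂σ ∂τ :=
          lintegral_mono fun x => enorm_integral_le_lintegral_enorm _
      _ = ∫⁻ y, ∫⁻ x, ‖q (x - y)‖ₑ ∂τ ∂σ := lintegral_lintegral_swap hmeas.aemeasurable
      _ ≤ ∫⁻ _, ENNReal.ofReal M * A ∂σ := by
          refine lintegral_mono fun y => ?_
          calc ∫⁻ x, ‖q (x - y)‖ₑ ∂τ
              ≤ ∫⁻ x, (Metric.closedBall y r).indicator (fun _ => ENNReal.ofReal M) x ∂τ := by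
                refine lintegral_mono fun x => ?_
                by_cases hx : x ∈ Metric.closedBall y r
                · rw [indicator_of_mem hx]
                  exact hMe _
                · rw [indicator_of_notMem hx, hr]
                  · simp
                  · simpa [dist_eq_norm] using hx
            _ = ENNReal.ofReal M * τ (Metric.closedBall y r) := by
                rw [lintegral_indicator_const Metric.isClosed_closedBall.measurableSet]
            _ ≤ ENNReal.ofReal M * A := by gcongr; exact hA y
      _ = ENNReal.ofReal M * σ univ * A := by rw [lintegral_const]; ring
  rw [eLpNorm_eq_lintegral_rpow_enorm_toReal (by simpa using hp0) ENNReal.ofReal_ne_top,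
    ENNReal.toReal_ofReal hp0.le]
  have hp1 : 0 ≤ p - 1 := by linarith
  have hfin : (ENNReal.ofReal M * σ univ) ≠ ⊤ :=
    ENNReal.mul_ne_top ENNReal.ofReal_ne_top (measure_ne_top _ _)
  have key : ∫⁻ x, ‖∫ y, q (x - y) ∂σ‖ₑ ^ p ∂τ ≤ (ENNReal.ofReal M * σ univ) ^ p * A := by
    calc ∫⁻ x, ‖∫ y, q (x - y) ∂σ‖ₑ ^ p ∂τ
        ≤ ∫⁻ x, (ENNReal.ofReal M * σ univ) ^ (p - 1) * ‖∫ y, q (x - y) ∂σ‖ₑ ∂τ := by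
          refine lintegral_mono fun x => ?_
          calc ‖∫ y, q (x - y) ∂σ‖ₑ ^ p
              = ‖∫ y, q (x - y) ∂σ‖ₑ ^ (p - 1) * ‖∫ y, q (x - y) ∂σ‖ₑ := by
                conv_lhs => rw [show p = (p - 1) + 1 by ring]
                rw [ENNReal.rpow_add_of_nonneg _ _ hp1 zero_le_one, ENNReal.rpow_one]
            _ ≤ _ := by gcongr; exact hsup x
      _ = (ENNReal.ofReal M * σ univ) ^ (p - 1) * ∫⁻ x, ‖∫ y, q (x - y) ∂σ‖ₑ ∂τ :=
          lintegral_const_mul' _ _ (ENNReal.rpow_ne_top_of_nonneg hp1 hfin)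
      _ ≤ (ENNReal.ofReal M * σ univ) ^ (p - 1) * (ENNReal.ofReal M * σ univ * A) := by gcongr
      _ = (ENNReal.ofReal M * σ univ) ^ p * A := by
          rw [← mul_assoc]
          congr 1
          conv_rhs => rw [show p = (p - 1) + 1 by ring]
          rw [ENNReal.rpow_add_of_nonneg _ _ hp1 zero_le_one, ENNReal.rpow_one]
  refine (ENNReal.rpow_le_rpow key (by positivity)).trans_eq ?_
  rw [ENNReal.mul_rpow_of_nonneg _ _ (by positivity), ← ENNReal.rpow_mul,
    mul_one_div_cancel hp0.ne', ENNReal.rpow_one]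

theorem hasFDerivAt_potential {d : ℕ} {k : EuclideanSpace ℝ (Fin d) → ℝ} (hk : ContDiff ℝ 1 k)
    {M : ℝ} (hM : ∀ x, ‖fderiv ℝ k x‖ ≤ M) {C : ℝ} (hC : ∀ x, |k x| ≤ C)
    (σ : Measure (EuclideanSpace ℝ (Fin d))) [IsFiniteMeasure σ] (x : EuclideanSpace ℝ (Fin d)) :
    HasFDerivAt (fun x => ∫ y, k (x - y) ∂σ) (∫ y, fderiv ℝ k (x - y) ∂σ) x := by
  have hc : ∀ x : EuclideanSpace ℝ (Fin d), Continuous fun y => k (x - y) := fun x =>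
    hk.continuous.comp (continuous_const.sub continuous_id)
  refine hasFDerivAt_integral_of_dominated_of_fderiv_le (bound := fun _ => M) (s := univ)
    (F' := fun x y => fderiv ℝ k (x - y)) univ_mem
    (Eventually.of_forall fun x => (hc x).aestronglyMeasurable) ?_ ?_
    (ae_of_all _ fun y x _ => hM _) (integrable_const M) (ae_of_all _ fun y x _ => ?_)
  · exact Integrable.of_bound (hc x).aestronglyMeasurable C (ae_of_all _ fun y => hC _)
  · exact ((hk.continuous_fderiv one_ne_zero).comp
      (continuous_const.sub continuous_id)).aestronglyMeasurable
  · have h1 := (hk.differentiable one_ne_zero (x - y)).hasFDerivAt.comp x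
      ((hasFDerivAt_id x).sub_const y)
    rw [ContinuousLinearMap.comp_id] at h1
    exact h1

/-- With the exponent `p = (n + 2) / (n + 1) = 1 + 1 / N`, the potential estimate at scale `2^{-j}`
decays geometrically as soon as `e (n + 2) + 1 ≤ d (n + 1)`. -/
theorem dyadic_bound_le {n e d : ℕ} (h : e * (n + 2) + 1 ≤ d * (n + 1)) {C : ℝ} (S A : ℝ≥0∞)
    (j : ℕ) :
    ENNReal.ofReal (C * (2 ^ j) ^ e) * S *
        (A * ENNReal.ofReal (((2⁻¹ : ℝ) ^ j) ^ d)) ^ (1 / (((n : ℝ) + 2) / (n + 1))) ≤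
      ENNReal.ofReal C * S * A ^ (1 / (((n : ℝ) + 2) / (n + 1))) *
        ENNReal.ofReal (2 ^ (-(1 / ((n : ℝ) + 2)))) ^ j := by
  set p : ℝ := ((n : ℝ) + 2) / (n + 1) with hp
  have hp0 : 0 < p := by positivity
  have h2 : (0 : ℝ) < 2 := two_pos
  have hreal : ((2 : ℝ) ^ j) ^ e * (((2⁻¹ : ℝ) ^ j) ^ d) ^ (1 / p) ≤
      (2 ^ (-(1 / ((n : ℝ) + 2)))) ^ j := by
    have e1 : ((2 : ℝ) ^ j) ^ e = 2 ^ ((j : ℝ) * e) := by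
      rw [← pow_mul, ← Real.rpow_natCast]
      push_cast
      rfl
    have e2 : (((2⁻¹ : ℝ) ^ j) ^ d) ^ (1 / p) = 2 ^ (-((j : ℝ) * d * (1 / p))) := by
      rw [← pow_mul, inv_pow, ← Real.rpow_natCast, ← Real.rpow_neg h2.le, ← Real.rpow_mul h2.le]
      congr 1
      push_cast
      ring
    have e3 : ((2 : ℝ) ^ (-(1 / ((n : ℝ) + 2)))) ^ j = 2 ^ (-(1 / ((n : ℝ) + 2)) * j) := by
      rw [Real.rpow_mul_natCast h2.le]
    rw [e1, e2, e3, ← Real.rpow_add h2]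
    refine Real.rpow_le_rpow_of_exponent_le one_le_two ?_
    have h' : (e : ℝ) * (n + 2) + 1 ≤ d * (n + 1) := by exact_mod_cast h
    have h3 : (e : ℝ) - d * (1 / p) ≤ -(1 / ((n : ℝ) + 2)) := by
      rw [hp]
      have hn2 : (0 : ℝ) < n + 2 := by positivity
      have hn1 : (0 : ℝ) < n + 1 := by positivity
      have h4 : (e : ℝ) - d * (1 / (((n : ℝ) + 2) / (n + 1))) =
          ((e : ℝ) * (n + 2) - d * (n + 1)) / (n + 2) := by
        field_simp
      rw [h4, ← neg_div]
      exact div_le_div_of_nonneg_right (by linarith) hn2.le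
    have h5 := mul_le_mul_of_nonneg_left h3 (Nat.cast_nonneg (α := ℝ) j)
    nlinarith [h5]
  rw [ENNReal.mul_rpow_of_nonneg _ _ (by positivity), ENNReal.ofReal_rpow_of_nonneg (by positivity)
    (by positivity), ENNReal.ofReal_mul' (by positivity), ← ENNReal.ofReal_pow (by positivity)]
  calc ENNReal.ofReal C * ENNReal.ofReal ((2 ^ j) ^ e) * S *
        (A ^ (1 / p) * ENNReal.ofReal ((((2⁻¹ : ℝ) ^ j) ^ d) ^ (1 / p)))
      = ENNReal.ofReal C * S * A ^ (1 / p) *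
        (ENNReal.ofReal (((2 : ℝ) ^ j) ^ e) * ENNReal.ofReal ((((2⁻¹ : ℝ) ^ j) ^ d) ^ (1 / p))) := by
        ring
    _ ≤ _ := by
        gcongr
        rw [← ENNReal.ofReal_mul (by positivity)]
        exact ENNReal.ofReal_le_ofReal hreal

theorem ofReal_two_rpow_neg_lt_one (n : ℕ) :
    ENNReal.ofReal (2 ^ (-(1 / ((n : ℝ) + 2)))) < 1 := by
  rw [ENNReal.ofReal_lt_one]
  exact Real.rpow_lt_one_of_one_lt_of_neg one_lt_two (neg_lt_zero.2 (by positivity))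

/-! ### Local limits in `L^p` -/

theorem exists_tendsto_eLpNorm_of_geometric {α F : Type*} [MeasurableSpace α]
    [NormedAddCommGroup F] [CompleteSpace F] {μ : Measure α} {p : ℝ≥0∞} (hp : 1 ≤ p)
    {f : ℕ → α → F} (hf : ∀ j, MemLp (f j) p μ) {r B : ℝ≥0∞} (hr : r < 1) (hB : B ≠ ⊤) {J : ℕ}
    (h : ∀ j ≥ J, eLpNorm (fun x => f (j + 1) x - f j x) p μ ≤ B * r ^ j) :
    ∃ g, MemLp g p μ ∧ Tendsto (fun j => eLpNorm (fun x => f j x - g x) p μ) atTop (𝓝 0) := by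
  have : Fact (1 ≤ p) := ⟨hp⟩
  have hc : CauchySeq fun j => (hf (j + J)).toLp (f (j + J)) := by
    refine cauchySeq_of_edist_le_geometric r B hr hB fun j => ?_
    rw [edist_comm, Lp.edist_toLp_toLp, show j + 1 + J = j + J + 1 by ring]
    refine (h (j + J) (by omega)).trans ?_
    gcongr B * ?_
    exact pow_le_pow_right_of_le_one' hr.le (by omega)
  obtain ⟨G, hG⟩ := cauchySeq_tendsto_of_complete hc
  refine ⟨G, Lp.memLp G, ?_⟩
  have h1 := (Lp.tendsto_Lp_iff_tendsto_eLpNorm' _ _).1 hG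
  refine (tendsto_add_atTop_iff_nat J).1 (h1.congr fun j => eLpNorm_congr_ae ?_)
  filter_upwards [(hf (j + J)).coeFn_toLp] with x hx
  rw [Pi.sub_apply, hx]

/-- Local `L^p` limits on countably many sets fit together to one function. -/
theorem exists_tendsto_eLpNorm_restrict {α F : Type*} [MeasurableSpace α]
    [NormedAddCommGroup F] [CompleteSpace F] {μ : Measure α} {p : ℝ≥0∞} (hp : 1 ≤ p)
    {K : ℕ → Set α} (hK : ∀ i, MeasurableSet (K i))
    {f : ℕ → α → F} (hf : ∀ i j, MemLp (f j) p (μ.restrict (K i))) {r : ℝ≥0∞} (hr : r < 1)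
    (h : ∀ i, ∃ B ≠ ⊤, ∃ J, ∀ j ≥ J,
      eLpNorm (fun x => f (j + 1) x - f j x) p (μ.restrict (K i)) ≤ B * r ^ j) :
    ∃ g : α → F, ∀ i, MemLp g p (μ.restrict (K i)) ∧
      Tendsto (fun j => eLpNorm (fun x => f j x - g x) p (μ.restrict (K i))) atTop (𝓝 0) := by
  have hex : ∀ i, ∃ g, MemLp g p (μ.restrict (K i)) ∧
      Tendsto (fun j => eLpNorm (fun x => f j x - g x) p (μ.restrict (K i))) atTop (𝓝 0) := by
    intro i
    obtain ⟨B, hB, J, hJ⟩ := h i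
    exact exists_tendsto_eLpNorm_of_geometric hp (hf i) hr hB hJ
  choose g hg hlim using hex
  have hp0 : p ≠ 0 := (zero_lt_one.trans_le hp).ne'
  have huniq : ∀ i i', ∀ᵐ x ∂μ.restrict (K i), x ∈ K i' → g i' x = g i x := by
    intro i i'
    rw [← ae_restrict_iff' (hK i'), Measure.restrict_restrict (hK i')]
    have hle1 : μ.restrict (K i' ∩ K i) ≤ μ.restrict (K i) :=
      Measure.restrict_mono inter_subset_right le_rfl
    have hle2 : μ.restrict (K i' ∩ K i) ≤ μ.restrict (K i') :=
      Measure.restrict_mono inter_subset_left le_rfl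
    have hm : ∀ m i, m ≤ μ.restrict (K i) → TendstoInMeasure m f atTop (g i) := by
      intro m i hm
      refine tendstoInMeasure_of_tendsto_eLpNorm hp0
        (fun j => (hf i j).aestronglyMeasurable.mono_measure hm)
        ((hg i).aestronglyMeasurable.mono_measure hm) ?_
      exact tendsto_of_tendsto_of_tendsto_of_le_of_le tendsto_const_nhds (hlim i)
        (fun _ => zero_le) fun j => eLpNorm_mono_measure _ hm
    exact tendstoInMeasure_ae_unique (hm _ i' hle2) (hm _ i hle1)
  classical
  refine ⟨fun x => if hx : ∃ i, x ∈ K i then g (Nat.find hx) x else 0, fun i => ?_⟩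
  have heq : (fun x => if hx : ∃ i, x ∈ K i then g (Nat.find hx) x else 0)
      =ᵐ[μ.restrict (K i)] g i := by
    filter_upwards [ae_all_iff.2 (huniq i), ae_restrict_mem (hK i)] with x hx hxi
    have h1 : ∃ i, x ∈ K i := ⟨i, hxi⟩
    rw [dif_pos h1]
    exact hx _ (Nat.find_spec h1)
  refine ⟨(memLp_congr_ae heq).2 (hg i), (hlim i).congr fun j => eLpNorm_congr_ae ?_⟩
  filter_upwards [heq] with x hx
  rw [hx]

/-! ### Mollification of weak solutions -/

namespace DyadicMollifier

variable (M : DyadicMollifier n)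

/-- The mollification at scale `2^{-j}` of `u`, extended by zero outside the half-space. -/
def mollify (u : EuclideanSpace ℝ (Fin (n + 1)) → ℝ) (j : ℕ) (x : EuclideanSpace ℝ (Fin (n + 1))) :
    ℝ :=
  ∫ y, (halfSpace n).indicator u y * M.ρ j (x - y)

theorem hasCompactSupport_ρ (j : ℕ) : HasCompactSupport (M.ρ j) :=
  HasCompactSupport.intro (isCompact_closedBall 0 ((2⁻¹ : ℝ) ^ j)) fun x hx =>
    M.ρ_eq_zero j x (by simpa using hx)

theorem hasCompactSupport_k (j : ℕ) : HasCompactSupport (M.k j) :=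
  HasCompactSupport.intro (isCompact_closedBall 0 ((2⁻¹ : ℝ) ^ j)) fun x hx =>
    M.k_eq_zero j x (by simpa using hx)

theorem fderiv_k_eq_zero (j : ℕ) (x : EuclideanSpace ℝ (Fin (n + 1))) (hx : (2⁻¹ : ℝ) ^ j < ‖x‖) :
    fderiv ℝ (M.k j) x = 0 := by
  have h : M.k j =ᶠ[𝓝 x] fun _ => 0 := by
    filter_upwards [(isOpen_lt continuous_const continuous_norm).mem_nhds hx] with y hy
    exact M.k_eq_zero j y hy
  rw [h.fderiv_eq, fderiv_const_apply]

theorem contDiff_mollify {u : EuclideanSpace ℝ (Fin (n + 1)) → ℝ}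
    (hu : LocIntegrableUpToBoundary u) (j : ℕ) : ContDiff ℝ 1 (M.mollify u j) :=
  (M.hasCompactSupport_ρ j).contDiff_convolution_right (ContinuousLinearMap.mul ℝ ℝ)
    hu.locallyIntegrable_indicator (M.contDiff_ρ j)

theorem integrable_indicator_mul_ρ {u : EuclideanSpace ℝ (Fin (n + 1)) → ℝ}
    (hu : LocIntegrableUpToBoundary u) (j : ℕ) (x : EuclideanSpace ℝ (Fin (n + 1))) :
    Integrable fun y => (halfSpace n).indicator u y * M.ρ j (x - y) :=
  (M.hasCompactSupport_ρ j).convolutionExists_right (ContinuousLinearMap.mul ℝ ℝ)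
    hu.locallyIntegrable_indicator (M.contDiff_ρ j).continuous x

/-- The function `y ↦ k j (x - y)` as a test function: the increments of the mollifications of a weak
solution are given by the right-hand side of the equation. -/
theorem mollify_succ_sub {m : LocalRadonMeasure (halfSpace n)}
    {ν : LocalRadonMeasure (EuclideanSpace ℝ (Fin n))} {u : EuclideanSpace ℝ (Fin (n + 1)) → ℝ}
    (hu : IsWeakSolution m ν u) (j : ℕ) {x : EuclideanSpace ℝ (Fin (n + 1))}
    (hx : Metric.closedBall x ((2⁻¹ : ℝ) ^ j) ⊆ halfSpace n) :
    M.mollify u (j + 1) x - M.mollify u j x = m.integral fun y => M.k j (x - y) := by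
  have hout : ∀ y, y ∉ halfSpace n → M.k j (x - y) = 0 := fun y hy => by
    refine M.k_eq_zero j _ ?_
    by_contra! h
    exact hy (hx (by rwa [Metric.mem_closedBall, dist_comm, dist_eq_norm]))
  have hb : ∀ x' : EuclideanSpace ℝ (Fin n), point x' 0 ∉ halfSpace n := fun x' => by
    simp [halfSpace, point_last]
  have haff : (fun y => M.k j (x - y)) = fun y => M.k j ((-1 : ℝ) • y + x) := by
    funext y
    congr 1
    simp [sub_eq_neg_add]
  have htest : IsTest fun y => M.k j (x - y) :=
    ⟨(M.contDiff_k j).comp (contDiff_const.sub contDiff_id),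
      (M.hasCompactSupport_k j).comp_homeomorph (Homeomorph.subLeft x), fun x' => hout _ (hb x')⟩
  have hn : normalDeriv (fun y => M.k j (x - y)) = fun _ => 0 := by
    funext x'
    have h : (fun y => M.k j (x - y)) =ᶠ[𝓝 (point x' 0)] fun _ => 0 := by
      filter_upwards [Metric.isClosed_closedBall.isOpen_compl.mem_nhds fun h => hb x' (hx h)]
        with y hy
      refine M.k_eq_zero j _ ?_
      rw [mem_compl_iff, Metric.mem_closedBall, not_le, dist_comm, dist_eq_norm] at hy
      exact hy
    rw [normalDeriv, h.fderiv_eq, fderiv_const_apply]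
    rfl
  have h := hu.2.2 _ htest
  rw [hn] at h
  have h0 : ν.integral (fun _ => 0) = 0 := by simp [LocalRadonMeasure.integral]
  rw [h0, sub_zero] at h
  rw [h, mollify, mollify, ← integral_sub (M.integrable_indicator_mul_ρ hu.2.1 _ _)
    (M.integrable_indicator_mul_ρ hu.2.1 _ _), ← integral_indicator measurableSet_halfSpace]
  refine integral_congr_ae (ae_of_all _ fun y => ?_)
  by_cases hy : y ∈ halfSpace n
  · simp only [indicator_of_mem hy]
    rw [haff, laplacian_comp_smul_add (M.contDiff_k j), M.laplacian_k,
      show (-1 : ℝ) • y + x = x - y by simp [sub_eq_neg_add]]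
    ring
  · simp [indicator_of_notMem hy]

/-- Near a compact subset of the half-space, the increments of the mollifications are potentials of
finite measures. -/
theorem exists_potential {m : LocalRadonMeasure (halfSpace n)}
    {ν : LocalRadonMeasure (EuclideanSpace ℝ (Fin n))} {u : EuclideanSpace ℝ (Fin (n + 1)) → ℝ}
    (hu : IsWeakSolution m ν u) {K : Set (EuclideanSpace ℝ (Fin (n + 1)))} (hK : IsCompact K)
    (hKs : K ⊆ halfSpace n) :
    ∃ σ₁ σ₂ : Measure (EuclideanSpace ℝ (Fin (n + 1))), IsFiniteMeasure σ₁ ∧ IsFiniteMeasure σ₂ ∧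
      ∃ (V : Set (EuclideanSpace ℝ (Fin (n + 1)))) (J : ℕ), IsOpen V ∧ K ⊆ V ∧
        ∀ j ≥ J, ∀ x ∈ V, M.mollify u (j + 1) x - M.mollify u j x =
          (∫ y, M.k j (x - y) ∂σ₁) - ∫ y, M.k j (x - y) ∂σ₂ := by
  obtain ⟨δ, hδ, hδs⟩ := hK.exists_cthickening_subset_open isOpen_halfSpace hKs
  set K' := Metric.cthickening δ K
  have hK' : IsCompact K' := hK.cthickening
  have hpre : IsCompact ((Subtype.val : halfSpace n → _) ⁻¹' K') :=
    (IsInducing.subtypeVal.isCompact_preimage_iff (by simpa using hδs)).2 hK'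
  have hmeas : Measurable (Subtype.val : halfSpace n → EuclideanSpace ℝ (Fin (n + 1))) :=
    measurable_subtype_coe
  have hfin : ∀ σ : Measure (halfSpace n), IsFiniteMeasureOnCompacts σ →
      IsFiniteMeasure ((σ.restrict (Subtype.val ⁻¹' K')).map Subtype.val) := fun σ hσ => by
    have : IsFiniteMeasure (σ.restrict ((Subtype.val : halfSpace n → _) ⁻¹' K')) :=
      ⟨by rw [Measure.restrict_apply_univ]; exact hpre.measure_lt_top⟩
    infer_instance
  have hint : ∀ (σ : Measure (halfSpace n)) (f : EuclideanSpace ℝ (Fin (n + 1)) → ℝ),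
      Continuous f → (∀ y, y ∉ K' → f y = 0) →
      ∫ y, f y ∂((σ.restrict (Subtype.val ⁻¹' K')).map Subtype.val) = ∫ y, f y.1 ∂σ := by
    intro σ f hf h0
    rw [integral_map hmeas.aemeasurable hf.aestronglyMeasurable]
    exact setIntegral_eq_integral_of_forall_compl_eq_zero fun y hy => h0 _ hy
  obtain ⟨J, hJ⟩ := exists_pow_lt_of_lt_one (half_pos hδ) (show (2⁻¹ : ℝ) < 1 by norm_num)
  refine ⟨_, _, hfin _ m.finite_posPart, hfin _ m.finite_negPart, Metric.thickening (δ / 2) K, J,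
    Metric.isOpen_thickening, Metric.self_subset_thickening (half_pos hδ) K, fun j hj x hx => ?_⟩
  have hjδ : (2⁻¹ : ℝ) ^ j < δ / 2 :=
    (pow_le_pow_of_le_one (by norm_num) (by norm_num) hj).trans_lt hJ
  have hball : Metric.closedBall x ((2⁻¹ : ℝ) ^ j) ⊆ K' := by
    intro y hy
    obtain ⟨z, hz, hxz⟩ := Metric.mem_thickening_iff.1 hx
    refine Metric.mem_cthickening_of_dist_le y z δ K hz ?_
    have := dist_triangle y x z
    rw [Metric.mem_closedBall] at hy
    linarith
  have hk0 : ∀ y, y ∉ K' → M.k j (x - y) = 0 := fun y hy => by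
    refine M.k_eq_zero j _ ?_
    by_contra! h
    exact hy (hball (by rwa [Metric.mem_closedBall, dist_comm, dist_eq_norm]))
  have hkc : Continuous fun y => M.k j (x - y) :=
    (M.contDiff_k j).continuous.comp (continuous_const.sub continuous_id)
  rw [M.mollify_succ_sub hu j (hball.trans hδs), hint _ _ hkc hk0, hint _ _ hkc hk0]
  rfl

end DyadicMollifier

theorem continuous_potential {d : ℕ} {F : Type*} [NormedAddCommGroup F] [NormedSpace ℝ F]
    {q : EuclideanSpace ℝ (Fin d) → F} (hq : Continuous q) {M : ℝ} (hM : ∀ x, ‖q x‖ ≤ M)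
    (σ : Measure (EuclideanSpace ℝ (Fin d))) [IsFiniteMeasure σ] :
    Continuous fun x => ∫ y, q (x - y) ∂σ :=
  continuous_of_dominated
    (fun _ => (hq.comp (continuous_const.sub continuous_id)).aestronglyMeasurable)
    (fun _ => ae_of_all _ fun _ => hM _) (integrable_const M)
    (ae_of_all _ fun _ => hq.comp (continuous_id.sub continuous_const))

/-- Geometric decay of the potentials of two finite measures with kernels at scale `2^{-j}`, in
`L^p(τ)` for a measure `τ` of dimension `d`. -/
theorem exists_geometric_bound {e d : ℕ} (h : e * (n + 2) + 1 ≤ d * (n + 1)) {F : Type*}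
    [NormedAddCommGroup F] [NormedSpace ℝ F] [MeasurableSpace F] [BorelSpace F]
    [SecondCountableTopology F] {q : ℕ → EuclideanSpace ℝ (Fin (n + 1)) → F}
    (hq : ∀ j, Continuous (q j)) (hr : ∀ j x, (2⁻¹ : ℝ) ^ j < ‖x‖ → q j x = 0) {C : ℝ}
    (hC : ∀ j x, ‖q j x‖ ≤ C * (2 ^ j) ^ e)
    (σ₁ σ₂ τ : Measure (EuclideanSpace ℝ (Fin (n + 1)))) [IsFiniteMeasure σ₁] [IsFiniteMeasure σ₂]
    [SFinite τ] {A : ℝ≥0∞} (hA : A ≠ ⊤)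
    (hτ : ∀ y r, 0 ≤ r → τ (Metric.closedBall y r) ≤ A * ENNReal.ofReal (r ^ d)) :
    ∃ B ≠ ⊤, ∀ j, eLpNorm (fun x => (∫ y, q j (x - y) ∂σ₁) - ∫ y, q j (x - y) ∂σ₂)
      (ENNReal.ofReal (((n : ℝ) + 2) / (n + 1))) τ ≤
        B * ENNReal.ofReal (2 ^ (-(1 / ((n : ℝ) + 2)))) ^ j := by
  have hp : 1 ≤ ((n : ℝ) + 2) / (n + 1) := by
    rw [one_le_div (by positivity)]
    linarith
  have hb : ∀ (σ : Measure (EuclideanSpace ℝ (Fin (n + 1)))) [IsFiniteMeasure σ] (j : ℕ),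
      eLpNorm (fun x => ∫ y, q j (x - y) ∂σ) (ENNReal.ofReal (((n : ℝ) + 2) / (n + 1))) τ ≤
      ENNReal.ofReal C * σ univ * A ^ (1 / (((n : ℝ) + 2) / (n + 1))) *
        ENNReal.ofReal (2 ^ (-(1 / ((n : ℝ) + 2)))) ^ j := fun σ _ j =>
    (eLpNorm_potential_le (hq j) (hr j) (hC j) σ τ (fun y => hτ y _ (by positivity)) hp).trans
      (dyadic_bound_le h _ _ j)
  have hne : ∀ (σ : Measure (EuclideanSpace ℝ (Fin (n + 1)))) [IsFiniteMeasure σ],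
      ENNReal.ofReal C * σ univ * A ^ (1 / (((n : ℝ) + 2) / (n + 1))) ≠ ⊤ := fun σ _ =>
    ENNReal.mul_ne_top (ENNReal.mul_ne_top ENNReal.ofReal_ne_top (measure_ne_top _ _))
      (ENNReal.rpow_ne_top_of_nonneg (by positivity) hA)
  refine ⟨_, ENNReal.add_ne_top.2 ⟨hne σ₁, hne σ₂⟩, fun j => ?_⟩
  rw [add_mul]
  refine (eLpNorm_sub_le (continuous_potential (hq j) (hC j) σ₁).aestronglyMeasurable
    (continuous_potential (hq j) (hC j) σ₂).aestronglyMeasurable ?_).trans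
    (add_le_add (hb σ₁ j) (hb σ₂ j))
  rwa [ENNReal.one_le_ofReal]

theorem volume_closedBall_le (d : ℕ) (y : EuclideanSpace ℝ (Fin d)) {r : ℝ} (hr : 0 ≤ r) :
    volume (Metric.closedBall y r) ≤
      volume (Metric.ball (0 : EuclideanSpace ℝ (Fin d)) 1) * ENNReal.ofReal (r ^ d) := by
  rw [Measure.addHaar_closedBall _ _ hr, finrank_euclideanSpace_fin, mul_comm]

/-- Lebesgue measure on a hyperplane `{x_N = ε}` has dimension `N - 1`. -/
theorem map_point_closedBall_le (ε : ℝ) (y : EuclideanSpace ℝ (Fin (n + 1))) {r : ℝ} (hr : 0 ≤ r) :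
    (volume.map fun x' : EuclideanSpace ℝ (Fin n) => point x' ε) (Metric.closedBall y r) ≤
      volume (Metric.ball (0 : EuclideanSpace ℝ (Fin n)) 1) * ENNReal.ofReal (r ^ n) := by
  rw [Measure.map_apply (continuous_point ε).measurable Metric.isClosed_closedBall.measurableSet]
  refine (measure_mono fun x' hx' => ?_).trans (volume_closedBall_le n (tangential y) hr)
  rw [mem_preimage, Metric.mem_closedBall, dist_eq_norm] at hx'
  rw [Metric.mem_closedBall, dist_eq_norm]
  refine le_trans (le_of_eq_of_le ?_ (norm_tangential_le (point x' ε - y))) hx'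
  congr 1
  ext i
  simp [tangential, point_castSucc]

/-! ### Sobolev regularity and traces of weak solutions -/

/-- By the Lebesgue differentiation theorem, the mollifications converge almost everywhere. -/
theorem DyadicMollifier.ae_tendsto_mollify (M : DyadicMollifier n)
    {u : EuclideanSpace ℝ (Fin (n + 1)) → ℝ} (hu : LocIntegrableUpToBoundary u) :
    ∀ᵐ x, x ∈ halfSpace n → Tendsto (fun j => M.mollify u j x) atTop (𝓝 (u x)) := by
  filter_upwards [(Besicovitch.vitaliFamily (volume : Measure (EuclideanSpace ℝ (Fin (n + 1))))
    ).ae_tendsto_average_norm_sub hu.locallyIntegrable_indicator] with x h₀ hx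
  have hr : Tendsto (fun j : ℕ => (2⁻¹ : ℝ) ^ j) atTop (𝓝[>] 0) :=
    tendsto_nhdsWithin_iff.2 ⟨tendsto_pow_atTop_nhds_zero_of_lt_one (by norm_num) (by norm_num),
      Eventually.of_forall fun j => by simp⟩
  have h1 := (h₀.comp (Besicovitch.tendsto_filterAt volume x)).comp hr
  rw [indicator_of_mem hx] at h1
  set c := (volume : Measure (EuclideanSpace ℝ (Fin (n + 1)))).real (Metric.ball 0 1)
  have hc : 0 < c := ENNReal.toReal_pos (Metric.measure_ball_pos _ _ one_pos).ne'
    measure_ball_lt_top.ne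
  have h2 := tendsto_integral_smul_of_tendsto_average_norm_sub (g := fun j y => M.ρ j (x - y))
    (M.C * c) h1 (Eventually.of_forall fun j =>
      hu.locallyIntegrable_indicator.integrableOn_isCompact (isCompact_closedBall _ _)) ?_ ?_ ?_
  · refine h2.congr fun j => integral_congr_ae (ae_of_all _ fun y => ?_)
    simp only [smul_eq_mul, mul_comm]
  · exact tendsto_const_nhds.congr fun j =>
      ((integral_sub_left_eq_self (M.ρ j) volume x).trans (M.integral_ρ j)).symm
  · refine Eventually.of_forall fun j y hy => ?_
    by_contra h
    refine hy (M.ρ_eq_zero j _ ?_)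
    rwa [Metric.mem_closedBall, not_le, dist_comm, dist_eq_norm] at h
  · refine Eventually.of_forall fun j y => (M.abs_ρ_le j _).trans_eq ?_
    rw [Measure.addHaar_real_closedBall _ _ (by positivity), finrank_euclideanSpace_fin,
      mul_div_mul_right _ _ hc.ne']
    beta_reduce
    rw [inv_pow, inv_pow, div_inv_eq_mul]

theorem memLp_restrict_of_continuous {α F : Type*} [TopologicalSpace α] [MeasurableSpace α]
    [OpensMeasurableSpace α] [SecondCountableTopology α] [NormedAddCommGroup F]
    {μ : Measure α} {f : α → F} (hf : Continuous f) {s K : Set α} (hK : IsCompact K) (hs : s ⊆ K)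
    (hsm : MeasurableSet s) (hμ : μ s ≠ ⊤)
    (p : ℝ≥0∞) : MemLp f p (μ.restrict s) := by
  obtain ⟨C, hC⟩ := hK.exists_bound_of_continuousOn hf.continuousOn
  have : IsFiniteMeasure (μ.restrict s) := ⟨by
    rw [Measure.restrict_apply_univ]; exact hμ.lt_top⟩
  refine MemLp.of_bound hf.aestronglyMeasurable C ?_
  filter_upwards [ae_restrict_mem hsm] with x hx
  exact hC x (hs hx)

/-- A compact exhaustion of the half-space: the points of norm at most `i` at height at least
`1 / (i + 1)`. -/
def exhaustion (n i : ℕ) : Set (EuclideanSpace ℝ (Fin (n + 1))) :=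
  {x | ‖x‖ ≤ i ∧ 1 / ((i : ℝ) + 1) ≤ x (Fin.last n)}

theorem isCompact_exhaustion (i : ℕ) : IsCompact (exhaustion n i) := by
  refine (isCompact_closedBall (0 : EuclideanSpace ℝ (Fin (n + 1))) i).of_isClosed_subset
    ((isClosed_le continuous_norm continuous_const).inter
      (isClosed_le continuous_const continuous_last)) fun x hx => ?_
  simpa using hx.1

theorem exhaustion_subset_halfSpace (i : ℕ) : exhaustion n i ⊆ halfSpace n := fun _ hx =>
  lt_of_lt_of_le (by positivity) hx.2

theorem exists_subset_exhaustion {K : Set (EuclideanSpace ℝ (Fin (n + 1)))} (hK : IsCompact K)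
    (hKs : K ⊆ halfSpace n) : ∃ i, K ⊆ exhaustion n i := by
  have hcov : K ⊆ ⋃ i : ℕ, {x : EuclideanSpace ℝ (Fin (n + 1)) |
      ‖x‖ < i ∧ 1 / ((i : ℝ) + 1) < x (Fin.last n)} := by
    intro x hx
    obtain ⟨i, hi⟩ := exists_nat_gt ‖x‖
    obtain ⟨i', hi'⟩ := exists_nat_one_div_lt (show 0 < x (Fin.last n) from hKs hx)
    refine mem_iUnion.2 ⟨max i i', hi.trans_le (by simp), lt_of_le_of_lt ?_ hi'⟩
    gcongr
    simp
  have hmono : Monotone fun i : ℕ => {x : EuclideanSpace ℝ (Fin (n + 1)) |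
      ‖x‖ < i ∧ 1 / ((i : ℝ) + 1) < x (Fin.last n)} := by
    rintro i i' h x ⟨h1, h2⟩
    exact ⟨h1.trans_le (Nat.cast_le.2 h), (Nat.one_div_le_one_div h).trans_lt h2⟩
  obtain ⟨i, hi⟩ := hK.elim_directed_cover _ (fun i => (isOpen_lt continuous_norm
    continuous_const).inter (isOpen_lt continuous_const continuous_last)) hcov
    (Monotone.directed_le hmono)
  exact ⟨i, fun x hx => ⟨(hi hx).1.le, (hi hx).2.le⟩⟩

/-- The weak gradient identity passes to limits of `C¹` functions in `W^{1,p}`. -/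
theorem integral_mul_fderiv_of_tendsto_eLpNorm {p : ℝ≥0∞} (hp : 1 ≤ p)
    {u : EuclideanSpace ℝ (Fin (n + 1)) → ℝ}
    {G : EuclideanSpace ℝ (Fin (n + 1)) → EuclideanSpace ℝ (Fin (n + 1))}
    {w : ℕ → EuclideanSpace ℝ (Fin (n + 1)) → ℝ} (hw : ∀ k, ContDiff ℝ 1 (w k))
    {φ : EuclideanSpace ℝ (Fin (n + 1)) → ℝ} (hφ : ContDiff ℝ 1 φ) (hφc : HasCompactSupport φ)
    (hφs : tsupport φ ⊆ halfSpace n)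
    (hu : MemLp u p (volume.restrict (tsupport φ)))
    (hG : MemLp G p (volume.restrict (tsupport φ)))
    (h₁ : Tendsto (fun k => eLpNorm (fun x => w k x - u x) p (volume.restrict (tsupport φ)))
      atTop (𝓝 0))
    (h₂ : Tendsto (fun k => eLpNorm (fun x => gradient (w k) x - G x) p
      (volume.restrict (tsupport φ))) atTop (𝓝 0)) (i : Fin (n + 1)) :
    ∫ x in halfSpace n, u x * fderiv ℝ φ x (EuclideanSpace.single i 1) =
      -∫ x in halfSpace n, G x i * φ x := by
  have hK : IsCompact (tsupport φ) := hφc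
  have : IsFiniteMeasure (volume.restrict (tsupport φ)) := ⟨by simpa using hK.measure_lt_top⟩
  have hdc : Continuous fun x => fderiv ℝ φ x (EuclideanSpace.single i 1) :=
    (hφ.continuous_fderiv one_ne_zero).clm_apply continuous_const
  have hds : HasCompactSupport fun x => fderiv ℝ φ x (EuclideanSpace.single i 1) :=
    hφc.fderiv_apply (𝕜 := ℝ) _
  have hφ0 : ∀ x, x ∉ tsupport φ → φ x = 0 := fun x hx => image_eq_zero_of_notMem_tsupport hx
  have hdφ0 : ∀ x, x ∉ tsupport φ → fderiv ℝ φ x (EuclideanSpace.single i 1) = 0 := fun x hx => by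
    rw [image_eq_zero_of_notMem_tsupport fun h' => hx (tsupport_fderiv_subset ℝ h')]
    rfl
  have hwd : ∀ k, Continuous fun x => fderiv ℝ (w k) x (EuclideanSpace.single i 1) := fun k =>
    ((hw k).continuous_fderiv one_ne_zero).clm_apply continuous_const
  obtain ⟨C, hC⟩ := hφc.exists_bound_of_continuous hφ.continuous
  obtain ⟨C', hC'⟩ := hds.exists_bound_of_continuous hdc
  have l1 : Tendsto (fun k => ∫ x in tsupport φ, w k x * fderiv ℝ φ x (EuclideanSpace.single i 1))
      atTop (𝓝 (∫ x in tsupport φ, u x * fderiv ℝ φ x (EuclideanSpace.single i 1))) :=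
    tendsto_integral_mul_of_tendsto_eLpNorm hp (fun k => (hw k).continuous.aestronglyMeasurable)
      hu h₁ hdc.aestronglyMeasurable hC'
  have l2 : Tendsto (fun k => ∫ x in tsupport φ,
      fderiv ℝ (w k) x (EuclideanSpace.single i 1) * φ x) atTop
      (𝓝 (∫ x in tsupport φ, G x i * φ x)) := by
    refine tendsto_integral_mul_of_tendsto_eLpNorm hp (fun k => (hwd k).aestronglyMeasurable)
      ⟨(EuclideanSpace.proj i : _ →L[ℝ] ℝ).continuous.comp_aestronglyMeasurable hG.1,
        (eLpNorm_apply_le _ _).trans_lt hG.2⟩ ?_ hφ.continuous.aestronglyMeasurable hC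
    refine tendsto_of_tendsto_of_tendsto_of_le_of_le tendsto_const_nhds h₂
      (fun _ => zero_le) fun k => ?_
    refine le_of_eq_of_le (eLpNorm_congr_ae (ae_of_all _ fun x => ?_)) (eLpNorm_apply_le _ i)
    simp [gradient_apply]
  have hset : ∀ (s : Set (EuclideanSpace ℝ (Fin (n + 1)))) (f : EuclideanSpace ℝ (Fin (n + 1)) → ℝ),
      tsupport φ ⊆ s → (∀ x, x ∉ tsupport φ → f x = 0) →
      ∫ x in tsupport φ, f x = ∫ x in s, f x := fun s f hs hf => by
    rw [setIntegral_eq_integral_of_forall_compl_eq_zero hf,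
      setIntegral_eq_integral_of_forall_compl_eq_zero fun x hx => hf x fun h => hx (hs h)]
  have hk : ∀ k, ∫ x in tsupport φ, w k x * fderiv ℝ φ x (EuclideanSpace.single i 1) =
      -∫ x in tsupport φ, fderiv ℝ (w k) x (EuclideanSpace.single i 1) * φ x := by
    intro k
    rw [setIntegral_eq_integral_of_forall_compl_eq_zero fun x hx => by rw [hdφ0 x hx, mul_zero],
      setIntegral_eq_integral_of_forall_compl_eq_zero fun x hx => by rw [hφ0 x hx, mul_zero]]
    refine integral_mul_fderiv_eq_neg_fderiv_mul_of_integrable ?_ ?_ ?_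
      (fun x _ => (hw k).differentiable one_ne_zero x) fun x _ => hφ.differentiable one_ne_zero x
    · exact ((hwd k).mul hφ.continuous).integrable_of_hasCompactSupport hφc.mul_left
    · exact ((hw k).continuous.mul hdc).integrable_of_hasCompactSupport hds.mul_left
    · exact ((hw k).continuous.mul hφ.continuous).integrable_of_hasCompactSupport hφc.mul_left
  simp only [hk] at l1
  have h := tendsto_nhds_unique l1 l2.neg
  rwa [hset _ _ hφs fun x hx => by rw [hdφ0 x hx, mul_zero],
    hset _ _ hφs fun x hx => by rw [hφ0 x hx, mul_zero]] at h

theorem gradient_sub_of_eventuallyEq {f g h : EuclideanSpace ℝ (Fin (n + 1)) → ℝ}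
    {h' : EuclideanSpace ℝ (Fin (n + 1)) →L[ℝ] ℝ} {x : EuclideanSpace ℝ (Fin (n + 1))}
    (hf : DifferentiableAt ℝ f x) (hg : DifferentiableAt ℝ g x) (hh : HasFDerivAt h h' x)
    (heq : (fun y => f y - g y) =ᶠ[𝓝 x] h) : ‖gradient f x - gradient g x‖ = ‖h'‖ := by
  rw [gradient, gradient, ← map_sub, LinearIsometryEquiv.norm_map,
    ← ((hf.hasFDerivAt.sub hg.hasFDerivAt).congr_of_eventuallyEq heq.symm).unique hh]

/-- Geometric convergence of the mollifications of a weak solution, in `W^{1,p}` on compact subsets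
of the half-space and in `L^p` on bounded parts of the hyperplanes `{x_N = ε}`, for `p = 1 + 1 / N`.
The kernels at scale `2^{-j}` have size `2^{j(N-2)}`, with gradients of size `2^{j(N-1)}`. In the
notation of `exists_geometric_bound`, `(e, d)` is `(N - 2, N)` for functions, `(N - 1, N)` for
gradients, which is the extremal case, and `(N - 2, N - 1)` for traces. -/
theorem DyadicMollifier.exists_bounds (M : DyadicMollifier n) (hn : 1 ≤ n)
    {m : LocalRadonMeasure (halfSpace n)} {ν : LocalRadonMeasure (EuclideanSpace ℝ (Fin n))}
    {u : EuclideanSpace ℝ (Fin (n + 1)) → ℝ} (hu : IsWeakSolution m ν u)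
    {K : Set (EuclideanSpace ℝ (Fin (n + 1)))} (hK : IsCompact K) (hKs : K ⊆ halfSpace n) :
    (∃ B ≠ ⊤, ∃ J, ∀ j ≥ J, eLpNorm (fun x => M.mollify u (j + 1) x - M.mollify u j x)
      (ENNReal.ofReal (((n : ℝ) + 2) / (n + 1))) (volume.restrict K) ≤
        B * ENNReal.ofReal (2 ^ (-(1 / ((n : ℝ) + 2)))) ^ j) ∧
    (∃ B ≠ ⊤, ∃ J, ∀ j ≥ J,
      eLpNorm (fun x => gradient (M.mollify u (j + 1)) x - gradient (M.mollify u j) x)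
      (ENNReal.ofReal (((n : ℝ) + 2) / (n + 1))) (volume.restrict K) ≤
        B * ENNReal.ofReal (2 ^ (-(1 / ((n : ℝ) + 2)))) ^ j) ∧
    ∀ (ε : ℝ) (s : Set (EuclideanSpace ℝ (Fin n))), MeasurableSet s →
      (∀ x' ∈ s, point x' ε ∈ K) → ∃ B ≠ ⊤, ∃ J, ∀ j ≥ J,
      eLpNorm (fun x' => M.mollify u (j + 1) (point x' ε) - M.mollify u j (point x' ε))
      (ENNReal.ofReal (((n : ℝ) + 2) / (n + 1))) (volume.restrict s) ≤
        B * ENNReal.ofReal (2 ^ (-(1 / ((n : ℝ) + 2)))) ^ j := by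
  obtain ⟨σ₁, σ₂, hσ₁, hσ₂, V, J, hV, hKV, hpot⟩ := M.exists_potential hu hK hKs
  obtain ⟨l, rfl⟩ : ∃ l, n = l + 1 := ⟨n - 1, by omega⟩
  have hkc : ∀ j, Continuous (M.k j) := fun j => (M.contDiff_k j).continuous
  have hKm := hK.measurableSet
  refine ⟨?_, ?_, fun ε s hs hsK => ?_⟩
  · obtain ⟨B, hB, h⟩ := exists_geometric_bound (n := l + 1) (e := l + 1 - 1) (d := l + 1 + 1)
      (by rw [Nat.add_sub_cancel]; nlinarith) hkc M.k_eq_zero M.abs_k_le σ₁ σ₂ volume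
      (A := volume (Metric.ball 0 1)) measure_ball_lt_top.ne fun y r hr =>
        volume_closedBall_le _ y hr
    refine ⟨B, hB, J, fun j hj => le_trans ?_ (h j)⟩
    refine le_trans (le_of_eq (eLpNorm_congr_ae ?_)) (eLpNorm_mono_measure _ Measure.restrict_le_self)
    filter_upwards [ae_restrict_mem hKm] with x hx
    exact hpot j hj x (hKV hx)
  · have : ProperSpace (EuclideanSpace ℝ (Fin (l + 1 + 1)) →L[ℝ] ℝ) :=
      FiniteDimensional.proper ℝ _
    have hdk : ∀ j, Continuous (fderiv ℝ (M.k j)) := fun j =>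
      (M.contDiff_k j).continuous_fderiv two_ne_zero
    obtain ⟨B, hB, h⟩ := exists_geometric_bound (n := l + 1) (e := l + 1) (d := l + 1 + 1)
      (by nlinarith) hdk M.fderiv_k_eq_zero M.norm_fderiv_k_le σ₁ σ₂ volume
      (A := volume (Metric.ball 0 1)) measure_ball_lt_top.ne fun y r hr =>
        volume_closedBall_le _ y hr
    refine ⟨B, hB, J, fun j hj => le_trans ?_ (h j)⟩
    refine le_trans (le_of_eq (eLpNorm_congr_norm_ae ?_))
      (eLpNorm_mono_measure _ Measure.restrict_le_self)
    filter_upwards [ae_restrict_mem hKm] with x hx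
    have hd := fun (σ : Measure (EuclideanSpace ℝ (Fin (l + 1 + 1)))) [IsFiniteMeasure σ] =>
      hasFDerivAt_potential ((M.contDiff_k j).of_le one_le_two) (M.norm_fderiv_k_le j)
        (M.abs_k_le j) σ x
    refine gradient_sub_of_eventuallyEq ((M.contDiff_mollify hu.2.1 _).differentiable one_ne_zero x)
      ((M.contDiff_mollify hu.2.1 _).differentiable one_ne_zero x) ((hd σ₁).sub (hd σ₂)) ?_
    filter_upwards [hV.mem_nhds (hKV hx)] with y hy
    exact hpot j hj y hy
  · obtain ⟨B, hB, h⟩ := exists_geometric_bound (n := l + 1) (e := l + 1 - 1) (d := l + 1)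
      (by rw [Nat.add_sub_cancel]; nlinarith) hkc M.k_eq_zero M.abs_k_le σ₁ σ₂
      (volume.map fun x' : EuclideanSpace ℝ (Fin (l + 1)) => point x' ε)
      (A := volume (Metric.ball 0 1)) measure_ball_lt_top.ne fun y r hr =>
        map_point_closedBall_le ε y hr
    refine ⟨B, hB, J, fun j hj => le_trans ?_ (h j)⟩
    have hc : Continuous fun x => (∫ y, M.k j (x - y) ∂σ₁) - ∫ y, M.k j (x - y) ∂σ₂ :=
      (continuous_potential (hkc j) (M.abs_k_le j) σ₁).sub
        (continuous_potential (hkc j) (M.abs_k_le j) σ₂)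
    rw [eLpNorm_map_measure hc.aestronglyMeasurable (continuous_point ε).measurable.aemeasurable]
    refine le_trans (le_of_eq (eLpNorm_congr_ae ?_)) (eLpNorm_mono_measure _ Measure.restrict_le_self)
    filter_upwards [ae_restrict_mem hs] with x' hx'
    exact hpot j hj _ (hKV (hsK x' hx'))

/-- A weak solution belongs to `W^{1,p}_loc` for some `p > 1` and has Sobolev traces. -/
theorem IsWeakSolution.exists_isSobolevTrace (hn : 1 ≤ n)
    {m : LocalRadonMeasure (halfSpace n)} {ν : LocalRadonMeasure (EuclideanSpace ℝ (Fin n))}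
    {u : EuclideanSpace ℝ (Fin (n + 1)) → ℝ} (hu : IsWeakSolution m ν u) :
    ∃ p : ℝ≥0, 1 < p ∧ (∃ G, IsW1pLoc p u G) ∧
      ∃ U : ℝ → EuclideanSpace ℝ (Fin n) → ℝ, ∀ ε > 0, IsSobolevTrace p u ε (U ε) := by
  obtain ⟨M⟩ := nonempty_dyadicMollifier hn
  set p : ℝ≥0 := (((n : ℝ) + 2) / (n + 1)).toNNReal with hpdef
  have hpe : (p : ℝ≥0∞) = ENNReal.ofReal (((n : ℝ) + 2) / (n + 1)) := rfl
  have hp1 : 1 < p := by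
    rw [hpdef, Real.one_lt_toNNReal, one_lt_div (by positivity)]
    linarith
  have hp : (1 : ℝ≥0∞) ≤ p := by exact_mod_cast hp1.le
  have hr := ofReal_two_rpow_neg_lt_one n
  have hw : ∀ j, ContDiff ℝ 1 (M.mollify u j) := M.contDiff_mollify hu.2.1
  have hwg : ∀ j, Continuous (gradient (M.mollify u j)) := fun j =>
    (InnerProductSpace.toDual ℝ _).symm.continuous.comp ((hw j).continuous_fderiv one_ne_zero)
  have hKc : ∀ i, IsCompact (exhaustion n i) := isCompact_exhaustion
  have hKs : ∀ i, exhaustion n i ⊆ halfSpace n := exhaustion_subset_halfSpace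
  have hKm : ∀ i, MeasurableSet (exhaustion n i) := fun i => (hKc i).measurableSet
  have hmem : ∀ {F : Type} [NormedAddCommGroup F] {f : EuclideanSpace ℝ (Fin (n + 1)) → F},
      Continuous f → ∀ i, MemLp f p (volume.restrict (exhaustion n i)) := fun hf i =>
    memLp_restrict_of_continuous hf (hKc i) subset_rfl (hKm i) (hKc i).measure_lt_top.ne _
  obtain ⟨v, hv⟩ := exists_tendsto_eLpNorm_restrict hp hKm (f := fun j => M.mollify u j)
    (fun i j => hmem (hw j).continuous i) hr fun i => (M.exists_bounds hn hu (hKc i) (hKs i)).1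
  obtain ⟨G, hG⟩ := exists_tendsto_eLpNorm_restrict hp hKm
    (f := fun j => gradient (M.mollify u j))
    (fun i j => hmem (hwg j) i) hr fun i => (M.exists_bounds hn hu (hKc i) (hKs i)).2.1
  have hp0 : (p : ℝ≥0∞) ≠ 0 := (zero_lt_one.trans_le hp).ne'
  -- The limit in `L^p` is `u`, since the mollifications converge to `u` almost everywhere.
  have hvu : ∀ i, v =ᵐ[volume.restrict (exhaustion n i)] u := fun i => by
    have : IsFiniteMeasure (volume.restrict (exhaustion n i)) :=
      ⟨by rw [Measure.restrict_apply_univ]; exact (hKc i).measure_lt_top⟩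
    refine tendstoInMeasure_ae_unique (tendstoInMeasure_of_tendsto_eLpNorm hp0
      (fun j => (hw j).continuous.aestronglyMeasurable) (hv i).1.1 (hv i).2)
      (tendstoInMeasure_of_tendsto_ae (fun j => (hw j).continuous.aestronglyMeasurable) ?_)
    rw [ae_restrict_iff' (hKm i)]
    exact (M.ae_tendsto_mollify hu.2.1).mono fun x hx hxi => hx (hKs i hxi)
  have hui : ∀ i, MemLp u p (volume.restrict (exhaustion n i)) := fun i =>
    (memLp_congr_ae (hvu i)).1 (hv i).1
  have hulim : ∀ i, Tendsto (fun j => eLpNorm (fun x => M.mollify u j x - u x) p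
      (volume.restrict (exhaustion n i))) atTop (𝓝 0) := fun i =>
    (hv i).2.congr fun j => eLpNorm_congr_ae <| by
      filter_upwards [hvu i] with x hx
      rw [hx]
  have hle : ∀ K : Set (EuclideanSpace ℝ (Fin (n + 1))), IsCompact K → K ⊆ halfSpace n →
      ∃ i, volume.restrict K ≤ volume.restrict (exhaustion n i) := fun K hK hKh => by
    obtain ⟨i, hi⟩ := exists_subset_exhaustion hK hKh
    exact ⟨i, Measure.restrict_mono hi le_rfl⟩
  have hconv : ∀ K : Set (EuclideanSpace ℝ (Fin (n + 1))), IsCompact K → K ⊆ halfSpace n →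
      Tendsto (fun k => eLpNorm (fun x => M.mollify u k x - u x) p (volume.restrict K)) atTop
        (𝓝 0) ∧
      Tendsto (fun k => eLpNorm (fun x => gradient (M.mollify u k) x - G x) p (volume.restrict K))
        atTop (𝓝 0) := fun K hK hKh => by
    obtain ⟨i, hi⟩ := hle K hK hKh
    exact ⟨tendsto_of_tendsto_of_tendsto_of_le_of_le tendsto_const_nhds (hulim i)
        (fun _ => zero_le) fun k => eLpNorm_mono_measure _ hi,
      tendsto_of_tendsto_of_tendsto_of_le_of_le tendsto_const_nhds (hG i).2
        (fun _ => zero_le) fun k => eLpNorm_mono_measure _ hi⟩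
  have hW : IsW1pLoc p u G := by
    have hu' : ∀ K : Set (EuclideanSpace ℝ (Fin (n + 1))), IsCompact K → K ⊆ halfSpace n →
        MemLp u p (volume.restrict K) := fun K hK hKh => by
      obtain ⟨i, hi⟩ := hle K hK hKh
      exact (hui i).mono_measure hi
    have hG' : ∀ K : Set (EuclideanSpace ℝ (Fin (n + 1))), IsCompact K → K ⊆ halfSpace n →
        MemLp G p (volume.restrict K) := fun K hK hKh => by
      obtain ⟨i, hi⟩ := hle K hK hKh
      exact (hG i).1.mono_measure hi
    refine ⟨hu', hG', fun φ hφ hφc hφs i => ?_⟩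
    exact integral_mul_fderiv_of_tendsto_eLpNorm hp hw (hφ.of_le (by exact_mod_cast le_top)) hφc
      hφs (hu' _ hφc hφs) (hG' _ hφc hφs) (hconv _ hφc hφs).1 (hconv _ hφc hφs).2 i
  have htrace : ∀ ε : ℝ, ∃ g, 0 < ε → IsSobolevTrace p u ε g := by
    intro ε
    by_cases hε : 0 < ε
    · have hbm : ∀ i : ℕ, MeasurableSet (Metric.ball (0 : EuclideanSpace ℝ (Fin n)) i) :=
        fun i => Metric.isOpen_ball.measurableSet
      obtain ⟨g, hg⟩ := exists_tendsto_eLpNorm_restrict hp hbm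
        (f := fun j x' => M.mollify u j (point x' ε))
        (fun i j => memLp_restrict_of_continuous ((hw j).continuous.comp (continuous_point ε))
          (isCompact_closedBall 0 i) Metric.ball_subset_closedBall (hbm i)
          measure_ball_lt_top.ne _) hr
        fun i => (M.exists_bounds hn hu (K := (fun x' => point x' ε) '' Metric.closedBall 0 i)
          ((isCompact_closedBall 0 _).image (continuous_point ε)) (by
            rintro _ ⟨x', -, rfl⟩
            rwa [halfSpace, mem_ofPred_eq, point_last])).2.2 ε _ (hbm i)
            fun x' hx' => ⟨x', Metric.ball_subset_closedBall hx', rfl⟩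
      have hball : ∀ R : ℝ, ∃ i : ℕ, volume.restrict (Metric.ball (0 : EuclideanSpace ℝ (Fin n)) R) ≤
          volume.restrict (Metric.ball 0 (i : ℝ)) := fun R =>
        ⟨⌈R⌉₊, Measure.restrict_mono (Metric.ball_subset_ball (Nat.le_ceil R)) le_rfl⟩
      refine ⟨g, fun _ => ⟨fun R => ?_, G, hW, M.mollify u, fun k => (hw k).contDiffOn, hconv,
        fun R => ?_⟩⟩
      · obtain ⟨i, hi⟩ := hball R
        exact (hg i).1.mono_measure hi
      · obtain ⟨i, hi⟩ := hball R
        exact tendsto_of_tendsto_of_tendsto_of_le_of_le tendsto_const_nhds (hg i).2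
          (fun _ => zero_le) fun k => eLpNorm_mono_measure _ hi
    · exact ⟨0, fun h => absurd h hε⟩
  choose U hU using htrace
  exact ⟨p, hp1, ⟨G, hW⟩, U, hU⟩

end HalfSpaceProblem

end

theorem mainTheorem10 (n : ℕ) (hn : 2 ≤ n + 1)
    (μ₁ : LocalRadonMeasure (HalfSpaceProblem.halfSpace n))
    (ν₁ : LocalRadonMeasure (EuclideanSpace ℝ (Fin n)))
    (u : EuclideanSpace ℝ (Fin (n + 1)) → ℝ)
    (hu : HalfSpaceProblem.IsWeakSubsolution μ₁ ν₁ u) :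
    ((∀ R > (0 : ℝ), ∃ M > (0 : ℝ), ∃ δ > (0 : ℝ), ∀ᵐ x ∂(volume :
          Measure (EuclideanSpace ℝ (Fin (n + 1)))),
        ‖HalfSpaceProblem.tangential x‖ < R → 0 < x (Fin.last n) → x (Fin.last n) < δ → u x ≤ M) →
      ∃ ν, HalfSpaceProblem.HasLimTrace u ν) ∧
    ((∀ R > (0 : ℝ), ∃ M > (0 : ℝ), ∃ δ > (0 : ℝ), ∀ ε : ℝ, 0 < ε → ε < δ →
        ∀ (p : ℝ≥0) (g : EuclideanSpace ℝ (Fin n) → ℝ), 1 < p →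
          HalfSpaceProblem.IsSobolevTrace p u ε g → ∫ x' in Metric.ball 0 R, |g x'| < M) →
      ∃ ν, HalfSpaceProblem.HasLimTrace u ν) ∧
    (∀ ν, HalfSpaceProblem.HasLimTrace u ν →
      ν ≤ ν₁ ∧
      ∃ lam : LocalRadonMeasure (HalfSpaceProblem.halfSpace n),
        lam.IsPositive ∧ HalfSpaceProblem.IsWeightedLocal lam ∧
        HalfSpaceProblem.IsWeakSolution (μ₁ + lam) ν u) := by
  obtain ⟨lam, ν₀, hlam, hlamw, hν₀, hsol⟩ := hu.exists_isWeakSolution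
  have htrace : ∃ ν, HalfSpaceProblem.HasLimTrace u ν := by
    obtain ⟨p, hp, hW, U, hU⟩ := hsol.exists_isSobolevTrace (by omega)
    exact ⟨ν₀, p, hp, hW, U, hU, fun ψ hψ hψc => hsol.tendsto_trace hp.le hU hψ hψc⟩
  refine ⟨fun _ => htrace, fun _ => htrace, fun ν ⟨p, hp, _, U, hU, hlim⟩ => ?_⟩
  -- A lim-trace has the same integrals as `ν₀` against functions in `C²_c`, hence in `C_c`.
  have heq : ∀ f : EuclideanSpace ℝ (Fin n) → ℝ, Continuous f → HasCompactSupport f →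
      ν.integral f = ν₀.integral f := fun f hf hfc =>
    HalfSpaceProblem.integral_eq_of_forall_contDiff (fun ψ hψ hψc =>
      tendsto_nhds_unique (hlim ψ hψ hψc) (hsol.tendsto_trace hp.le hU hψ hψc)) hf hfc
  refine ⟨fun f hf hfc hf0 => (heq f hf hfc).trans_le (hν₀ f hf hfc hf0), lam, hlam, hlamw,
    hsol.1, hsol.2.1, fun φ hφ => ?_⟩
  rw [heq _ (HalfSpaceProblem.continuous_normalDeriv hφ.contDiff) hφ.hasCompactSupport_normalDeriv]
  exact hsol.2.2 φ hφ
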